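/- **Theorem.** Let $n\ge 0$, $p\ge 1$, $G=GL(n,\mathbb C)$, $NG(r)=G^r$ with face maps $\varepsilon_i:G^{r}\to G^{r-1}$, $\varepsilon_0(h_1,\dots,h_r)=(h_2,\dots,h_r)$, $\varepsilon_i(h_1,\dots,h_r)=(h_1,\dots,h_ih_{i+1},\dots,h_r)$ for $0<i<r$, $\varepsilon_r(h_1,\dots,h_r)=(h_1,\dots,h_{r-1})$. *The complexes.* Let $\Omega^{r,s}_{\rm loc}(NG)=\varinjlim_{1\in V\subset G^r}\Omega^s(V)$ (germs at $1$ of smooth complex-valued $s$-forms), with $d'=\sum_i(-1)^i\varepsilon_i^*$, $d''=(-1)^r d$ and total differential $d'+d''$. Let $F^p\Omega_{\rm loc}^*$ be the subcomplex of forms of degree $s\ge p$ and $\sigma_{<p}\Omega^*_{\rm loc}$ the quotient complex of forms of degree $s<p$. The exact sequence $0\to F^p\Omega^*_{\rm loc}\to\Omega^*_{\rm loc}\to\sigma_{<p}\Omega^*_{\rm loc}\to0$ gives the boundary map $\beta:H^{l}(NG,\sigma_{<p}\Omega^*_{\rm loc})\to H^{l+1}(NG,F^p\Omega^*_{\rm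 loc})$. *The Chern character.* On $\Delta^m\times G^{m+1}$, with barycentric coordinates $(t_0,\dots,t_m)$ and points $(g_0,\dots,g_m)\in G^{m+1}$, let $\theta=\sum_i t_i\,g_i^{-1}dg_i$ and $\Omega=d\theta+\theta\wedge\theta$. The form $\frac1{p!}\operatorname{tr}\big((\frac{-\Omega}{2\pi i})^p\big)$ is the pull-back of a form on $\Delta^m\times G^m$ along $\gamma(g_0,\dots,g_m)=(g_0g_1^{-1},\dots,g_{m-1}g_m^{-1})$, namely of its own pull-back along the section $(h_1,\dots,h_m)\mapsto(h_1\cdots h_m,\,h_2\cdots h_m,\dots,h_m,1)$ of $\gamma$. Let $\omega_m\in\Omega^{2p-m}(G^m)$, $1\le m\le p$, be the integral over $\Delta^m$ of that form on $\Delta^m\times G^m$, and $\omega_m=0$ for $m>p$. (Here $\Delta^q$ is oriented by $dt_1\wedge\dots\wedge dt_q$ and, in integration along the fibre $\Delta^q$, the factor $dt_1\wedge\dots\wedge dt_q$ is put first.) *The maps $\sigma_l$.* Let $U\subset G$ be an open set containing $1$ (for example a contractible one). A *system of simplices in $U$* consists of open neighbourhoods $W_l\subset U^l$ of $1\in G^l$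 ($l\ge0$) with $\varepsilon_i(W_{l+1})\subset W_l$ for all $i$, and smooth maps $\sigma_l:\Delta^l\times W_l\to U$ such that $\sigma_0(pt)=1$ and, with $\varepsilon^j:\Delta^{l-1}\to\Delta^l$ the $j$-th face, $$\sigma_l(\varepsilon^j t;h_1,\dots,h_l)=\begin{cases}\sigma_{l-1}(t;\varepsilon_j(h_1,\dots,h_l)) & j\ge1,\\ h_1\,\sigma_{l-1}(t;h_2,\dots,h_l)& j=0.\end{cases}$$ *The cochain $\eta$.* For $m\ge1$, $q\ge0$ put $f_{m,q}(t;h_1,\dots,h_{m+q-1})=(h_1,\dots,h_{m-1},\sigma_q(t;h_m,\dots,h_{m+q-1}))\in G^m$, $\beta_{m,q}=(-1)^m\int_{\Delta^q}f_{m,q}^*\omega_m$, a $(2p-m-q)$-form near $1\in G^{m+q-1}$, and $\eta_l=\sum_{m+q=2p-l,\ m\ge1}\beta_{m,q}$ for $0\le l\le p-1$, an $l$-form near $1\in G^{2p-1-l}$. *Claim.* Systems of simplices in $U$ exist. For every such system, the germs at $1$ of the $\eta_l$ and of the $\omega_m$ are germs of smooth forms, $\omega_1+\dots+\omega_p$ is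 a cocycle of $F^p\Omega^*_{\rm loc}(NG)$ of degree $2p$, $\eta=\eta_0+\dots+\eta_{p-1}$ is a cocycle of $\sigma_{<p}\Omega^*_{\rm loc}(NG)$ of degree $2p-1$, and $$\beta[\eta]=[\omega_1+\dots+\omega_p]\quad\text{in } H^{2p}(NG,F^p\Omega^*_{\rm loc}).$$ -/

import Mathlib

open Filter CategoryTheory
open scoped Topology ContDiff

namespace SimplicialDeRham

section Forms

/-! ### Differential forms on normed spaces and their germs -/

variable {E F H : Type} [NormedAddCommGroup E] [NormedSpace ℝ E]
  [NormedAddCommGroup F] [NormedSpace ℝ F] [NormedAddCommGroup H] [NormedSpace ℝ H]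

/-- Differential forms of degree `s` on `E`, with values in `F`. -/
abbrev DiffForm (E F : Type) [NormedAddCommGroup E] [NormedSpace ℝ E] [NormedAddCommGroup F]
    [NormedSpace ℝ F] (s : ℕ) : Type := E → E [⋀^Fin s]→L[ℝ] F

/-- A form of degree `a`, seen as a form of degree `b = a`. -/
def castDegree {a b : ℕ} (h : a = b) (α : DiffForm E F a) : DiffForm E F b := h ▸ α

/-- The pull-back `f^* α` of a differential form. -/
noncomputable def pullback {s : ℕ} (f : E → F) (α : DiffForm F ℂ s) : DiffForm E ℂ s :=
  fun x => (α (f x)).compContinuousLinearMap (fderiv ℝ f x)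

/-- The pull-back `f^* α` of a differential form along a map given on a set `S`. -/
noncomputable def pullbackWithin {s : ℕ} (f : E → F) (S : Set E) (α : DiffForm F ℂ s) :
    DiffForm E ℂ s :=
  fun x => (α (f x)).compContinuousLinearMap (fderivWithin ℝ f S x)

/-- The form is smooth on a neighbourhood of `x`. -/
def SmoothNear {s : ℕ} (x : E) (α : DiffForm E ℂ s) : Prop :=
  ∀ᶠ y in 𝓝 x, ContDiffAt ℝ ∞ α y

/-- Germs at `x` of smooth complex-valued `s`-forms, i.e. the direct limit of the spaces of
smooth `s`-forms on the open neighbourhoods of `x`. -/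
def GermForm (x : E) (s : ℕ) : Submodule ℂ (Germ (𝓝 x) (E [⋀^Fin s]→L[ℝ] ℂ)) where
  carrier := {g | ∃ α : DiffForm E ℂ s, SmoothNear x α ∧ (α : Germ (𝓝 x) _) = g}
  add_mem' := by
    rintro _ _ ⟨α, hα, rfl⟩ ⟨β, hβ, rfl⟩
    refine ⟨α + β, ?_, rfl⟩
    filter_upwards [hα, hβ] with y h1 h2 using h1.add h2
  zero_mem' := ⟨0, Eventually.of_forall fun _ => contDiffAt_const, rfl⟩
  smul_mem' := by
    rintro c _ ⟨α, hα, rfl⟩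
    refine ⟨c • α, ?_, rfl⟩
    filter_upwards [hα] with y h1 using h1.const_smul c

lemma SmoothNear.extDeriv {s : ℕ} {x : E} {α : DiffForm E ℂ s} (hα : SmoothNear x α) :
    SmoothNear x (extDeriv α) := by
  filter_upwards [hα] with y hy
  have h1 : ContDiffAt ℝ ∞ (fderiv ℝ α) y := hy.fderiv_right (by simp)
  exact (ContinuousAlternatingMap.alternatizeUncurryFinCLM ℝ E ℂ).contDiff.contDiffAt.comp y h1

lemma contDiff_alternatization (s : ℕ) :
    ContDiff ℝ ∞ (ContinuousMultilinearMap.alternatization :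
      ContinuousMultilinearMap ℝ (fun _ : Fin s => E) ℂ →+ E [⋀^Fin s]→L[ℝ] ℂ) := by
  let L : ContinuousMultilinearMap ℝ (fun _ : Fin s => E) ℂ →ₗ[ℝ] E [⋀^Fin s]→L[ℝ] ℂ :=
    { toFun := ContinuousMultilinearMap.alternatization
      map_add' := map_add _
      map_smul' := fun c f => by
        ext v
        simp [ContinuousMultilinearMap.alternatization_apply_apply, Finset.mul_sum,
          Units.smul_def, mul_left_comm] }
  refine (L.mkContinuous (∑ _σ : Equiv.Perm (Fin s), 1) fun f => ?_).contDiff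
  rw [← ContinuousAlternatingMap.norm_toContinuousMultilinearMap]
  change ‖∑ σ : Equiv.Perm (Fin s), Equiv.Perm.sign σ • f.domDomCongr σ‖ ≤ _
  rw [Finset.sum_mul]
  refine norm_sum_le_of_le _ fun σ _ => ?_
  rcases Int.units_eq_one_or (Equiv.Perm.sign σ) with h | h <;>
    simp [h, Units.smul_def, ContinuousMultilinearMap.norm_domDomCongr]

lemma SmoothNear.pullback {s : ℕ} {x : E} {f : E → F} (hf : ContDiff ℝ ∞ f)
    {α : DiffForm F ℂ s} (hα : SmoothNear (f x) α) : SmoothNear x (pullback f α) := by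
  have := hf.continuous.continuousAt.eventually hα
  filter_upwards [this] with y hy
  have h1 : ContDiffAt ℝ ∞ (fderiv ℝ f) y := hf.contDiffAt.fderiv_right (by simp)
  have h2 : ContDiffAt ℝ ∞ (fun y => α (f y)) y := ContDiffAt.comp y hy hf.contDiffAt
  have h3 : SimplicialDeRham.pullback f α = fun y => ((s.factorial : ℝ)⁻¹) •
      ContinuousMultilinearMap.alternatization
        (ContinuousMultilinearMap.compContinuousLinearMapContinuousMultilinear ℝ
          (fun _ : Fin s => E) (fun _ : Fin s => F) ℂ (fun _ => fderiv ℝ f y)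
          (ContinuousAlternatingMap.toContinuousMultilinearMapCLM ℝ (α (f y)))) := by
    funext y
    ext v
    rw [ContinuousAlternatingMap.smul_apply,
      ContinuousMultilinearMap.alternatization_apply_apply]
    have h4 : ∀ σ : Equiv.Perm (Fin s), Equiv.Perm.sign σ •
        (ContinuousMultilinearMap.compContinuousLinearMapContinuousMultilinear ℝ
          (fun _ : Fin s => E) (fun _ : Fin s => F) ℂ (fun _ => fderiv ℝ f y)
          (ContinuousAlternatingMap.toContinuousMultilinearMapCLM ℝ (α (f y)))) (v ∘ σ) =
        SimplicialDeRham.pullback f α y v := fun σ => by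
      have h5 := (SimplicialDeRham.pullback f α y).toAlternatingMap.map_perm v σ
      change Equiv.Perm.sign σ • SimplicialDeRham.pullback f α y (v ∘ σ) = _
      change SimplicialDeRham.pullback f α y (v ∘ σ) = _ at h5
      rw [h5]
      change _ • _ • SimplicialDeRham.pullback f α y v = _
      rw [smul_smul, Int.units_mul_self, one_smul]
    rw [Finset.sum_congr rfl fun σ _ => h4 σ]
    have h' : (s.factorial : ℂ) ≠ 0 := by exact_mod_cast s.factorial_ne_zero
    simp [Fintype.card_perm, h']
  rw [h3]
  have h5 : ContDiff ℝ ∞ (fun g : Fin s → (E →L[ℝ] F) =>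
      ContinuousMultilinearMap.compContinuousLinearMapContinuousMultilinear ℝ
        (fun _ : Fin s => E) (fun _ : Fin s => F) ℂ g) :=
    ContinuousMultilinearMap.contDiff _
  have h6 := h5.contDiffAt.comp y (contDiffAt_pi.2 fun _ : Fin s => h1)
  have h8 : ContDiff ℝ ∞ (fun a : F [⋀^Fin s]→L[ℝ] ℂ =>
      ContinuousAlternatingMap.toContinuousMultilinearMapCLM ℝ a) :=
    ContinuousLinearMap.contDiff _
  have h7 := h8.contDiffAt.comp y h2
  exact ((contDiff_alternatization s).contDiffAt.comp y (h6.clm_apply h7)).const_smul _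

/-- The exterior differential on germs of forms. -/
noncomputable def germExtDeriv (x : E) (s : ℕ) : GermForm x s →ₗ[ℂ] GermForm x (s + 1) where
  toFun g := ⟨g.1.map' extDeriv (fun _ _ h => h.extDeriv), by
    obtain ⟨_, α, hα, rfl⟩ := g
    exact ⟨extDeriv α, hα.extDeriv, rfl⟩⟩
  map_add' := by
    rintro ⟨_, α, hα, rfl⟩ ⟨_, β, hβ, rfl⟩
    refine Subtype.ext (Germ.coe_eq.2 ?_)
    filter_upwards [hα, hβ] with y h1 h2
    exact extDeriv_add (h1.differentiableAt (by simp)) (h2.differentiableAt (by simp))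
  map_smul' := by
    rintro c ⟨_, α, hα, rfl⟩
    refine Subtype.ext (Germ.coe_eq.2 ?_)
    filter_upwards [hα] with y h1
    have h2 : fderiv ℝ (c • α) y = c • fderiv ℝ α y :=
      ((h1.differentiableAt (by simp)).hasFDerivAt.const_smul c).fderiv
    ext v
    change (ContinuousAlternatingMap.alternatizeUncurryFin (fderiv ℝ (c • α) y)) v = _
    rw [h2]
    simp [extDeriv, ContinuousAlternatingMap.alternatizeUncurryFin_apply, Finset.mul_sum]

/-- The pull-back of germs of forms along a smooth map. -/
noncomputable def germPullback (f : E → F) (hf : ContDiff ℝ ∞ f) (x : E) (y : F) (hxy : f x = y)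
    (s : ℕ) : GermForm y s →ₗ[ℂ] GermForm x s where
  toFun g := ⟨g.1.map' (pullback f) (fun α β h => by
      have h1 : Tendsto f (𝓝 x) (𝓝 y) := hxy ▸ hf.continuous.continuousAt
      filter_upwards [h1.eventually h] with z hz
      simp only [pullback, hz]), by
    obtain ⟨_, α, hα, rfl⟩ := g
    subst hxy
    exact ⟨pullback f α, hα.pullback hf, rfl⟩⟩
  map_add' := by
    rintro ⟨_, α, hα, rfl⟩ ⟨_, β, hβ, rfl⟩
    rfl
  map_smul' := by
    rintro c ⟨_, α, hα, rfl⟩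
    rfl

lemma two_le : minSmoothness ℝ 2 ≤ (∞ : WithTop ℕ∞) := by
  rw [minSmoothness_of_isRCLikeNormedField]
  exact WithTop.coe_le_coe.2 (le_top : (2 : ℕ∞) ≤ ⊤)

lemma germExtDeriv_germExtDeriv (x : E) (s : ℕ) (g : GermForm x s) :
    germExtDeriv x (s + 1) (germExtDeriv x s g) = 0 := by
  obtain ⟨_, α, hα, rfl⟩ := g
  refine Subtype.ext (Germ.coe_eq.2 ?_)
  filter_upwards [hα] with y hy
  exact extDeriv_extDeriv_apply hy two_le

lemma germExtDeriv_germPullback (f : E → F) (hf : ContDiff ℝ ∞ f) (x : E) (y : F)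
    (hxy : f x = y) (s : ℕ) (g : GermForm y s) :
    germExtDeriv x s (germPullback f hf x y hxy s g) =
      germPullback f hf x y hxy (s + 1) (germExtDeriv y s g) := by
  obtain ⟨_, α, hα, rfl⟩ := g
  subst hxy
  refine Subtype.ext (Germ.coe_eq.2 ?_)
  filter_upwards [hf.continuous.continuousAt.eventually hα] with z hz
  exact extDeriv_pullback (r := ∞) (hz.differentiableAt (by simp)) hf.contDiffAt two_le

lemma germPullback_germPullback (f : E → F) (hf : ContDiff ℝ ∞ f) (f' : F → H)
    (hf' : ContDiff ℝ ∞ f') (x : E) (y : F) (z : H) (hxy : f x = y) (hyz : f' y = z) (s : ℕ)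
    (g : GermForm z s) :
    germPullback f hf x y hxy s (germPullback f' hf' y z hyz s g) =
      germPullback (f' ∘ f) (hf'.comp hf) x z (by simp [hxy, hyz]) s g := by
  obtain ⟨_, α, hα, rfl⟩ := g
  refine Subtype.ext (Germ.coe_eq.2 (Eventually.of_forall fun w => ?_))
  simp only [pullback]
  rw [fderiv_comp w (hf'.differentiable (by simp) _) (hf.differentiable (by simp) _)]
  rfl

end Forms

section Local

/-! ### The nerve of `GL(n, ℂ)` and its local simplicial de Rham complex

`G = GL(n, ℂ)` is the open subset of invertible matrices in the vector space of all matrices, and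
`NG(r) = G ^ r` is an open subset of the space `MatTuple n r` of `r`-tuples of matrices. -/

/-- The algebra of complex `n × n` matrices, with the operator norm for the sup norm on `ℂ ^ n`.
(All norms give the same smooth functions.) -/
def Mat (n : ℕ) : Type := Matrix (Fin n) (Fin n) ℂ

noncomputable instance (n : ℕ) : NormedRing (Mat n) :=
  Matrix.linftyOpNormedRing (n := Fin n) (α := ℂ)

noncomputable instance (n : ℕ) : NormedAlgebra ℝ (Mat n) :=
  Matrix.linftyOpNormedAlgebra (n := Fin n) (α := ℂ) (R := ℝ)

instance (n : ℕ) : FiniteDimensional ℝ (Mat n) :=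
  inferInstanceAs (FiniteDimensional ℝ (Matrix (Fin n) (Fin n) ℂ))

instance (n : ℕ) : CompleteSpace (Mat n) := FiniteDimensional.complete ℝ _

/-- The space of `r`-tuples of complex `n × n` matrices. -/
abbrev MatTuple (n r : ℕ) : Type := Fin r → Mat n

/-- The face operators `ε_i : G ^ (r + 1) → G ^ r`, `0 ≤ i ≤ r + 1`, of the nerve. -/
def face {M : Type} [Monoid M] {r : ℕ} (i : ℕ) (h : Fin (r + 1) → M) : Fin r → M :=
  fun k => if (k : ℕ) + 1 < i then h k.castSucc
    else if (k : ℕ) + 1 = i then h k.castSucc * h k.succ else h k.succ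

lemma face_one {M : Type} [Monoid M] {r : ℕ} (i : ℕ) :
    face i (1 : Fin (r + 1) → M) = 1 := by
  funext k
  simp [face]

lemma face_face {M : Type} [Monoid M] {r : ℕ} {i j : ℕ} (hij : i ≤ j) (h : Fin (r + 2) → M) :
    face i (face (j + 1) h) = face j (face i h) := by
  funext k
  rcases eq_or_lt_of_le hij with rfl | hij <;>
  · simp only [face, Fin.val_castSucc, Fin.val_succ, Fin.succ_castSucc]
    split_ifs <;> first | rfl | omega | simp only [mul_assoc]

lemma contDiff_face {n r : ℕ} (i : ℕ) :
    ContDiff ℝ ∞ (face i : MatTuple n (r + 1) → MatTuple n r) := by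
  refine contDiff_pi.2 fun k => ?_
  unfold face
  split_ifs
  · fun_prop
  · exact (contDiff_apply ℝ _ _).mul (contDiff_apply ℝ _ _)
  · fun_prop

/-- Families consisting of a germ at `1 ∈ G ^ r` of an `s`-form for all `r` and `s`. -/
@[ext]
structure BiForm (n : ℕ) : Type where
  /-- the component in `Ω^{r,s}` -/
  app : (r s : ℕ) → GermForm (1 : MatTuple n r) s

namespace BiForm

instance (n : ℕ) : CoeFun (BiForm n) fun _ => (r s : ℕ) → GermForm (1 : MatTuple n r) s := ⟨app⟩

/-- A family of germs of forms is just a function. -/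
def equivFun (n : ℕ) : BiForm n ≃ ((r s : ℕ) → GermForm (1 : MatTuple n r) s) where
  toFun := app
  invFun := mk
  left_inv _ := rfl
  right_inv _ := rfl

noncomputable instance (n : ℕ) : AddCommGroup (BiForm n) := (equivFun n).addCommGroup

noncomputable instance (n : ℕ) : Module ℂ (BiForm n) := (equivFun n).module ℂ

@[simp] lemma add_apply {n : ℕ} (x y : BiForm n) (r s : ℕ) : (x + y) r s = x r s + y r s := rfl

@[simp] lemma smul_apply {n : ℕ} (c : ℂ) (x : BiForm n) (r s : ℕ) :
    (c • x) r s = c • x r s := rfl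

@[simp] lemma zero_apply {n : ℕ} (r s : ℕ) : (0 : BiForm n) r s = 0 := rfl

lemma ext' {n : ℕ} {x y : BiForm n} (h : ∀ r s, x r s = y r s) : x = y :=
  BiForm.ext (funext fun r => funext fun s => h r s)

end BiForm

/-- The pull-back `ε_i^*` on germs of forms. -/
noncomputable def facePullback (n r s i : ℕ) :
    GermForm (1 : MatTuple n r) s →ₗ[ℂ] GermForm (1 : MatTuple n (r + 1)) s :=
  germPullback (face i) (contDiff_face i) 1 1 (face_one i) s

/-- `d' = ∑ (-1) ^ i ε_i^*`. -/
noncomputable def dHor (n : ℕ) : BiForm n →ₗ[ℂ] BiForm n where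
  toFun x := ⟨fun
    | 0, _ => 0
    | r + 1, s => ∑ i ∈ Finset.range (r + 2), (-1 : ℂ) ^ i • facePullback n r s i (x r s)⟩
  map_add' x y := by
    refine BiForm.ext' fun r s => ?_
    cases r <;> simp [Finset.sum_add_distrib]
  map_smul' c x := by
    refine BiForm.ext' fun r s => ?_
    cases r
    · simp
    · simp [Finset.smul_sum, smul_comm c]

/-- `d'' = (-1) ^ r d` on forms on `G ^ r`. -/
noncomputable def dVert (n : ℕ) : BiForm n →ₗ[ℂ] BiForm n where
  toFun x := ⟨fun
    | _, 0 => 0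
    | r, s + 1 => (-1 : ℂ) ^ r • germExtDeriv 1 s (x r s)⟩
  map_add' x y := by
    refine BiForm.ext' fun r s => ?_
    cases s <;> simp
  map_smul' c x := by
    refine BiForm.ext' fun r s => ?_
    cases s
    · simp
    · simp [smul_comm c]

/-- The total differential `d' + d''`. -/
noncomputable def totalD (n : ℕ) : BiForm n →ₗ[ℂ] BiForm n := dHor n + dVert n

lemma facePullback_facePullback (n r s : ℕ) {i j : ℕ} (hij : i ≤ j)
    (g : GermForm (1 : MatTuple n r) s) :
    facePullback n (r + 1) s (j + 1) (facePullback n r s i g) =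
      facePullback n (r + 1) s i (facePullback n r s j g) := by
  unfold facePullback
  rw [germPullback_germPullback, germPullback_germPullback]
  congr 2
  funext h
  exact face_face hij h

lemma dHor_dHor (n : ℕ) (x : BiForm n) : dHor n (dHor n x) = 0 := by
  refine BiForm.ext' fun r s => ?_
  rcases r with _ | _ | r
  · rfl
  · change ∑ i ∈ Finset.range 2, (-1 : ℂ) ^ i • facePullback n 0 s i 0 = 0
    simp
  · change ∑ j ∈ Finset.range (r + 3), (-1 : ℂ) ^ j • facePullback n (r + 1) s j
      (∑ i ∈ Finset.range (r + 2), (-1 : ℂ) ^ i • facePullback n r s i (x r s)) = 0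
    simp only [map_sum, map_smul, Finset.smul_sum, smul_smul, ← pow_add]
    rw [← Finset.sum_product']
    refine Finset.sum_involution
      (fun p _ => if p.2 < p.1 then (p.2, p.1 - 1) else (p.2 + 1, p.1)) ?_ ?_ ?_ ?_
    · rintro ⟨j, i⟩ -
      dsimp only
      split_ifs with h
      · obtain ⟨j, rfl⟩ : ∃ k, j = k + 1 := ⟨j - 1, by omega⟩
        rw [facePullback_facePullback n r s (by omega : i ≤ j), Nat.add_sub_cancel, ← add_smul]
        convert zero_smul ℂ _
        ring
      · rw [facePullback_facePullback n r s (by omega : j ≤ i), ← add_smul]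
        convert zero_smul ℂ _
        ring
    · rintro ⟨j, i⟩ - - h
      dsimp only at h
      split_ifs at h <;> simp only [Prod.mk.injEq] at h <;> omega
    · rintro ⟨j, i⟩ h
      simp only [Finset.mem_product, Finset.mem_range] at h ⊢
      split_ifs <;> simp only <;> omega
    · rintro ⟨j, i⟩ h
      dsimp only
      split_ifs <;> simp only [Prod.mk.injEq, true_and, and_true] <;> omega

lemma dVert_dVert (n : ℕ) (x : BiForm n) : dVert n (dVert n x) = 0 := by
  refine BiForm.ext' fun r s => ?_
  rcases s with _ | _ | s
  · rfl
  · change (-1 : ℂ) ^ r • germExtDeriv 1 0 0 = 0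
    simp
  · change (-1 : ℂ) ^ r • germExtDeriv 1 (s + 1) ((-1 : ℂ) ^ r • germExtDeriv 1 s (x r s)) = 0
    simp [germExtDeriv_germExtDeriv]

lemma dHor_dVert (n : ℕ) (x : BiForm n) : dHor n (dVert n x) + dVert n (dHor n x) = 0 := by
  refine BiForm.ext' fun r s => ?_
  rcases r with _ | r <;> rcases s with _ | s
  · exact add_zero 0
  · change 0 + (-1 : ℂ) ^ 0 • germExtDeriv 1 s 0 = 0
    simp
  · change (∑ i ∈ Finset.range (r + 2), (-1 : ℂ) ^ i • facePullback n r 0 i 0) + 0 = 0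
    simp
  · change (∑ i ∈ Finset.range (r + 2), (-1 : ℂ) ^ i • facePullback n r (s + 1) i
      ((-1 : ℂ) ^ r • germExtDeriv 1 s (x r s))) + (-1 : ℂ) ^ (r + 1) • germExtDeriv 1 s
      (∑ i ∈ Finset.range (r + 2), (-1 : ℂ) ^ i • facePullback n r s i (x r s)) = 0
    simp only [map_sum, map_smul, Finset.smul_sum, smul_smul]
    rw [← Finset.sum_add_distrib]
    refine Finset.sum_eq_zero fun i _ => ?_
    unfold facePullback
    rw [germExtDeriv_germPullback, ← add_smul]
    convert zero_smul ℂ _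
    ring

lemma totalD_totalD (n : ℕ) (x : BiForm n) : totalD n (totalD n x) = 0 := by
  have h := dHor_dVert n x
  simp only [totalD, LinearMap.add_apply, map_add, dHor_dHor, dVert_dVert, zero_add, add_zero]
  rw [add_comm]
  exact h

/-- The total degree `l` part, with form degrees `s` in `S`, of the double complex. -/
def cochains (n : ℕ) (S : Set ℕ) (l : ℕ) : Submodule ℂ (BiForm n) where
  carrier := {x | ∀ r s, ¬ (r + s = l ∧ s ∈ S) → x r s = 0}
  add_mem' hx hy r s h := by simp [hx r s h, hy r s h]
  zero_mem' _ _ _ := rfl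
  smul_mem' c x hx r s h := by simp [hx r s h]

open Classical in
/-- The projection onto the part of total degree `l` with form degrees in `S`. -/
noncomputable def cochainsProj (n : ℕ) (S : Set ℕ) (l : ℕ) : BiForm n →ₗ[ℂ] cochains n S l where
  toFun x := ⟨⟨fun r s => if r + s = l ∧ s ∈ S then x r s else 0⟩, fun r s h => if_neg h⟩
  map_add' x y := by
    refine Subtype.ext (BiForm.ext' fun r s => ?_)
    by_cases h : r + s = l ∧ s ∈ S <;> simp [h]
  map_smul' c x := by
    refine Subtype.ext (BiForm.ext' fun r s => ?_)
    by_cases h : r + s = l ∧ s ∈ S <;> simp [h]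

lemma cochainsProj_apply_of (n : ℕ) (S : Set ℕ) (l : ℕ) (x : BiForm n) {r s : ℕ}
    (h : r + s = l ∧ s ∈ S) : (cochainsProj n S l x).1 r s = x r s := if_pos h

lemma cochainsProj_apply_of_not (n : ℕ) (S : Set ℕ) (l : ℕ) (x : BiForm n) {r s : ℕ}
    (h : ¬ (r + s = l ∧ s ∈ S)) : (cochainsProj n S l x).1 r s = 0 := if_neg h

/-- `d' + d''`, followed by the projection that discards the form degrees outside `S`. It raises
the total degree by one, so that it vanishes unless `l' = l + 1`. -/
noncomputable def cochainsD (n : ℕ) (S : Set ℕ) (l l' : ℕ) : cochains n S l →ₗ[ℂ] cochains n S l' :=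
  cochainsProj n S l' ∘ₗ totalD n ∘ₗ (cochains n S l).subtype

lemma totalD_congr (n : ℕ) {x y : BiForm n} {r s : ℕ}
    (h1 : ∀ r', r' + 1 = r → x r' s = y r' s) (h2 : ∀ s', s' + 1 = s → x r s' = y r s') :
    totalD n x r s = totalD n y r s := by
  change dHor n x r s + dVert n x r s = dHor n y r s + dVert n y r s
  congr 1
  · cases r with
    | zero => rfl
    | succ r =>
      change ∑ i ∈ Finset.range (r + 2), (-1 : ℂ) ^ i • facePullback n r s i (x r s) =
        ∑ i ∈ Finset.range (r + 2), (-1 : ℂ) ^ i • facePullback n r s i (y r s)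
      rw [h1 r rfl]
  · cases s with
    | zero => rfl
    | succ s =>
      change (-1 : ℂ) ^ r • germExtDeriv 1 s (x r s) = (-1 : ℂ) ^ r • germExtDeriv 1 s (y r s)
      rw [h2 s rfl]

lemma totalD_eq_zero (n : ℕ) {x : BiForm n} {r s : ℕ}
    (h1 : ∀ r', r' + 1 = r → x r' s = 0) (h2 : ∀ s', s' + 1 = s → x r s' = 0) :
    totalD n x r s = 0 :=
  (totalD_congr n (y := 0) h1 h2).trans (by rw [map_zero]; rfl)

lemma cochainsD_shape (n : ℕ) (S : Set ℕ) (l l' : ℕ) (h : l + 1 ≠ l') : cochainsD n S l l' = 0 := by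
  refine LinearMap.ext fun x => Subtype.ext (BiForm.ext' fun r s => ?_)
  by_cases hrs : r + s = l' ∧ s ∈ S
  · refine (cochainsProj_apply_of n S l' _ hrs).trans (totalD_eq_zero n ?_ ?_)
    · rintro r' rfl
      exact x.2 _ _ fun hx => h (by omega)
    · rintro s' rfl
      exact x.2 _ _ fun hx => h (by omega)
  · exact cochainsProj_apply_of_not n S l' _ hrs

/-- Restricting the form degrees from `T` to a subset `S` commutes with the differentials as soon
as the part of the double complex with form degrees in `T \ S` is preserved by them. -/
lemma cochainsD_comm (n : ℕ) {S T : Set ℕ} (hST : S ⊆ T)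
    (hS : ∀ s, s ∈ T → s + 1 ∈ S → s ∈ S) (l l' : ℕ) (x : cochains n T l) :
    cochainsProj n S l' (cochainsD n T l l' x).1 =
      cochainsD n S l l' (cochainsProj n S l x.1) := by
  by_cases h : l + 1 = l'
  swap
  · rw [cochainsD_shape n T l l' h, cochainsD_shape n S l l' h]
    exact map_zero _
  subst h
  refine Subtype.ext (BiForm.ext' fun r s => ?_)
  by_cases hrs : r + s = l + 1 ∧ s ∈ S
  swap
  · exact (cochainsProj_apply_of_not n S _ _ hrs).trans
      (cochainsProj_apply_of_not n S _ _ hrs).symm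
  refine (cochainsProj_apply_of n S _ _ hrs).trans
    ((cochainsProj_apply_of n T _ _ ⟨hrs.1, hST hrs.2⟩).trans
      (Eq.trans ?_ (cochainsProj_apply_of n S _ _ hrs).symm))
  refine totalD_congr n ?_ ?_
  · rintro r' rfl
    exact (cochainsProj_apply_of n S _ _ ⟨by omega, hrs.2⟩).symm
  · rintro s' rfl
    by_cases hs : s' ∈ S
    · exact (cochainsProj_apply_of n S _ _ ⟨by omega, hs⟩).symm
    · refine Eq.trans (x.2 _ _ fun hx => hs (hS s' hx.2 hrs.2))
        (cochainsProj_apply_of_not n S _ _ fun hx => hs hx.2).symm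

lemma cochainsD_cochainsD (n : ℕ) (S : Set ℕ) [hS : S.OrdConnected] (i j k : ℕ)
    (hij : i + 1 = j) (hjk : j + 1 = k) (x : cochains n S i) :
    cochainsD n S j k (cochainsD n S i j x) = 0 := by
  subst hij hjk
  refine Subtype.ext (BiForm.ext' fun r s => ?_)
  by_cases hrs : r + s = i + 1 + 1 ∧ s ∈ S
  swap
  · exact cochainsProj_apply_of_not n S _ _ hrs
  refine (cochainsProj_apply_of n S _ _ hrs).trans
    (Eq.trans ?_ (congrArg (fun y : BiForm n => y r s) (totalD_totalD n x.1)))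
  refine totalD_congr n ?_ ?_
  · rintro r' rfl
    exact cochainsProj_apply_of n S _ _ ⟨by omega, hrs.2⟩
  · rintro s' rfl
    by_cases hs : s' ∈ S
    · exact cochainsProj_apply_of n S _ _ ⟨by omega, hs⟩
    · refine (cochainsProj_apply_of_not n S _ _ fun hx => hs hx.2).trans
        (totalD_eq_zero n ?_ ?_).symm
      · rintro r' rfl
        exact x.2 _ _ fun hx => hs hx.2
      · rintro s'' rfl
        exact x.2 _ _ fun hx => hs (hS.out hx.2 hrs.2 ⟨by omega, by omega⟩)

/-- The total complex of the local simplicial de Rham complex, cut down to the form degrees in an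
interval `S`. -/
noncomputable def locComplex (n : ℕ) (S : Set ℕ) [S.OrdConnected] :
    CochainComplex (ModuleCat.{0} ℂ) ℕ where
  X l := ModuleCat.of ℂ (cochains n S l)
  d l l' := ModuleCat.ofHom (cochainsD n S l l')
  shape l l' h := by
    rw [cochainsD_shape n S l l' h]
    rfl
  d_comp_d' i j k hij hjk := by
    refine ModuleCat.hom_ext (LinearMap.ext fun x => ?_)
    exact cochainsD_cochainsD n S i j k hij hjk x

/-- The complex `Ω_loc^*(NG)`. -/
noncomputable abbrev omegaLoc (n : ℕ) : CochainComplex (ModuleCat.{0} ℂ) ℕ :=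
  locComplex n Set.univ

/-- The filtration `F^p Ω_loc^*(NG)`: forms of degree `s ≥ p`. -/
noncomputable abbrev filteredLoc (n p : ℕ) : CochainComplex (ModuleCat.{0} ℂ) ℕ :=
  locComplex n (Set.Ici p)

/-- The truncation `σ_{<p} Ω_loc^*(NG)`: forms of degree `s < p`. -/
noncomputable abbrev truncatedLoc (n p : ℕ) : CochainComplex (ModuleCat.{0} ℂ) ℕ :=
  locComplex n (Set.Iio p)

/-- The inclusion `F^p Ω_loc → Ω_loc`. -/
noncomputable def filteredIncl (n p : ℕ) : filteredLoc n p ⟶ omegaLoc n where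
  f l := ModuleCat.ofHom (Submodule.inclusion (p := cochains n (Set.Ici p) l)
    (p' := cochains n Set.univ l) fun x hx r s h => hx r s fun h' => h ⟨h'.1, trivial⟩)
  comm' l l' h := by
    cases h
    ext x
    refine Subtype.ext (BiForm.ext' fun r s => ?_)
    change (cochainsProj n Set.univ (l + 1) (totalD n x.1)).1 r s =
      (cochainsProj n (Set.Ici p) (l + 1) (totalD n x.1)).1 r s
    by_cases hrs : r + s = l + 1 ∧ s ∈ Set.Ici p
    · rw [cochainsProj_apply_of n _ _ _ hrs, cochainsProj_apply_of n _ _ _ ⟨hrs.1, Set.mem_univ s⟩]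
    · rw [cochainsProj_apply_of_not n _ _ _ hrs]
      by_cases hl : r + s = l + 1
      · rw [cochainsProj_apply_of n _ _ _ ⟨hl, Set.mem_univ s⟩]
        have hs : ¬ p ≤ s := fun h' => hrs ⟨hl, h'⟩
        refine totalD_eq_zero n ?_ ?_
        · rintro r' rfl
          exact x.2 _ _ fun hx => hs hx.2
        · rintro s' rfl
          exact x.2 _ _ fun hx => hs (le_trans (Set.mem_Ici.1 hx.2) (Nat.le_succ _))
      · exact cochainsProj_apply_of_not n _ _ _ fun h' => hl h'.1

/-- The projection `Ω_loc → σ_{<p} Ω_loc`. -/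
noncomputable def truncatedProj (n p : ℕ) : omegaLoc n ⟶ truncatedLoc n p where
  f l := ModuleCat.ofHom (cochainsProj n (Set.Iio p) l ∘ₗ (cochains n Set.univ l).subtype)
  comm' l l' h := by
    ext x
    exact (cochainsD_comm n (Set.subset_univ (Set.Iio p))
      (fun s _ hs => lt_of_le_of_lt (Nat.le_succ s) hs) l l' x).symm

/-- The sequence `0 → F^p Ω_loc → Ω_loc → σ_{<p} Ω_loc → 0`. -/
noncomputable def locSequence (n p : ℕ) : ShortComplex (CochainComplex (ModuleCat.{0} ℂ) ℕ) :=
  ShortComplex.mk (filteredIncl n p) (truncatedProj n p) (by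
    ext l x
    refine Subtype.ext (BiForm.ext' fun r s => ?_)
    by_cases hrs : r + s = l ∧ s ∈ Set.Iio p
    · refine (cochainsProj_apply_of n _ _ _ hrs).trans ?_
      exact x.2 _ _ fun hx => not_lt_of_ge (Set.mem_Ici.1 hx.2) hrs.2
    · exact cochainsProj_apply_of_not n _ _ _ hrs)

lemma locSequence_shortExact (n p : ℕ) : (locSequence n p).ShortExact := by
  refine HomologicalComplex.shortExact_of_degreewise_shortExact _ fun l => ?_
  refine ModuleCat.shortComplex_shortExact _ ?_ ?_ ?_
  · intro x
    constructor
    · intro hx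
      refine ⟨⟨x.1, fun r s h => ?_⟩, rfl⟩
      by_cases hl : r + s = l
      · have hs : s < p := not_le.1 fun h' => h ⟨hl, h'⟩
        have h1 := congrArg (fun y : cochains n (Set.Iio p) l => y.1 r s) hx
        exact (cochainsProj_apply_of n _ _ _ ⟨hl, hs⟩).symm.trans h1
      · exact x.2 _ _ fun h' => hl h'.1
    · rintro ⟨y, rfl⟩
      refine Subtype.ext (BiForm.ext' fun r s => ?_)
      by_cases hrs : r + s = l ∧ s ∈ Set.Iio p
      · refine (cochainsProj_apply_of n _ _ _ hrs).trans ?_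
        exact y.2 _ _ fun hx => not_lt_of_ge (Set.mem_Ici.1 hx.2) hrs.2
      · exact cochainsProj_apply_of_not n _ _ _ hrs
  · intro x y hxy
    refine Subtype.ext ?_
    exact congrArg (fun z : cochains n Set.univ l => z.1) hxy
  · intro x
    refine ⟨⟨x.1, fun r s h => x.2 r s fun h' => h ⟨h'.1, trivial⟩⟩, Subtype.ext (BiForm.ext' fun r s => ?_)⟩
    by_cases hrs : r + s = l ∧ s ∈ Set.Iio p
    · exact cochainsProj_apply_of n _ _ _ hrs
    · exact (cochainsProj_apply_of_not n _ _ _ hrs).trans (x.2 _ _ hrs).symm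

/-- The boundary map `β : H^l(σ_{<p} Ω_loc) → H^{l'}(F^p Ω_loc)`, `l' = l + 1`. -/
noncomputable def boundaryMap (n p l l' : ℕ) (h : l + 1 = l') :
    (truncatedLoc n p).homology l ⟶ (filteredLoc n p).homology l' :=
  (locSequence_shortExact n p).δ l l' h

/-- The cohomology class of a cocycle. -/
noncomputable def cohomologyClass (K : CochainComplex (ModuleCat.{0} ℂ) ℕ) (l : ℕ) (x : K.X l)
    (hx : K.d l (l + 1) x = 0) : K.homology l :=
  K.homologyπ l (K.cyclesMk x (l + 1) (by simp) hx)

end Local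

section FiberIntegral

/-! ### Simplices and integration along the fibres `Δ^q`

The standard simplex `Δ^q` is parametrized by the barycentric coordinates `(t_1, …, t_q)`, with
`t_0 = 1 - t_1 - ⋯ - t_q`; it is oriented by `dt_1 ∧ ⋯ ∧ dt_q`. -/

/-- The standard simplex `Δ^q`. -/
def simplex (q : ℕ) : Set (Fin q → ℝ) := {t | (∀ i, 0 ≤ t i) ∧ ∑ i, t i ≤ 1}

/-- All barycentric coordinates `(t_0, …, t_q)`. -/
def bary {q : ℕ} (t : Fin q → ℝ) : Fin (q + 1) → ℝ := Fin.cons (1 - ∑ i, t i) t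

/-- The face operator `ε^j : Δ^q → Δ^{q+1}`, inserting `0` as the `j`-th barycentric coordinate. -/
def coface {q : ℕ} (j : Fin (q + 2)) (t : Fin q → ℝ) : Fin (q + 1) → ℝ :=
  Fin.tail (j.insertNth (α := fun _ => ℝ) 0 (bary t))

variable {E : Type} [NormedAddCommGroup E] [NormedSpace ℝ E]

lemma append_update_contract {q s : ℕ} [DecidableEq (Fin s)] (u : Fin q → (Fin q → ℝ) × E)
    (v : Fin s → E) (i : Fin s) (x : E) :
    Fin.append u (fun j => ((0 : Fin q → ℝ), Function.update v i x j)) =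
      Function.update (Fin.append u (fun j => (0, v j))) (Fin.natAdd q i) (0, x) := by
  funext k
  refine Fin.addCases (fun k => ?_) (fun k => ?_) k
  · rw [Function.update_of_ne, Fin.append_left, Fin.append_left]
    intro h
    have := congrArg Fin.val h
    simp only [Fin.val_castAdd, Fin.val_natAdd] at this
    omega
  · rw [Fin.append_right]
    by_cases hk : k = i
    · subst hk
      simp
    · rw [Function.update_of_ne hk, Function.update_of_ne (by simpa using hk), Fin.append_right]

/-- The contraction of an alternating form on `ℝ^q × E` with the standard basis of `ℝ^q`, in the
first `q` slots: `(v_1, …, v_s) ↦ α(∂_{t_1}, …, ∂_{t_q}, v_1, …, v_s)`. -/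
noncomputable def contractSimplex (q s : ℕ) (α : ((Fin q → ℝ) × E) [⋀^Fin (q + s)]→L[ℝ] ℂ) :
    E [⋀^Fin s]→L[ℝ] ℂ where
  toFun v := α (Fin.append (fun i => (Pi.single i 1, 0)) (fun j => (0, v j)))
  map_update_add' v i x y := by
    simp only [append_update_contract]
    rw [← α.map_update_add]
    simp
  map_update_smul' v i c x := by
    simp only [append_update_contract]
    rw [← α.map_update_smul]
    simp
  map_eq_zero_of_eq' v i j hij hne :=
    α.map_eq_zero_of_eq _ (i := Fin.natAdd q i) (j := Fin.natAdd q j) (by simp [hij])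
      (by simpa using hne)
  cont := by
    refine α.cont.comp (continuous_pi fun i => ?_)
    refine Fin.addCases (fun i => ?_) (fun j => ?_) i
    · simp only [Fin.append_left]
      fun_prop
    · simp only [Fin.append_right]
      fun_prop

/-- Integration along the fibre `Δ^q` of a form on `Δ^q × E`, with the convention
`∫_{Δ^q} (a dt_1 ∧ ⋯ ∧ dt_q ∧ γ) = (∫_{Δ^q} a dt_1 ⋯ dt_q) γ`. -/
noncomputable def fiberIntegral (q s : ℕ)
    (α : DiffForm ((Fin q → ℝ) × E) ℂ (q + s)) : DiffForm E ℂ s :=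
  fun x => ∫ t in simplex q, contractSimplex q s (α (t, x))

end FiberIntegral

section Wedge

/-! ### Wedge products of forms with values in an algebra -/

variable {V A : Type} [NormedAddCommGroup V] [NormedSpace ℝ V] [NormedRing A] [NormedAlgebra ℝ A]

/-- The multilinear map `(v_1, …, v_{k+l}) ↦ a(v_1, …, v_k) b(v_{k+1}, …, v_{k+l})`. -/
noncomputable def tensorMul {k l : ℕ} (a : V [⋀^Fin k]→L[ℝ] A) (b : V [⋀^Fin l]→L[ℝ] A) :
    ContinuousMultilinearMap ℝ (fun _ : Fin (k + l) => V) A where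
  toMultilinearMap := (LinearMap.mul' ℝ A).compMultilinearMap
    ((MultilinearMap.domCoprod a.toMultilinearMap b.toMultilinearMap).domDomCongr finSumFinEquiv)
  cont := by
    change Continuous fun v : Fin (k + l) → V =>
      a (fun i => v (Fin.castAdd l i)) * b (fun j => v (Fin.natAdd k j))
    fun_prop

lemma tensorMul_apply {k l : ℕ} (a : V [⋀^Fin k]→L[ℝ] A) (b : V [⋀^Fin l]→L[ℝ] A)
    (v : Fin (k + l) → V) :
    tensorMul a b v = a (fun i => v (Fin.castAdd l i)) * b (fun j => v (Fin.natAdd k j)) := rfl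

/-- The wedge product of algebra-valued alternating forms,
`(a ∧ b)(v) = 1/(k! l!) ∑_σ sgn(σ) a(v_{σ 1}, …, v_{σ k}) b(v_{σ (k+1)}, …, v_{σ (k+l)})`. -/
noncomputable def wedge {k l : ℕ} (a : V [⋀^Fin k]→L[ℝ] A) (b : V [⋀^Fin l]→L[ℝ] A) :
    V [⋀^Fin (k + l)]→L[ℝ] A :=
  ((k.factorial * l.factorial : ℝ)⁻¹) • ContinuousMultilinearMap.alternatization (tensorMul a b)

/-- The `p`-th wedge power of an algebra-valued `2`-form. -/
noncomputable def wedgePow (a : V [⋀^Fin 2]→L[ℝ] A) : (p : ℕ) → V [⋀^Fin (2 * p)]→L[ℝ] A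
  | 0 => ContinuousAlternatingMap.constOfIsEmpty ℝ V (Fin 0) 1
  | p + 1 => wedge (wedgePow a p) a

/-- The curvature `dθ + ½[θ, θ] = dθ + θ ∧ θ` of a connection form `θ`. -/
noncomputable def curvatureForm (θ : DiffForm V A 1) : DiffForm V A 2 :=
  fun x => extDeriv θ x + wedge (θ x) (θ x)

/-- The form `(1/p!) tr((-Ω/(2πi))^p)`, where `Ω` is the curvature of `θ`. -/
noncomputable def chernWeilForm (tr : A →L[ℝ] ℂ) (p : ℕ) (θ : DiffForm V A 1) :
    DiffForm V ℂ (2 * p) :=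
  fun x => (1 / (p.factorial : ℂ) * (-1 / (2 * Real.pi * Complex.I)) ^ p) •
    tr.compContinuousAlternatingMap (wedgePow (curvatureForm θ x) p)

end Wedge

section ChernCharacter

/-! ### The Chern character in the simplicial de Rham complex -/

/-- The canonical connection `θ = t_0 θ_0 + ⋯ + t_m θ_m` on `Δ^m × N\bar G(m)`, where
`θ_i = g_i⁻¹ dg_i` at `(g_0, …, g_m) ∈ N\bar G(m) = G ^ (m + 1)`. -/
noncomputable def connection (n m : ℕ) :
    DiffForm ((Fin m → ℝ) × MatTuple n (m + 1)) (Mat n) 1 :=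
  fun x => ContinuousAlternatingMap.ofSubsingleton ℝ _ _ 0
    (∑ i : Fin (m + 1), bary x.1 i • (ContinuousLinearMap.mul ℝ (Mat n) (Ring.inverse (x.2 i)) ∘L
      ContinuousLinearMap.proj i ∘L ContinuousLinearMap.snd ℝ (Fin m → ℝ) (MatTuple n (m + 1))))

/-- The trace as a real-linear functional. -/
noncomputable def traceCLM (n : ℕ) : Mat n →L[ℝ] ℂ :=
  LinearMap.toContinuousLinearMap (Matrix.traceLinearMap (Fin n) ℝ ℂ : Mat n →ₗ[ℝ] ℂ)

/-- The form `(1/p!) tr((-Ω/(2πi))^p)` on `Δ^m × N\bar G(m)`. -/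
noncomputable def chernFormTotal (n p m : ℕ) :
    DiffForm ((Fin m → ℝ) × MatTuple n (m + 1)) ℂ (2 * p) :=
  chernWeilForm (traceCLM n) p (connection n m)

/-- The section `(h_1, …, h_m) ↦ (h_1 h_2 ⋯ h_m, h_2 ⋯ h_m, …, h_m, 1)` of the bundle
`γ : N\bar G(m) → NG(m)`, `γ(g_0, …, g_m) = (g_0 g_1⁻¹, …, g_{m-1} g_m⁻¹)`. -/
noncomputable def nerveSection {n m : ℕ} (h : MatTuple n m) : MatTuple n (m + 1) :=
  fun i => ((List.ofFn h).drop i).prod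

lemma gamma_nerveSection {n m : ℕ} (h : MatTuple n m) (hh : ∀ i, IsUnit (h i)) (i : Fin m) :
    nerveSection h i.castSucc * Ring.inverse (nerveSection h i.succ) = h i := by
  have h1 : nerveSection h i.castSucc = h i * nerveSection h i.succ := by
    unfold nerveSection
    rw [← List.prod_cons]
    congr 1
    rw [Fin.val_castSucc, Fin.val_succ, List.drop_eq_getElem_cons (by simp)]
    simp
  have h2 : IsUnit (nerveSection h i.succ) := by
    unfold nerveSection
    refine List.prod_isUnit fun a ha => ?_
    obtain ⟨j, rfl⟩ := (List.mem_ofFn' h a).1 (List.mem_of_mem_drop ha)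
    exact hh j
  rw [h1, mul_assoc, Ring.mul_inverse_cancel _ h2, mul_one]

/-- The component `ω_m ∈ Ω^k(NG(m))`, `m + k = 2p`, `1 ≤ m ≤ p`, of the cocycle representing the
`p`-th Chern character. The form `(1/p!) tr((-Ω/(2πi))^p)` is basic for `γ`, hence is the pull-back
by `γ` of its pull-back by the section; the latter is integrated along `Δ^m`. -/
noncomputable def chernForm (n p m k : ℕ) : DiffForm (MatTuple n m) ℂ k :=
  if h : 1 ≤ m ∧ m ≤ p ∧ 2 * p = m + k then
    fiberIntegral m k (castDegree h.2.2 <| pullback (fun y : (Fin m → ℝ) × MatTuple n m =>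
      (y.1, nerveSection y.2)) (chernFormTotal n p m))
  else 0

end ChernCharacter

section Transgression

/-! ### The cochain `η` -/

/-- Smooth maps `σ_l : Δ^l × W_l → U`, `l ≥ 0`, on open neighbourhoods `W_l ⊆ U ^ l` of `1 ∈ G ^ l`
that are mapped to each other by the face operators, with
* `σ_0(pt) = 1`;
* `σ_l(ε^j t; h) = σ_{l-1}(t; ε_j h)` for `j ≥ 1`;
* `σ_l(ε^0 t; h) = h_1 σ_{l-1}(t; h_2, …, h_l)`. -/
structure SimplexFamily (n : ℕ) (U : Set (Mat n)) where
  /-- the domains -/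
  W : (l : ℕ) → Set (MatTuple n l)
  isOpen_W : ∀ l, IsOpen (W l)
  one_mem_W : ∀ l, 1 ∈ W l
  W_subset : ∀ l, ∀ h ∈ W l, ∀ i, h i ∈ U
  face_mem_W : ∀ l, ∀ h ∈ W (l + 1), ∀ i ≤ l + 1, face i h ∈ W l
  /-- the maps; only their values on `Δ^l × W_l` matter -/
  σ : (l : ℕ) → (Fin l → ℝ) × MatTuple n l → Mat n
  contDiffOn_σ : ∀ l, ContDiffOn ℝ ∞ (σ l) (simplex l ×ˢ W l)
  σ_mem : ∀ l, ∀ t ∈ simplex l, ∀ h ∈ W l, σ l (t, h) ∈ U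
  σ_zero : ∀ t ∈ simplex 0, ∀ h ∈ W 0, σ 0 (t, h) = 1
  σ_face : ∀ l, ∀ t ∈ simplex l, ∀ h ∈ W (l + 1), ∀ j : Fin (l + 2),
    σ (l + 1) (coface j t, h) =
      if j = 0 then h 0 * σ l (t, face 0 h) else σ l (t, face j h)

variable {n : ℕ} {U : Set (Mat n)}

/-- The map `f_{m,q} : Δ^q × U^r → G^m` for `m = m' + 1` and `r = m + q - 1 = m' + q`,
`(t; h_1, …, h_r) ↦ (h_1, …, h_{m'}, σ_q(t; h_{m'+1}, …, h_r))`. -/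
noncomputable def SimplexFamily.f (S : SimplexFamily n U) {m' q r : ℕ} (hr : m' + q = r) :
    (Fin q → ℝ) × MatTuple n r → MatTuple n (m' + 1) :=
  fun x => Fin.snoc (α := fun _ => Mat n)
    (fun i : Fin m' => x.2 (Fin.cast hr (Fin.castAdd q i)))
    (S.σ q (x.1, fun j : Fin q => x.2 (Fin.cast hr (Fin.natAdd m' j))))

/-- `β_{m,q} = (-1)^m ∫_{Δ^q} f_{m,q}^* ω_m`, for `m = m' + 1`, as an `s`-form on `U^r`,
`r = m + q - 1`; here `s = 2p - m - q`, and for all other `s` it is `0`. -/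
noncomputable def SimplexFamily.beta (S : SimplexFamily n U) (p : ℕ) {m' q r : ℕ} (hr : m' + q = r)
    (s : ℕ) : DiffForm (MatTuple n r) ℂ s :=
  (-1 : ℂ) ^ (m' + 1) • fiberIntegral q s
    (pullbackWithin (S.f hr) (simplex q ×ˢ Set.univ) (chernForm n p (m' + 1) (q + s)))

/-- The form `η_s = ∑_{m + q = 2p - s, m ≥ 1} β_{m,q}` on `U^r`, `r = 2p - 1 - s`. -/
noncomputable def SimplexFamily.eta (S : SimplexFamily n U) (p r s : ℕ) :
    DiffForm (MatTuple n r) ℂ s :=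
  ∑ x : {x : ℕ × ℕ // x ∈ Finset.HasAntidiagonal.antidiagonal r}, S.beta p (Finset.HasAntidiagonal.mem_antidiagonal.1 x.2) s

end Transgression

end SimplicialDeRham

namespace SimplicialDeRham

/-! The formula for η makes sense in every form degree, and `S.eta p r s` is defined without the
bound s < p. The extended family is a lift of η from σ_{<p}Ω_loc to Ω_loc, and everything rests on
one identity of germs in Ω_loc, `SimplexFamily.totalD_eta`: (d' + d'')η = ω_1 + ⋯ + ω_p. As ω_m has
form degree 2p - m ≥ p, the right side lies in F^p. The connecting map is computed by lifting and
differentiating, so this identity gives both cocycle conditions and β[η] = [ω_1 + ⋯ + ω_p]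
(`exists_cocycles`).

The identity comes from two applications of Stokes' theorem along a simplex. The first is dω_{m+1} =
(-1)^m ∑ (-1)^i ε_i^* ω_m (`extDeriv_chernForm`). The Chern–Weil form on Δ^{m+1} × G^{m+1} is
closed, by the Bianchi identity and the cyclicity of the trace (`extDeriv_chernWeilForm`). Its
restriction to the j-th face of the simplex is the pull-back by ε_j of the form on Δ^m × G^m,
because the two connections differ by a gauge transformation (`pullback_coface_nerveChernWeil`).
Integrating along the fibre gives the formula.

The second application is to f_{m,q}^* ω_m over Δ^q (`sum_chernIntegral_face_succ`). Its
differential is known from the first, so that ∑ ± ∫ (ε_i ∘ f_{m,q})^* ω_{m-1} equals a sum over the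
faces of Δ^q plus ± d ∫ f_{m,q}^* ω_m. The axioms on σ identify the terms: ε_i ∘ f_{m,q} is
f_{m-1,q} ∘ ε_i for i ≤ m - 2; it is the 0-th face of f_{m-1,q+1} for i = m - 1; and it does not
depend on t for i = m. The j-th face of f_{m,q}, j ≥ 1, is f_{m,q-1} ∘ ε_{m-1+j}. In the alternating
sum (`sum_transgression`) the 0-th faces cancel, the pull-backs by the ε_i make up d'η, and the
t-independent terms integrate to 0 except for q = 0, where they leave ω.

Systems of simplices exist because the affine simplices with vertices 1, h_1, h_1h_2, … satisfy the
face conditions and stay in a ball inside U for h near 1. -/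

/-! ### The connecting map of the truncation sequence. -/

theorem cochains_univ_d (n l : ℕ) (x : cochains n Set.univ l) :
    ((omegaLoc n).d l (l + 1) x : cochains n Set.univ (l + 1)).1 = totalD n x.1 := by
  refine BiForm.ext' fun r s => ?_
  change (cochainsProj n Set.univ (l + 1) (totalD n x.1)).1 r s = _
  by_cases h : r + s = l + 1
  · exact cochainsProj_apply_of n _ _ _ ⟨h, trivial⟩
  · refine (cochainsProj_apply_of_not n _ _ _ (by simp [h])).trans (totalD_eq_zero n ?_ ?_).symm
    · rintro r rfl
      exact x.2 _ _ (by simp; omega)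
    · rintro s rfl
      exact x.2 _ _ (by simp; omega)

/-- The usual description of a connecting map: `y` is a lift of `x` to Ω_loc, and its differential
comes from `w` in F^p. -/
theorem boundaryMap_cohomologyClass (n p l : ℕ) (y : cochains n Set.univ l)
    (x : cochains n (Set.Iio p) l) (w : cochains n (Set.Ici p) (l + 1))
    (hx : ∀ r s, s < p → x.1 r s = y.1 r s) (hw : totalD n y.1 = w.1)
    (hdx : (truncatedLoc n p).d l (l + 1) x = 0)
    (hdw : (filteredLoc n p).d (l + 1) (l + 1 + 1) w = 0) :
    boundaryMap n p l (l + 1) rfl (cohomologyClass (truncatedLoc n p) l x hdx) =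
      cohomologyClass (filteredLoc n p) (l + 1) w hdw := by
  have := (locSequence_shortExact n p).δ_apply l (l + 1) rfl x hdx y (by
    refine Subtype.ext (BiForm.ext' fun r s => ?_)
    by_cases h : r + s = l ∧ s ∈ Set.Iio p
    · exact (cochainsProj_apply_of n _ _ _ h).trans (hx r s h.2).symm
    · exact (cochainsProj_apply_of_not n _ _ _ h).trans (x.2 r s h).symm) w
    (Subtype.ext (hw.symm.trans (cochains_univ_d n l y).symm)) (l + 1 + 1) (by simp)
  exact this

/-- The single equation `totalD n y = w` suffices. The truncation of `y` is closed because `w`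
vanishes in form degrees below `p`, and `w` is closed because the total differential squares to
zero. -/
theorem exists_cocycles (n p l : ℕ) (y : BiForm n) (w : BiForm n)
    (hy : ∀ r s, r + s ≠ l → y r s = 0) (hw : ∀ r s, s < p → w r s = 0)
    (h : totalD n y = w) :
    ∃ (η : cochains n (Set.Iio p) l) (w' : cochains n (Set.Ici p) (l + 1))
      (hη : (truncatedLoc n p).d l (l + 1) η = 0)
      (hw : (filteredLoc n p).d (l + 1) (l + 1 + 1) w' = 0),
      (∀ r s, s < p → η.1 r s = y r s) ∧ w'.1 = w ∧
        boundaryMap n p l (l + 1) rfl (cohomologyClass (truncatedLoc n p) l η hη) =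
          cohomologyClass (filteredLoc n p) (l + 1) w' hw := by
  let y' : cochains n Set.univ l := ⟨y, fun r s hrs => hy r s fun h' => hrs ⟨h', trivial⟩⟩
  have hwl : ∀ r s, r + s ≠ l + 1 → w r s = 0 := fun r s hrs => by
    rw [← h]
    refine totalD_eq_zero n ?_ ?_
    · rintro r rfl
      exact hy _ _ (by omega)
    · rintro s rfl
      exact hy _ _ (by omega)
  let w' : cochains n (Set.Ici p) (l + 1) := ⟨w, fun r s hrs => by
    by_cases hl : r + s = l + 1
    · exact hw r s (not_le.1 fun h' => hrs ⟨hl, h'⟩)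
    · exact hwl r s hl⟩
  have hxy : ∀ r s, s < p → (cochainsProj n (Set.Iio p) l y).1 r s = y r s := fun r s hs => by
    by_cases hl : r + s = l
    · exact cochainsProj_apply_of n _ _ _ ⟨hl, hs⟩
    · exact (cochainsProj_apply_of_not n _ _ _ (by simp [hl])).trans (hy r s hl).symm
  have hη : (truncatedLoc n p).d l (l + 1) (cochainsProj n (Set.Iio p) l y) = 0 := by
    refine Subtype.ext (BiForm.ext' fun r s => ?_)
    change (cochainsProj n (Set.Iio p) (l + 1)
      (totalD n (cochainsProj n (Set.Iio p) l y).1)).1 r s = 0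
    by_cases hrs : r + s = l + 1 ∧ s ∈ Set.Iio p
    -- The component of the differential in form degree s only involves form degrees s and s - 1,
    -- and the truncation keeps both when s < p.
    · rw [cochainsProj_apply_of n _ _ _ hrs, ← hw r s hrs.2, ← h]
      refine totalD_congr n ?_ ?_
      · rintro r rfl
        exact hxy _ _ hrs.2
      · rintro s rfl
        exact hxy _ _ (lt_of_le_of_lt (Nat.le_succ s) hrs.2)
    · exact cochainsProj_apply_of_not n _ _ _ hrs
  have hdw : (filteredLoc n p).d (l + 1) (l + 1 + 1) w' = 0 := by
    refine Subtype.ext (BiForm.ext' fun r s => ?_)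
    change (cochainsProj n (Set.Ici p) (l + 1 + 1) (totalD n w)).1 r s = 0
    rw [← h, totalD_totalD, map_zero]
    rfl
  exact ⟨_, w', hη, hdw, hxy, rfl,
    boundaryMap_cohomologyClass n p l y' (cochainsProj n (Set.Iio p) l y) w' hxy h hη hdw⟩

/-! ### Smoothness of forms, tested on vector fields. -/

section Smoothness

variable {X V A : Type} [NormedAddCommGroup X] [NormedSpace ℝ X] [NormedAddCommGroup V]
  [NormedSpace ℝ V] [NormedAddCommGroup A] [NormedSpace ℝ A]

/-- Encoding the vectors `w i x` as linear maps from `ℝ` turns evaluation into precomposition, which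
is multilinear in these maps and linear in `F x`; the resulting form on `ℝ` is then evaluated at 1.
-/
theorem contDiffOn_multilinear_apply {k : ℕ} {n : WithTop ℕ∞} {s : Set X}
    {F : X → ContinuousMultilinearMap ℝ (fun _ : Fin k => V) A} {w : Fin k → X → V}
    (hF : ContDiffOn ℝ n F s) (hw : ∀ i, ContDiffOn ℝ n (w i) s) :
    ContDiffOn ℝ n (fun x => F x fun i => w i x) s := by
  have h1 : ContDiff ℝ n (fun g : Fin k → (ℝ →L[ℝ] V) =>
      ContinuousMultilinearMap.compContinuousLinearMapContinuousMultilinear ℝ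
        (fun _ : Fin k => ℝ) (fun _ : Fin k => V) A g) :=
    ContinuousMultilinearMap.contDiff _
  have h2 : ContDiffOn ℝ n (fun x => fun i => ContinuousLinearMap.toSpanSingleton ℝ (w i x)) s :=
    contDiffOn_pi.2 fun i =>
      (ContinuousLinearMap.toSpanSingletonCLE (𝕜 := ℝ) (E := V)).contDiff.comp_contDiffOn (hw i)
  have h3 := (ContinuousMultilinearMap.apply ℝ (fun _ : Fin k => ℝ) A
    fun _ => 1).contDiff.comp_contDiffOn ((h1.comp_contDiffOn h2).clm_apply hF)
  refine h3.congr fun x _ => ?_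
  simp

theorem contDiffOn_form_apply {k : ℕ} {n : WithTop ℕ∞} {s : Set X}
    {F : X → V [⋀^Fin k]→L[ℝ] A} {w : Fin k → X → V}
    (hF : ContDiffOn ℝ n F s) (hw : ∀ i, ContDiffOn ℝ n (w i) s) :
    ContDiffOn ℝ n (fun x => F x fun i => w i x) s :=
  contDiffOn_multilinear_apply
    (F := fun x => ContinuousAlternatingMap.toContinuousMultilinearMapCLM ℝ (F x))
    ((ContinuousLinearMap.contDiff _).comp_contDiffOn hF) hw

/-- A form with values in a finite-dimensional space is smooth if its values on constant vector
fields are. -/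
theorem contDiffOn_form [FiniteDimensional ℝ V] [FiniteDimensional ℝ A] {k : ℕ} {n : WithTop ℕ∞}
    {s : Set X} {F : X → V [⋀^Fin k]→L[ℝ] A} (hF : ∀ v, ContDiffOn ℝ n (fun x => F x v) s) :
    ContDiffOn ℝ n F s := by
  let b := Module.finBasis ℝ V
  let L : (V [⋀^Fin k]→L[ℝ] A) →ₗ[ℝ] ((Fin k → Fin (Module.finrank ℝ V)) → A) :=
    { toFun := fun α I => α fun i => b (I i)
      map_add' := fun _ _ => rfl
      map_smul' := fun _ _ => rfl }
  -- A form is determined by its values on tuples of basis vectors, so a linear left inverse of `L`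
  -- rebuilds it smoothly from finitely many functions.
  have hL : Function.Injective L := fun α β h =>
    ContinuousAlternatingMap.toAlternatingMap_injective <|
      AlternatingMap.coe_multilinearMap_injective <|
        Module.Basis.ext_multilinear (fun _ => b) fun I => congrFun h I
  obtain ⟨R, hR⟩ := L.exists_leftInverse_of_injective (LinearMap.ker_eq_bot.2 hL)
  have h1 : ContDiffOn ℝ n (fun x => L (F x)) s := contDiffOn_pi.2 fun I => hF _
  refine ((LinearMap.toContinuousLinearMap R).contDiff.comp_contDiffOn h1).congr fun x _ => ?_
  exact (LinearMap.congr_fun hR (F x)).symm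

end Smoothness

/-! ### Differentiation under the integral over a compact set. -/

section ParametricIntegral

set_option linter.unusedSectionVars false

open MeasureTheory

variable {T E G : Type} [NormedAddCommGroup T] [NormedSpace ℝ T] [FiniteDimensional ℝ T]
  [MeasurableSpace T] [BorelSpace T] {μ : Measure T} [IsFiniteMeasureOnCompacts μ]
  [NormedAddCommGroup E] [NormedSpace ℝ E] [FiniteDimensional ℝ E]
  [NormedAddCommGroup G] [NormedSpace ℝ G]

theorem continuousOn_slice {K : Set T} {W : Set E} {F : T × E → G} (hF : ContinuousOn F (K ×ˢ W))
    {x : E} (hx : x ∈ W) : ContinuousOn (fun t => F (t, x)) K :=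
  hF.comp (by fun_prop) fun _ ht => ⟨ht, hx⟩

theorem integrableOn_slice {K : Set T} (hK : IsCompact K) {W : Set E} {F : T × E → G}
    (hF : ContinuousOn F (K ×ˢ W)) {x : E} (hx : x ∈ W) :
    IntegrableOn (fun t => F (t, x)) K μ :=
  (continuousOn_slice hF hx).integrableOn_compact hK

/-- `F` is only differentiable within `K ×ˢ W`, but as `W` is open its restriction to a slice has a
genuine derivative. -/
theorem hasFDerivAt_slice {K : Set T} {W : Set E} (hW : IsOpen W)
    {F : T × E → G} (hF : DifferentiableOn ℝ F (K ×ˢ W)) {t : T} (ht : t ∈ K) {x : E}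
    (hx : x ∈ W) :
    HasFDerivAt (fun x => F (t, x))
      ((fderivWithin ℝ F (K ×ˢ W) (t, x)) ∘L ContinuousLinearMap.inr ℝ T E) x := by
  have h1 := (hF (t, x) ⟨ht, hx⟩).hasFDerivWithinAt
  have h2 : HasFDerivWithinAt (fun x : E => (t, x)) (ContinuousLinearMap.inr ℝ T E) W x :=
    (hasFDerivAt_prodMk_right t x).hasFDerivWithinAt
  exact (h1.comp x h2 fun y hy => ⟨ht, hy⟩).hasFDerivAt (hW.mem_nhds hx)

/-- Dominated convergence: on `K` times a small closed ball the derivative is continuous on a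
compact set, hence bounded by a constant, which is integrable over `K`. -/
theorem hasFDerivAt_setIntegral {K : Set T} (hK : IsCompact K) (hKu : UniqueDiffOn ℝ K) {W : Set E}
    (hW : IsOpen W) {F : T × E → G} (hF : ContDiffOn ℝ 1 F (K ×ˢ W)) {x : E} (hx : x ∈ W) :
    HasFDerivAt (fun x => ∫ t in K, F (t, x) ∂μ)
      (∫ t in K, (fderivWithin ℝ F (K ×ˢ W) (t, x)) ∘L ContinuousLinearMap.inr ℝ T E ∂μ) x := by
  have hD : ContinuousOn (fun z => (fderivWithin ℝ F (K ×ˢ W) z) ∘L ContinuousLinearMap.inr ℝ T E)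
      (K ×ˢ W) := (hF.continuousOn_fderivWithin (hKu.prod hW.uniqueDiffOn) le_rfl).clm_comp
        continuousOn_const
  obtain ⟨r, hr, hrW⟩ := Metric.nhds_basis_closedBall.mem_iff.1 (hW.mem_nhds hx)
  obtain ⟨C, hC⟩ := (hK.prod (isCompact_closedBall x r)).exists_bound_of_continuousOn
    (hD.mono (Set.prod_mono le_rfl hrW))
  refine hasFDerivAt_integral_of_dominated_of_fderiv_le
    (F' := fun x t => (fderivWithin ℝ F (K ×ˢ W) (t, x)) ∘L ContinuousLinearMap.inr ℝ T E)
    (bound := fun _ => C)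
    (Metric.closedBall_mem_nhds x hr) ?_ ?_ ?_ ?_ ?_ ?_
  · filter_upwards [hW.mem_nhds hx] with y hy
    exact (integrableOn_slice hK hF.continuousOn hy).aestronglyMeasurable
  · exact integrableOn_slice hK hF.continuousOn hx
  · exact (integrableOn_slice hK hD hx).aestronglyMeasurable
  · filter_upwards [ae_restrict_mem hK.measurableSet] with t ht y hy using hC (t, y) ⟨ht, hy⟩
  · exact integrableOn_const hK.measure_ne_top
  · filter_upwards [ae_restrict_mem hK.measurableSet] with t ht y hy using
      hasFDerivAt_slice hW (hF.differentiableOn one_ne_zero) ht (hrW hy)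

/-- The target `G` varies in the induction, since the derivative is an integral of the same kind
with values in `E →L[ℝ] G`. -/
theorem contDiffOn_setIntegral_nat {K : Set T} (hK : IsCompact K) (hKu : UniqueDiffOn ℝ K)
    {W : Set E} (hW : IsOpen W) (n : ℕ) : ∀ {G : Type} [NormedAddCommGroup G] [NormedSpace ℝ G]
    {F : T × E → G}, ContDiffOn ℝ ∞ F (K ×ˢ W) →
    ContDiffOn ℝ n (fun x => ∫ t in K, F (t, x) ∂μ) W := by
  induction n with
  | zero =>
    intro G _ _ F hF
    exact contDiffOn_zero.2 fun x hx => (hasFDerivAt_setIntegral hK hKu hW (hF.of_le (by simp))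
      hx).continuousAt.continuousWithinAt
  | succ n ih =>
    intro G _ _ F hF
    have h1 := fun x (hx : x ∈ W) => hasFDerivAt_setIntegral (μ := μ) hK hKu hW
      (hF.of_le (by simp)) hx
    refine (contDiffOn_succ_iff_fderiv_of_isOpen hW).2
      ⟨fun x hx => (h1 x hx).differentiableAt.differentiableWithinAt,
        fun h => absurd h (WithTop.natCast_ne_top _), ?_⟩
    refine (ih (F := fun z => (fderivWithin ℝ F (K ×ˢ W) z) ∘L ContinuousLinearMap.inr ℝ T E)
      ?_).congr fun x hx => (h1 x hx).fderiv
    exact (hF.fderivWithin (m := ∞) (hKu.prod hW.uniqueDiffOn) (by simp)).clm_comp contDiffOn_const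

theorem contDiffOn_setIntegral {K : Set T} (hK : IsCompact K) (hKu : UniqueDiffOn ℝ K)
    {W : Set E} (hW : IsOpen W) {F : T × E → G} (hF : ContDiffOn ℝ ∞ F (K ×ˢ W)) :
    ContDiffOn ℝ ∞ (fun x => ∫ t in K, F (t, x) ∂μ) W :=
  contDiffOn_infty.2 fun n => contDiffOn_setIntegral_nat hK hKu hW n hF

end ParametricIntegral

/-! ### Antisymmetrization. -/

section Permutations

variable {V M : Type} [AddCommGroup M]

/-- Antisymmetrization absorbs antisymmetrization over a subgroup. -/
theorem sum_sign_smul_comp_perm {N : ℕ} (τ : Equiv.Perm (Fin N)) (g : (Fin N → V) → M)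
    (v : Fin N → V) :
    ∑ σ : Equiv.Perm (Fin N), Equiv.Perm.sign τ • Equiv.Perm.sign σ • g ((v ∘ σ) ∘ τ) =
      ∑ σ : Equiv.Perm (Fin N), Equiv.Perm.sign σ • g (v ∘ σ) := by
  symm
  rw [← Equiv.sum_comp (Equiv.mulRight τ)]
  refine Finset.sum_congr rfl fun σ _ => ?_
  rw [Equiv.coe_mulRight, Equiv.Perm.sign_mul, mul_comm, ← smul_smul]
  rfl

/-- A 3-cycle is even, so precomposing `g` with one does not change its antisymmetrization. Three
times the sum is therefore the antisymmetrization of a cyclic sum, which is zero. -/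
theorem sum_sign_smul_eq_zero_of_cyclic [IsAddTorsionFree M] {N : ℕ} {a b c : Fin N} (hab : a ≠ b)
    (hbc : b ≠ c) (hac : a ≠ c) (g : (Fin N → V) → M)
    (hg : ∀ w : Fin N → V, g w + g (w ∘ (Equiv.swap a b * Equiv.swap b c : Equiv.Perm (Fin N))) +
      g (w ∘ (Equiv.swap a c * Equiv.swap c b : Equiv.Perm (Fin N))) = 0) (v : Fin N → V) :
    ∑ σ : Equiv.Perm (Fin N), Equiv.Perm.sign σ • g (v ∘ σ) = 0 := by
  have h1 := sum_sign_smul_comp_perm (Equiv.swap a b * Equiv.swap b c) g v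
  have h2 := sum_sign_smul_comp_perm (Equiv.swap a c * Equiv.swap c b) g v
  simp only [Equiv.Perm.sign_mul, Equiv.Perm.sign_swap hab, Equiv.Perm.sign_swap hbc,
    Equiv.Perm.sign_swap hac, Equiv.Perm.sign_swap hbc.symm, Int.units_mul_self, one_smul] at h1 h2
  have h3 : ∑ σ : Equiv.Perm (Fin N), Equiv.Perm.sign σ • (g (v ∘ σ) +
      g ((v ∘ σ) ∘ (Equiv.swap a b * Equiv.swap b c : Equiv.Perm (Fin N))) +
      g ((v ∘ σ) ∘ (Equiv.swap a c * Equiv.swap c b : Equiv.Perm (Fin N)))) = 0 :=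
    Finset.sum_eq_zero fun σ _ => by rw [hg, smul_zero]
  simp only [smul_add, Finset.sum_add_distrib, h1, h2] at h3
  have h4 : (3 : ℕ) • ∑ σ : Equiv.Perm (Fin N), Equiv.Perm.sign σ • g (v ∘ σ) = 0 := by
    rw [← h3]; abel
  exact (nsmul_eq_zero_iff_right (by norm_num)).1 h4

/-- The permutation fixing `0` and acting by `σ` on the other indices. -/
def extendPerm {N : ℕ} (σ : Equiv.Perm (Fin N)) : Equiv.Perm (Fin (N + 1)) :=
  Equiv.Perm.decomposeFin.symm (0, σ)

/-- A permutation factors uniquely as the cycle sending 0 to i, of sign (-1)^i, after a permutation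
fixing 0. This turns the alternating sum in an exterior derivative into a full antisymmetrization.
-/
theorem sum_perm_succ {N : ℕ} (g : V → (Fin N → V) → M) (v : Fin (N + 1) → V) :
    ∑ σ : Equiv.Perm (Fin (N + 1)), Equiv.Perm.sign σ • g ((v ∘ σ) 0) (Fin.tail (v ∘ σ)) =
      ∑ i : Fin (N + 1), (-1 : ℤˣ) ^ (i : ℕ) • ∑ σ : Equiv.Perm (Fin N), Equiv.Perm.sign σ •
        g (v i) ((i.removeNth v) ∘ σ) := by
  have hb : Function.Bijective (fun x : Fin (N + 1) × Equiv.Perm (Fin N) =>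
      x.1.cycleRange.symm * extendPerm x.2) := by
    rw [Fintype.bijective_iff_injective_and_card]
    constructor
    · rintro ⟨i, σ⟩ ⟨j, τ⟩ h
      have h0 : i = j := by
        have := congrArg (fun ρ : Equiv.Perm (Fin (N + 1)) => ρ 0) h
        simpa [extendPerm] using this
      subst h0
      have h1 := mul_left_cancel h
      have h2 : ((0, σ) : Fin (N + 1) × Equiv.Perm (Fin N)) = (0, τ) :=
        Equiv.Perm.decomposeFin.symm.injective h1
      rw [(Prod.mk.inj h2).2]
    · simp [Fintype.card_perm, Nat.factorial_succ]
  rw [← (Equiv.ofBijective _ hb).sum_comp, Fintype.sum_prod_type]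
  refine Finset.sum_congr rfl fun i _ => ?_
  rw [Finset.smul_sum]
  refine Finset.sum_congr rfl fun σ _ => ?_
  rw [smul_smul]
  congr 2
  · simp [Equiv.Perm.sign_mul, extendPerm, Equiv.Perm.sign_symm]
  · simp [extendPerm]
  · funext k
    simp [extendPerm, Fin.tail, Fin.removeNth]

end Permutations

/-! ### Wedge powers of a 2-form as antisymmetrized products. -/

section Wedge

set_option linter.unusedSectionVars false

variable {V A : Type} [NormedAddCommGroup V] [NormedSpace ℝ V] [NormedRing A] [NormedAlgebra ℝ A]

theorem wedge_apply {k l : ℕ} (a : V [⋀^Fin k]→L[ℝ] A) (b : V [⋀^Fin l]→L[ℝ] A)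
    (v : Fin (k + l) → V) :
    wedge a b v = ((k.factorial * l.factorial : ℝ)⁻¹) • ∑ σ : Equiv.Perm (Fin (k + l)),
      Equiv.Perm.sign σ • (a ((v ∘ σ) ∘ Fin.castAdd l) * b ((v ∘ σ) ∘ Fin.natAdd k)) := by
  rw [wedge, ContinuousAlternatingMap.smul_apply,
    ContinuousMultilinearMap.alternatization_apply_apply]
  rfl

/-- The product `B(v_0, v_1) B(v_2, v_3) ⋯ B(v_{2p-2}, v_{2p-1})`. -/
def pairProd (B : V → V → A) (p : ℕ) (v : Fin (2 * p) → V) : A :=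
  ((List.finRange p).map fun j : Fin p =>
    B (v ⟨2 * j, by omega⟩) (v ⟨2 * j + 1, by omega⟩)).prod

theorem pairProd_succ (B : V → V → A) (p : ℕ) (v : Fin (2 * (p + 1)) → V) :
    pairProd B (p + 1) v = pairProd B p (v ∘ Fin.castAdd 2 : Fin (2 * p) → V) *
      B (v (Fin.natAdd (2 * p) (0 : Fin 2))) (v (Fin.natAdd (2 * p) (1 : Fin 2))) := by
  simp only [pairProd, List.finRange_succ_last, List.map_append, List.prod_append, List.map_map,
    List.map_cons, List.map_nil, List.prod_cons, List.prod_nil, mul_one]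
  rfl

/-- The permutation acting by `τ` on the first `k` of `k + l` indices. -/
def extendPermCastAdd {k : ℕ} (l : ℕ) (τ : Equiv.Perm (Fin k)) : Equiv.Perm (Fin (k + l)) :=
  finSumFinEquiv.permCongr (Equiv.Perm.sumCongr τ 1)

theorem sign_extendPermCastAdd {k : ℕ} (l : ℕ) (τ : Equiv.Perm (Fin k)) :
    Equiv.Perm.sign (extendPermCastAdd l τ) = Equiv.Perm.sign τ := by
  simp [extendPermCastAdd]

theorem extendPermCastAdd_castAdd {k : ℕ} (l : ℕ) (τ : Equiv.Perm (Fin k)) (i : Fin k) :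
    extendPermCastAdd l τ (Fin.castAdd l i) = Fin.castAdd l (τ i) := by
  simp [extendPermCastAdd, Equiv.permCongr_apply]

theorem extendPermCastAdd_natAdd {k : ℕ} (l : ℕ) (τ : Equiv.Perm (Fin k)) (i : Fin l) :
    extendPermCastAdd l τ (Fin.natAdd k i) = Fin.natAdd k i := by
  simp [extendPermCastAdd, Equiv.permCongr_apply]

/-- The outer antisymmetrization absorbs the one inside `wedgePow a p`, which contributes (2p)!.
This cancels the same factor in the normalization of the wedge product, leaving 1/2 for each further
factor. -/
theorem wedgePow_apply (a : V [⋀^Fin 2]→L[ℝ] A) (p : ℕ) (v : Fin (2 * p) → V) :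
    wedgePow a p v = ((2 : ℝ) ^ p)⁻¹ • ∑ σ : Equiv.Perm (Fin (2 * p)),
      Equiv.Perm.sign σ • pairProd (fun x y => a ![x, y]) p (v ∘ σ) := by
  induction p with
  | zero =>
    simp [wedgePow, pairProd]
  | succ p ih =>
    have h0 : wedgePow a (p + 1) v = wedge (wedgePow a p) a v := rfl
    rw [h0, wedge_apply]
    simp only [ih]
    have h1 : ∀ τ : Equiv.Perm (Fin (2 * p)), ∑ σ : Equiv.Perm (Fin (2 * p + 2)),
        Equiv.Perm.sign τ • Equiv.Perm.sign σ • (pairProd (fun x y => a ![x, y]) p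
          (((v ∘ σ) ∘ Fin.castAdd 2) ∘ τ) * a ((v ∘ σ) ∘ Fin.natAdd (2 * p))) =
        ∑ σ : Equiv.Perm (Fin (2 * (p + 1))), Equiv.Perm.sign σ •
          pairProd (fun x y => a ![x, y]) (p + 1) (v ∘ σ) := fun τ => by
      have h2 := sum_sign_smul_comp_perm (extendPermCastAdd 2 τ)
        (fun w => pairProd (fun x y => a ![x, y]) (p + 1) w) v
      rw [sign_extendPermCastAdd] at h2
      refine Eq.trans ?_ h2
      refine Finset.sum_congr rfl fun σ _ => ?_
      rw [pairProd_succ]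
      congr 4
      · funext i
        simp only [Function.comp_apply, extendPermCastAdd_castAdd]
      · funext i
        fin_cases i <;> simp [extendPermCastAdd_natAdd]
    have h3 : ∑ σ : Equiv.Perm (Fin (2 * p + 2)), Equiv.Perm.sign σ •
        ((((2 : ℝ) ^ p)⁻¹ • ∑ τ : Equiv.Perm (Fin (2 * p)), Equiv.Perm.sign τ •
          pairProd (fun x y => a ![x, y]) p (((v ∘ σ) ∘ Fin.castAdd 2) ∘ τ)) *
          a ((v ∘ σ) ∘ Fin.natAdd (2 * p))) = ((2 : ℝ) ^ p)⁻¹ • ((2 * p).factorial : ℝ) •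
        ∑ σ : Equiv.Perm (Fin (2 * (p + 1))), Equiv.Perm.sign σ •
          pairProd (fun x y => a ![x, y]) (p + 1) (v ∘ σ) := by
      have h4 : ((2 * p).factorial : ℝ) • ∑ σ : Equiv.Perm (Fin (2 * (p + 1))),
          Equiv.Perm.sign σ • pairProd (fun x y => a ![x, y]) (p + 1) (v ∘ σ) =
          ∑ τ : Equiv.Perm (Fin (2 * p)), ∑ σ : Equiv.Perm (Fin (2 * p + 2)),
          Equiv.Perm.sign τ • Equiv.Perm.sign σ • (pairProd (fun x y => a ![x, y]) p
          (((v ∘ σ) ∘ Fin.castAdd 2) ∘ τ) * a ((v ∘ σ) ∘ Fin.natAdd (2 * p))) := by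
        rw [Finset.sum_congr rfl fun τ _ => h1 τ, Finset.sum_const, Finset.card_univ,
          Fintype.card_perm, Fintype.card_fin, Nat.cast_smul_eq_nsmul]
      rw [h4, Finset.sum_comm, Finset.smul_sum]
      refine Finset.sum_congr rfl fun σ _ => ?_
      rw [smul_mul_assoc, smul_comm, Finset.sum_mul, Finset.smul_sum]
      congr 1
      refine Finset.sum_congr rfl fun τ _ => ?_
      rw [smul_mul_assoc, smul_comm]
    rw [h3, smul_smul, smul_smul]
    congr 1
    have : ((2 * p).factorial : ℝ) ≠ 0 := by exact_mod_cast Nat.factorial_ne_zero _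
    field_simp
    simp [Nat.factorial, pow_succ, mul_comm]

theorem pairProd_eq_zero (B : V → V → A) (p : ℕ) (v : Fin (2 * p) → V) (j : Fin p)
    (h : B (v ⟨2 * j, by omega⟩) (v ⟨2 * j + 1, by omega⟩) = 0) : pairProd B p v = 0 := by
  have h1 : (0 : A) ∈ (List.finRange p).map fun j : Fin p =>
      B (v ⟨2 * j, by omega⟩) (v ⟨2 * j + 1, by omega⟩) :=
    List.mem_map.2 ⟨j, List.mem_finRange j, h⟩
  obtain ⟨s, t, hst⟩ := List.append_of_mem h1
  rw [pairProd, hst, List.prod_append, List.prod_cons, zero_mul, mul_zero]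

theorem pairProd_conj (B C : V → V → A) {h k : A} (hk : h * k = 1)
    (hBC : ∀ x y, C x y = k * B x y * h) (p : ℕ) (v : Fin (2 * p) → V) (hkh : k * h = 1) :
    pairProd C p v = k * pairProd B p v * h := by
  unfold pairProd
  induction List.finRange p with
  | nil => simp [hkh]
  | cons j l ih =>
    rw [List.map_cons, List.prod_cons, ih, List.map_cons, List.prod_cons, hBC]
    simp only [mul_assoc]
    rw [← mul_assoc h k, hk, one_mul]

theorem wedgePow_compContinuousLinearMap {W : Type} [NormedAddCommGroup W] [NormedSpace ℝ W]
    (a : V [⋀^Fin 2]→L[ℝ] A) (f : W →L[ℝ] V) (p : ℕ) :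
    wedgePow (a.compContinuousLinearMap f) p = (wedgePow a p).compContinuousLinearMap f := by
  ext v
  rw [wedgePow_apply, ContinuousAlternatingMap.compContinuousLinearMap_apply, wedgePow_apply]
  congr 1
  refine Finset.sum_congr rfl fun σ _ => ?_
  congr 1
  unfold pairProd
  congr 1
  refine List.map_congr_left fun j _ => ?_
  refine (ContinuousAlternatingMap.compContinuousLinearMap_apply _ _ _).trans ?_
  congr 1
  funext i
  fin_cases i <;> rfl

end Wedge

/-! ### Curvature: commutators, the Bianchi identity and gauge transformations. -/

section Derivation

variable {A : Type} [Ring A]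

/-- The commutator with θ is a derivation. Under a trace the right side vanishes, so ordinary
derivatives of curvature factors may be replaced by covariant ones. -/
theorem sum_commutator_list_prod {ι : Type} (f : ι → A) (θ : A) (l : List ι) :
    ∑ i : Fin l.length, ((l.take i).map f).prod * (θ * f l[i] - f l[i] * θ) *
      ((l.drop (.succ i)).map f).prod = θ * (l.map f).prod - (l.map f).prod * θ := by
  induction l with
  | nil => simp
  | cons a l ih =>
    have h : ∑ i : Fin (a :: l).length, (((a :: l).take i).map f).prod *
        (θ * f (a :: l)[i] - f (a :: l)[i] * θ) * (((a :: l).drop (.succ i)).map f).prod =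
        (θ * f a - f a * θ) * (l.map f).prod + f a * ∑ i : Fin l.length,
        ((l.take i).map f).prod * (θ * f l[i] - f l[i] * θ) * ((l.drop (.succ i)).map f).prod := by
      refine (Fin.sum_univ_succ _).trans ?_
      congr 1
      · simp
      · rw [Finset.mul_sum]
        refine Finset.sum_congr rfl fun i _ => ?_
        simp [mul_assoc]
    rw [h, ih]
    simp
    noncomm_ring

end Derivation

section Curvature

variable {V A : Type} [NormedAddCommGroup V] [NormedSpace ℝ V] [NormedRing A] [NormedAlgebra ℝ A]

/-- The form of degree one given by a family of linear maps. -/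
noncomputable def oneForm (Θ : V → V →L[ℝ] A) : DiffForm V A 1 :=
  fun x => ContinuousAlternatingMap.ofSubsingleton ℝ _ _ 0 (Θ x)

theorem contDiffOn_oneForm [FiniteDimensional ℝ V] [FiniteDimensional ℝ A] {n : WithTop ℕ∞}
    {Θ : V → V →L[ℝ] A} {s : Set V}
    (hΘ : ContDiffOn ℝ n Θ s) : ContDiffOn ℝ n (oneForm Θ) s :=
  contDiffOn_form fun _ => hΘ.clm_apply contDiffOn_const

/-- The values of the curvature form of a connection form. -/
noncomputable def curvature (Θ : V → V →L[ℝ] A) (x u w : V) : A :=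
  fderiv ℝ Θ x u w - fderiv ℝ Θ x w u + (Θ x u * Θ x w - Θ x w * Θ x u)

theorem wedge_one_one (a b : V [⋀^Fin 1]→L[ℝ] A) (u w : V) :
    wedge a b ![u, w] = a ![u] * b ![w] - a ![w] * b ![u] := by
  have h : (Finset.univ : Finset (Equiv.Perm (Fin (1 + 1)))) = {1, Equiv.swap 0 1} := by decide
  have h1 := wedge_apply a b ![u, w]
  rw [h, Finset.sum_pair (by decide)] at h1
  refine h1.trans ?_
  rw [Equiv.Perm.sign_swap (by decide)]
  simp only [Nat.factorial, Nat.cast_one, mul_one, inv_one, one_smul, Equiv.Perm.sign_one,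
    Units.neg_smul, sub_eq_add_neg]
  congr 1
  · congr 2 <;>
    · funext i
      fin_cases i
      rfl
  · congr 3 <;>
    · funext i
      fin_cases i
      rfl

theorem curvatureForm_oneForm_apply [FiniteDimensional ℝ V] [FiniteDimensional ℝ A]
    {Θ : V → V →L[ℝ] A} {s : Set V} (hs : IsOpen s) (hΘ : ContDiffOn ℝ ∞ Θ s) {x : V}
    (hx : x ∈ s) (u w : V) : curvatureForm (oneForm Θ) x ![u, w] = curvature Θ x u w := by
  have h1 : DifferentiableAt ℝ (oneForm Θ) x :=
    ((contDiffOn_oneForm hΘ).differentiableOn (by simp)).differentiableAt (hs.mem_nhds hx)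
  have h2 : DifferentiableAt ℝ Θ x :=
    (hΘ.differentiableOn (by simp)).differentiableAt (hs.mem_nhds hx)
  have h3 : ∀ w v : V, fderiv ℝ (fun y => Θ y w) x v = fderiv ℝ Θ x v w := fun w v => by
    rw [fderiv_clm_apply h2 (differentiableAt_const w)]
    simp
  have h4 : ∀ (i : Fin 2) (v : V), fderiv ℝ (fun y => oneForm Θ y (i.removeNth ![u, w])) x v =
      fderiv ℝ Θ x v (i.removeNth ![u, w] 0) := fun i v => h3 _ v
  have h5 : ∀ v : V, oneForm Θ x ![v] = Θ x v := fun v => rfl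
  rw [curvatureForm, ContinuousAlternatingMap.add_apply, wedge_one_one, h5, h5, curvature]
  congr 1
  rw [extDeriv_apply h1, Fin.sum_univ_two, h4, h4]
  simp [sub_eq_add_neg, Fin.removeNth]

theorem hasFDerivAt_curvature {Θ : V → V →L[ℝ] A} {s : Set V} (hs : IsOpen s)
    (hΘ : ContDiffOn ℝ ∞ Θ s) {x : V} (hx : x ∈ s) (u w : V) :
    ∃ L : V →L[ℝ] A, HasFDerivAt (fun y => curvature Θ y u w) L x ∧ ∀ v, L v =
      fderiv ℝ (fderiv ℝ Θ) x v u w - fderiv ℝ (fderiv ℝ Θ) x v w u +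
      (fderiv ℝ Θ x v u * Θ x w + Θ x u * fderiv ℝ Θ x v w -
        (fderiv ℝ Θ x v w * Θ x u + Θ x w * fderiv ℝ Θ x v u)) := by
  have h2 : HasFDerivAt Θ (fderiv ℝ Θ x) x :=
    ((hΘ.differentiableOn (by simp)).differentiableAt (hs.mem_nhds hx)).hasFDerivAt
  have h3 : HasFDerivAt (fderiv ℝ Θ) (fderiv ℝ (fderiv ℝ Θ) x) x :=
    (((hΘ.fderiv_of_isOpen (m := ∞) hs (by simp)).differentiableOn (by simp)).differentiableAt
      (hs.mem_nhds hx)).hasFDerivAt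
  have h4 : ∀ a, HasFDerivAt (fun y => Θ y a) _ x := fun a =>
    h2.clm_apply (hasFDerivAt_const a x)
  have h5 : ∀ a b, HasFDerivAt (fun y => fderiv ℝ Θ y a b) _ x := fun a b =>
    (h3.clm_apply (hasFDerivAt_const a x)).clm_apply (hasFDerivAt_const b x)
  refine ⟨_, ((h5 u w).sub (h5 w u)).add (((h4 u).mul' (h4 w)).sub ((h4 w).mul' (h4 u))), ?_⟩
  intro v
  simp
  abel

theorem contDiffOn_curvature {Θ : V → V →L[ℝ] A} {s : Set V} (hs : IsOpen s)
    (hΘ : ContDiffOn ℝ ∞ Θ s) (u w : V) : ContDiffOn ℝ ∞ (fun y => curvature Θ y u w) s := by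
  have h3 : ContDiffOn ℝ ∞ (fderiv ℝ Θ) s := hΘ.fderiv_of_isOpen hs (by simp)
  have h4 : ∀ a, ContDiffOn ℝ ∞ (fun y => Θ y a) s := fun a => hΘ.clm_apply contDiffOn_const
  have h5 : ∀ a b, ContDiffOn ℝ ∞ (fun y => fderiv ℝ Θ y a b) s := fun a b =>
    (h3.clm_apply contDiffOn_const).clm_apply contDiffOn_const
  exact ((h5 u w).sub (h5 w u)).add (((h4 u).mul (h4 w)).sub ((h4 w).mul (h4 u)))

/-- The Bianchi identity. -/
theorem bianchi {Θ : V → V →L[ℝ] A} {s : Set V} (hs : IsOpen s) (hΘ : ContDiffOn ℝ ∞ Θ s) {x : V}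
    (hx : x ∈ s) (N : V → V → V → A)
    (hN : ∀ u v w, N u v w = fderiv ℝ (fun y => curvature Θ y v w) x u +
      (Θ x u * curvature Θ x v w - curvature Θ x v w * Θ x u)) (u v w : V) :
    N u v w + N v w u + N w u v = 0 := by
  have hD : ∀ u v w, fderiv ℝ (fun y => curvature Θ y v w) x u = _ := fun u v w => by
    obtain ⟨L, hL, hL'⟩ := hasFDerivAt_curvature hs hΘ hx v w
    rw [hL.fderiv, hL' u]
  -- The second derivatives of Θ cancel in the cyclic sum by symmetry; what remains is an identity
  -- of noncommutative polynomials.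
  have hsymm : ∀ a b, fderiv ℝ (fderiv ℝ Θ) x a b = fderiv ℝ (fderiv ℝ Θ) x b a :=
    fun a b => ((hΘ x hx).contDiffAt (hs.mem_nhds hx)).isSymmSndFDerivAt two_le a b
  simp only [hN, hD]
  simp only [curvature, hsymm w u, hsymm v u, hsymm w v]
  noncomm_ring

/-- The terms with derivatives of `h` cancel, by the formula for the derivative of the inverse `k`
and the symmetry of the second derivative of `h`. -/
theorem curvature_gauge {Θ Θ' : V → V →L[ℝ] A} {h k : V → A} {s : Set V} (hs : IsOpen s)
    (hΘ : ContDiffOn ℝ ∞ Θ s) (hh : ContDiffOn ℝ ∞ h s) (hk : ContDiffOn ℝ ∞ k s)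
    (hhk : ∀ y ∈ s, h y * k y = 1) (hkh : ∀ y ∈ s, k y * h y = 1)
    (hΘ' : ContDiffOn ℝ ∞ Θ' s)
    (h' : ∀ y ∈ s, ∀ u, Θ' y u = k y * Θ y u * h y + k y * fderiv ℝ h y u) {x : V} (hx : x ∈ s)
    (u w : V) : curvature Θ' x u w = k x * curvature Θ x u w * h x := by
  have d1 : HasFDerivAt Θ (fderiv ℝ Θ x) x :=
    ((hΘ.differentiableOn (by simp)).differentiableAt (hs.mem_nhds hx)).hasFDerivAt
  have d1' : HasFDerivAt Θ' (fderiv ℝ Θ' x) x :=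
    ((hΘ'.differentiableOn (by simp)).differentiableAt (hs.mem_nhds hx)).hasFDerivAt
  have d2 : HasFDerivAt h (fderiv ℝ h x) x :=
    ((hh.differentiableOn (by simp)).differentiableAt (hs.mem_nhds hx)).hasFDerivAt
  have d3 : HasFDerivAt k (fderiv ℝ k x) x :=
    ((hk.differentiableOn (by simp)).differentiableAt (hs.mem_nhds hx)).hasFDerivAt
  have d4 : HasFDerivAt (fderiv ℝ h) (fderiv ℝ (fderiv ℝ h) x) x :=
    (((hh.fderiv_of_isOpen (m := ∞) hs (by simp)).differentiableOn (by simp)).differentiableAt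
      (hs.mem_nhds hx)).hasFDerivAt
  have hsymm : fderiv ℝ (fderiv ℝ h) x u w = fderiv ℝ (fderiv ℝ h) x w u :=
    ((hh x hx).contDiffAt (hs.mem_nhds hx)).isSymmSndFDerivAt two_le u w
  -- Differentiate k h = 1 and multiply by k on the right.
  have hk' : ∀ a, fderiv ℝ k x a = -(k x * fderiv ℝ h x a * k x) := fun a => by
    have e1 : HasFDerivAt (fun y => k y * h y) (0 : V →L[ℝ] A) x :=
      (hasFDerivAt_const (1 : A) x).congr_of_eventuallyEq
        (Filter.eventually_of_mem (hs.mem_nhds hx) hkh)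
    have e2 := congrArg (fun L : V →L[ℝ] A => L a * k x) ((d3.mul' d2).unique e1)
    simp only [add_apply, smul_apply,
      zero_apply, zero_mul, smul_eq_mul, add_mul,
      MulOpposite.smul_eq_mul_unop, MulOpposite.unop_op] at e2
    rw [mul_assoc (fderiv ℝ k x a), hhk x hx, mul_one] at e2
    exact eq_neg_of_add_eq_zero_right e2
  have hD : ∀ a b, fderiv ℝ Θ' x a b = fderiv ℝ k x a * Θ x b * h x +
      k x * fderiv ℝ Θ x a b * h x + k x * Θ x b * fderiv ℝ h x a +
      (fderiv ℝ k x a * fderiv ℝ h x b + k x * fderiv ℝ (fderiv ℝ h) x a b) := fun a b => by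
    have e1 := d1'.clm_apply (hasFDerivAt_const b x)
    have e2 := (((d3.mul' (d1.clm_apply (hasFDerivAt_const b x))).mul' d2).add
      (d3.mul' (d4.clm_apply (hasFDerivAt_const b x)))).congr_of_eventuallyEq
      (Filter.eventually_of_mem (hs.mem_nhds hx) fun y hy => h' y hy b)
    have e3 := congrArg (fun L : V →L[ℝ] A => L a) (e1.unique e2)
    simp at e3
    rw [e3]
    noncomm_ring
  have hc : ∀ a : A, h x * (k x * a) = a := fun a => by rw [← mul_assoc, hhk x hx, one_mul]
  simp only [curvature, hD, h' x hx, hk', hsymm, mul_add, add_mul, mul_sub, sub_mul, mul_assoc,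
    neg_mul, hc]
  abel

end Curvature

/-! ### Chern–Weil forms: closedness, gauge invariance and naturality. -/

section ChernWeil

set_option linter.unusedSectionVars false

variable {V A : Type} [NormedAddCommGroup V] [NormedSpace ℝ V] [NormedRing A] [NormedAlgebra ℝ A]
  [FiniteDimensional ℝ V] [FiniteDimensional ℝ A]

theorem contDiffOn_list_prod {ι : Type} {f : ι → V → A} {s : Set V}
    (hf : ∀ i, ContDiffOn ℝ ∞ (f i) s) (l : List ι) :
    ContDiffOn ℝ ∞ (fun y => (l.map fun i => f i y).prod) s := by
  induction l with
  | nil => exact contDiffOn_const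
  | cons a l ih => simpa using (hf a).mul ih

theorem contDiffOn_pairProd_curvature {Θ : V → V →L[ℝ] A} {s : Set V} (hs : IsOpen s)
    (hΘ : ContDiffOn ℝ ∞ Θ s) (p : ℕ) (v : Fin (2 * p) → V) :
    ContDiffOn ℝ ∞ (fun y => pairProd (curvature Θ y) p v) s :=
  contDiffOn_list_prod (fun j : Fin p => contDiffOn_curvature hs hΘ (v ⟨2 * j, by omega⟩)
    (v ⟨2 * j + 1, by omega⟩)) _

theorem chernWeilForm_oneForm_apply {Θ : V → V →L[ℝ] A} {s : Set V} (hs : IsOpen s)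
    (hΘ : ContDiffOn ℝ ∞ Θ s) {x : V} (hx : x ∈ s) (tr : A →L[ℝ] ℂ) (p : ℕ)
    (v : Fin (2 * p) → V) : chernWeilForm tr p (oneForm Θ) x v =
      (1 / (p.factorial : ℂ) * (-1 / (2 * Real.pi * Complex.I)) ^ p) • ((2 : ℝ) ^ p)⁻¹ •
        ∑ σ : Equiv.Perm (Fin (2 * p)), Equiv.Perm.sign σ •
          tr (pairProd (curvature Θ x) p (v ∘ σ)) := by
  have h : (fun u w => curvatureForm (oneForm Θ) x ![u, w]) = curvature Θ x :=
    funext fun u => funext fun w => curvatureForm_oneForm_apply hs hΘ hx u w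
  rw [chernWeilForm, ContinuousAlternatingMap.smul_apply]
  congr 1
  refine (congrArg tr (wedgePow_apply _ p v)).trans ?_
  rw [h, map_smul, map_sum]
  congr 1
  refine Finset.sum_congr rfl fun σ _ => ?_
  rw [Units.smul_def, Units.smul_def, map_zsmul]

theorem contDiffOn_chernWeilForm {Θ : V → V →L[ℝ] A} {s : Set V} (hs : IsOpen s)
    (hΘ : ContDiffOn ℝ ∞ Θ s) (tr : A →L[ℝ] ℂ) (p : ℕ) :
    ContDiffOn ℝ ∞ (chernWeilForm tr p (oneForm Θ)) s := by
  refine contDiffOn_form fun v => ContDiffOn.congr ?_ fun x hx =>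
    chernWeilForm_oneForm_apply hs hΘ hx tr p v
  refine ContDiffOn.const_smul _ (ContDiffOn.const_smul _ (ContDiffOn.sum fun σ _ => ?_))
  simp only [Units.smul_def, ← Int.cast_smul_eq_zsmul ℝ]
  exact (tr.contDiff.comp_contDiffOn (contDiffOn_pairProd_curvature hs hΘ p (v ∘ σ))).const_smul _

/-- Leibniz' rule, with each derivative of a curvature factor completed to the covariant derivative
`N`. The added commutators sum to the trace of a commutator, which is zero. -/
theorem fderiv_trace_pairProd {Θ : V → V →L[ℝ] A} {s : Set V} (hs : IsOpen s)
    (hΘ : ContDiffOn ℝ ∞ Θ s) {x : V} (hx : x ∈ s) {tr : A →L[ℝ] ℂ}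
    (htr : ∀ a b, tr (a * b) = tr (b * a)) (N : V → V → V → A)
    (hN : ∀ u v w, N u v w = fderiv ℝ (fun y => curvature Θ y v w) x u +
      (Θ x u * curvature Θ x v w - curvature Θ x v w * Θ x u)) (p : ℕ) (u : V)
    (v : Fin (2 * p) → V) :
    fderiv ℝ (fun y => tr (pairProd (curvature Θ y) p v)) x u =
      ∑ i : Fin (List.finRange p).length, tr (
        ((List.take i (List.finRange p)).map fun j : Fin p =>
          curvature Θ x (v ⟨2 * j, by omega⟩) (v ⟨2 * j + 1, by omega⟩)).prod *
        N u (v ⟨2 * (List.finRange p)[i], by omega⟩) (v ⟨2 * (List.finRange p)[i] + 1, by omega⟩) *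
        ((List.drop (.succ i) (List.finRange p)).map fun j : Fin p =>
          curvature Θ x (v ⟨2 * j, by omega⟩) (v ⟨2 * j + 1, by omega⟩)).prod) := by
  have h1 := HasFDerivAt.list_prod' (l := List.finRange p) (x := x)
    (f := fun (j : Fin p) y => curvature Θ y (v ⟨2 * j, by omega⟩) (v ⟨2 * j + 1, by omega⟩))
    (f' := fun (j : Fin p) => fderiv ℝ (fun y => curvature Θ y (v ⟨2 * j, by omega⟩)
      (v ⟨2 * j + 1, by omega⟩)) x)
    fun j _ => (((contDiffOn_curvature hs hΘ _ _).differentiableOn (by simp)).differentiableAt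
      (hs.mem_nhds hx)).hasFDerivAt
  have h2 := sum_commutator_list_prod (fun j : Fin p => curvature Θ x (v ⟨2 * j, by omega⟩)
    (v ⟨2 * j + 1, by omega⟩)) (Θ x u) (List.finRange p)
  have h3 := congrArg (fun L : V →L[ℝ] ℂ => L u) (tr.hasFDerivAt.comp x h1).fderiv
  refine h3.trans ?_
  simp only [hN, mul_add, add_mul, map_add, Finset.sum_add_distrib, ← map_sum]
  rw [h2, map_sub, htr, sub_self, add_zero]
  simp [ContinuousLinearMap.comp_apply, mul_assoc]

/-- The exterior derivative is an antisymmetrization of traces of products in which one curvature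
factor is replaced by its covariant derivative. Cycling the three arguments of that factor and
applying the Bianchi identity gives zero. -/
theorem extDeriv_chernWeilForm {Θ : V → V →L[ℝ] A} {s : Set V} (hs : IsOpen s)
    (hΘ : ContDiffOn ℝ ∞ Θ s) {x : V} (hx : x ∈ s) {tr : A →L[ℝ] ℂ}
    (htr : ∀ a b, tr (a * b) = tr (b * a)) (p : ℕ) :
    extDeriv (chernWeilForm tr p (oneForm Θ)) x = 0 := by
  ext v
  obtain ⟨N, hN⟩ : ∃ N : V → V → V → A, ∀ u v w, N u v w =
      fderiv ℝ (fun y => curvature Θ y v w) x u +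
      (Θ x u * curvature Θ x v w - curvature Θ x v w * Θ x u) := ⟨_, fun _ _ _ => rfl⟩
  have hd : ∀ w : Fin (2 * p) → V,
      DifferentiableAt ℝ (fun y => tr (pairProd (curvature Θ y) p w)) x := fun w =>
    ((tr.contDiff.comp_contDiffOn (contDiffOn_pairProd_curvature hs hΘ p w)).differentiableOn
      (by simp)).differentiableAt (hs.mem_nhds hx)
  rw [extDeriv_apply (((contDiffOn_chernWeilForm hs hΘ tr p).differentiableOn
    (by simp)).differentiableAt (hs.mem_nhds hx))]
  have h1 : ∀ (w : Fin (2 * p) → V) (u : V),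
      fderiv ℝ (fun y => chernWeilForm tr p (oneForm Θ) y w) x u =
      (1 / (p.factorial : ℂ) * (-1 / (2 * Real.pi * Complex.I)) ^ p) • ((2 : ℝ) ^ p)⁻¹ •
        ∑ σ : Equiv.Perm (Fin (2 * p)), Equiv.Perm.sign σ •
          fderiv ℝ (fun y => tr (pairProd (curvature Θ y) p (w ∘ σ))) x u := fun w u => by
    have e : HasFDerivAt (fun y => chernWeilForm tr p (oneForm Θ) y w)
        ((1 / (p.factorial : ℂ) * (-1 / (2 * Real.pi * Complex.I)) ^ p) • ((2 : ℝ) ^ p)⁻¹ •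
        ∑ σ : Equiv.Perm (Fin (2 * p)), ((Equiv.Perm.sign σ : ℤ) : ℝ) •
          fderiv ℝ (fun y => tr (pairProd (curvature Θ y) p (w ∘ σ))) x) x := by
      refine HasFDerivAt.congr_of_eventuallyEq ?_ (Filter.eventually_of_mem (hs.mem_nhds hx)
        fun y hy => chernWeilForm_oneForm_apply hs hΘ hy tr p w)
      have e1 : ∀ σ : Equiv.Perm (Fin (2 * p)), HasFDerivAt (fun y => Equiv.Perm.sign σ •
          tr (pairProd (curvature Θ y) p (w ∘ σ))) (((Equiv.Perm.sign σ : ℤ) : ℝ) •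
          fderiv ℝ (fun y => tr (pairProd (curvature Θ y) p (w ∘ σ))) x) x := fun σ => by
        simp only [Units.smul_def, ← Int.cast_smul_eq_zsmul ℝ]
        exact (hd (w ∘ σ)).hasFDerivAt.const_smul (((Equiv.Perm.sign σ : ℤ) : ℝ))
      exact ((HasFDerivAt.fun_sum (u := Finset.univ) fun σ _ => e1 σ).const_smul
        (((2 : ℝ) ^ p)⁻¹)).const_smul
        (1 / (p.factorial : ℂ) * (-1 / (2 * Real.pi * Complex.I)) ^ p)
    rw [e.fderiv]
    simp [Units.smul_def]
  have h2 := sum_perm_succ (fun u w => fderiv ℝ (fun y => tr (pairProd (curvature Θ y) p w)) x u) v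
  have h3 : ∑ i : Fin (2 * p + 1), (-1) ^ (i : ℕ) • fderiv ℝ (fun y =>
      chernWeilForm tr p (oneForm Θ) y (i.removeNth v)) x (v i) =
      (1 / (p.factorial : ℂ) * (-1 / (2 * Real.pi * Complex.I)) ^ p) • ((2 : ℝ) ^ p)⁻¹ •
      ∑ i : Fin (2 * p + 1), (-1 : ℤˣ) ^ (i : ℕ) • ∑ σ : Equiv.Perm (Fin (2 * p)),
        Equiv.Perm.sign σ • fderiv ℝ (fun y => tr (pairProd (curvature Θ y) p
          (i.removeNth v ∘ σ))) x (v i) := by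
    rw [Finset.smul_sum, Finset.smul_sum]
    refine Finset.sum_congr rfl fun i _ => ?_
    rw [h1]
    rcases neg_one_pow_eq_or ℤˣ (i : ℕ) with h | h <;>
    rcases neg_one_pow_eq_or ℤ (i : ℕ) with h' | h' <;> simp [h, h']
    all_goals
      have := congrArg Units.val h
      simp [h'] at this
  refine h3.trans ?_
  rw [← h2]
  have h4 : ∑ σ : Equiv.Perm (Fin (2 * p + 1)), Equiv.Perm.sign σ • fderiv ℝ (fun y =>
      tr (pairProd (curvature Θ y) p (Fin.tail (v ∘ σ)))) x ((v ∘ σ) 0) = 0 := by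
    simp only [fderiv_trace_pairProd hs hΘ hx htr N hN, Finset.smul_sum]
    rw [Finset.sum_comm]
    refine Finset.sum_eq_zero fun i _ => ?_
    -- The differentiated factor is the j-th. With the direction of differentiation placed in slot
    -- 0, its arguments are the slots 0, 2j + 1 and 2j + 2.
    obtain ⟨j, hj⟩ : ∃ j, (List.finRange p)[i] = j := ⟨_, rfl⟩
    have hi : (j : ℕ) = i := by rw [← hj]; simp
    have e01 : (0 : Fin (2 * p + 1)) ≠ ⟨2 * j + 1, by omega⟩ := by simp [Fin.ext_iff]
    have e02 : (0 : Fin (2 * p + 1)) ≠ ⟨2 * j + 1 + 1, by omega⟩ := by simp [Fin.ext_iff]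
    have e12 : (⟨2 * j + 1, by omega⟩ : Fin (2 * p + 1)) ≠ ⟨2 * j + 1 + 1, by omega⟩ := by
      simp
    refine sum_sign_smul_eq_zero_of_cyclic e01 e12 e02 (fun w : Fin (2 * p + 1) → V => tr (
      ((List.take i (List.finRange p)).map fun j : Fin p =>
          curvature Θ x (Fin.tail w ⟨2 * j, by omega⟩) (Fin.tail w ⟨2 * j + 1, by omega⟩)).prod *
        N (w 0) (Fin.tail w ⟨2 * (List.finRange p)[i], by omega⟩)
          (Fin.tail w ⟨2 * (List.finRange p)[i] + 1, by omega⟩) *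
        ((List.drop (.succ i) (List.finRange p)).map fun j : Fin p =>
          curvature Θ x (Fin.tail w ⟨2 * j, by omega⟩)
            (Fin.tail w ⟨2 * j + 1, by omega⟩)).prod)) (fun w => ?_) v
    -- The other factors do not involve these three slots, so the 3-cycles leave them unchanged.
    have ht : ∀ (τ : Equiv.Perm (Fin (2 * p + 1))), (∀ k : Fin (2 * p + 1), k ≠ 0 →
        k ≠ ⟨2 * j + 1, by omega⟩ → k ≠ ⟨2 * j + 1 + 1, by omega⟩ → τ k = k) →
        ∀ l : List (Fin p), j ∉ l →
        (l.map fun j : Fin p => curvature Θ x (Fin.tail (w ∘ τ) ⟨2 * j, by omega⟩)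
          (Fin.tail (w ∘ τ) ⟨2 * j + 1, by omega⟩)) =
        (l.map fun j : Fin p => curvature Θ x (Fin.tail w ⟨2 * j, by omega⟩)
          (Fin.tail w ⟨2 * j + 1, by omega⟩)) := fun τ hτ l hl => by
      refine List.map_congr_left fun k hk => ?_
      have hkj : k ≠ j := fun h => hl (h ▸ hk)
      have hkj' : (k : ℕ) ≠ j := fun h => hkj (Fin.ext h)
      simp only [Fin.tail, Function.comp_apply, Fin.succ_mk]
      rw [hτ, hτ] <;> simp [Fin.ext_iff] <;> omega
    have l1 : j ∉ List.take i (List.finRange p) := by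
      rw [List.mem_take_iff_getElem]
      rintro ⟨k, hk, hk'⟩
      have := congrArg Fin.val hk'
      simp at this
      omega
    have l2 : j ∉ List.drop (.succ i) (List.finRange p) := by
      rw [List.mem_drop_iff_getElem]
      rintro ⟨k, hk, hk'⟩
      have := congrArg Fin.val hk'
      simp at this
      omega
    have c1 : ∀ {a b c : Fin (2 * p + 1)} (k : Fin (2 * p + 1)), k ≠ a → k ≠ b → k ≠ c →
        (Equiv.swap a b * Equiv.swap b c : Equiv.Perm (Fin (2 * p + 1))) k = k := by
      intro a b c k ha hb hc
      rw [Equiv.Perm.mul_apply, Equiv.swap_apply_of_ne_of_ne hb hc,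
        Equiv.swap_apply_of_ne_of_ne ha hb]
    have c2 : ∀ {a b c : Fin (2 * p + 1)}, a ≠ b → b ≠ c → a ≠ c →
        (Equiv.swap a b * Equiv.swap b c : Equiv.Perm (Fin (2 * p + 1))) a = b ∧
        (Equiv.swap a b * Equiv.swap b c : Equiv.Perm (Fin (2 * p + 1))) b = c ∧
        (Equiv.swap a b * Equiv.swap b c : Equiv.Perm (Fin (2 * p + 1))) c = a := by
      intro a b c hab hbc hac
      simp [Equiv.Perm.mul_apply, Equiv.swap_apply_of_ne_of_ne hab hac,
        Equiv.swap_apply_of_ne_of_ne hac.symm hbc.symm]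
    rw [ht _ (fun k h0 h1 h2 => c1 k h0 h1 h2) _ l1, ht _ (fun k h0 h1 h2 => c1 k h0 h1 h2) _ l2,
      ht _ (fun k h0 h1 h2 => c1 k h0 h2 h1) _ l1, ht _ (fun k h0 h1 h2 => c1 k h0 h2 h1) _ l2]
    obtain ⟨a1, a2, a3⟩ := c2 e01 e12 e02
    obtain ⟨b1, b2, b3⟩ := c2 e02 e12.symm e01
    rw [← map_add, ← map_add, ← add_mul, ← add_mul, ← mul_add, ← mul_add]
    simp only [hj, Fin.tail, Function.comp_apply, Fin.succ_mk, a1, a2, a3, b1, b2, b3]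
    rw [bianchi hs hΘ hx N hN, mul_zero, zero_mul, map_zero]
  rw [h4, smul_zero, smul_zero]
  rfl

/-- The curvature is conjugated by `h`, and the trace does not see a conjugation. -/
theorem chernWeilForm_gauge {Θ Θ' : V → V →L[ℝ] A} {h k : V → A} {s : Set V} (hs : IsOpen s)
    (hΘ : ContDiffOn ℝ ∞ Θ s) (hh : ContDiffOn ℝ ∞ h s) (hk : ContDiffOn ℝ ∞ k s)
    (hhk : ∀ y ∈ s, h y * k y = 1) (hkh : ∀ y ∈ s, k y * h y = 1)
    (hΘ' : ContDiffOn ℝ ∞ Θ' s)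
    (h' : ∀ y ∈ s, ∀ u, Θ' y u = k y * Θ y u * h y + k y * fderiv ℝ h y u) {x : V} (hx : x ∈ s)
    {tr : A →L[ℝ] ℂ} (htr : ∀ a b, tr (a * b) = tr (b * a)) (p : ℕ) :
    chernWeilForm tr p (oneForm Θ') x = chernWeilForm tr p (oneForm Θ) x := by
  ext v
  rw [chernWeilForm_oneForm_apply hs hΘ hx, chernWeilForm_oneForm_apply hs hΘ' hx]
  congr 2
  refine Finset.sum_congr rfl fun σ _ => ?_
  rw [pairProd_conj (curvature Θ x) (curvature Θ' x) (hhk x hx)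
    (curvature_gauge hs hΘ hh hk hhk hkh hΘ' h' hx) p _ (hkh x hx), mul_assoc, htr, mul_assoc,
    hhk x hx, mul_one]

theorem chernWeilForm_pullback {W : Type} [NormedAddCommGroup W] [NormedSpace ℝ W]
    [FiniteDimensional ℝ W] {Θ : V → V →L[ℝ] A} {s : Set V} (hs : IsOpen s)
    (hΘ : ContDiffOn ℝ ∞ Θ s) {f : W → V} {x : W} (hx : f x ∈ s) (hf : ContDiffAt ℝ ∞ f x)
    (tr : A →L[ℝ] ℂ) (p : ℕ) :
    chernWeilForm tr p (oneForm fun y => (Θ (f y)).comp (fderiv ℝ f y)) x =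
      pullback f (chernWeilForm tr p (oneForm Θ)) x := by
  have h1 : curvatureForm (oneForm fun y => (Θ (f y)).comp (fderiv ℝ f y)) x =
      (curvatureForm (oneForm Θ) (f x)).compContinuousLinearMap (fderiv ℝ f x) := by
    have h3 : DifferentiableAt ℝ (oneForm Θ) (f x) :=
      ((contDiffOn_oneForm hΘ).differentiableOn (by simp)).differentiableAt (hs.mem_nhds hx)
    have h2 := extDeriv_pullback h3 hf two_le
    ext v
    rw [curvatureForm, ContinuousAlternatingMap.add_apply,
      ContinuousAlternatingMap.compContinuousLinearMap_apply, curvatureForm,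
      ContinuousAlternatingMap.add_apply]
    congr 1
    · exact congrArg (fun α : W [⋀^Fin 2]→L[ℝ] A => α v) h2
  ext v
  rw [chernWeilForm, h1, wedgePow_compContinuousLinearMap]
  rfl

end ChernWeil

/-! ### Geometry and measure of the standard simplex. -/

section Simplex

open MeasureTheory

theorem isClosed_simplex (q : ℕ) : IsClosed (simplex q) := by
  have h : simplex q = (⋂ i, {t | 0 ≤ t i}) ∩ {t | ∑ i, t i ≤ 1} := by
    ext t; simp [simplex]
  rw [h]
  exact (isClosed_iInter fun i => isClosed_le continuous_const (continuous_apply i)).inter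
    (isClosed_le (by fun_prop) continuous_const)

theorem le_one_of_mem_simplex {q : ℕ} {t : Fin q → ℝ} (ht : t ∈ simplex q) (i : Fin q) :
    t i ≤ 1 :=
  (Finset.single_le_sum (fun j _ => ht.1 j) (Finset.mem_univ i)).trans ht.2

theorem isCompact_simplex (q : ℕ) : IsCompact (simplex q) :=
  (isCompact_Icc (a := (0 : Fin q → ℝ)) (b := 1)).of_isClosed_subset (isClosed_simplex q)
    fun _ ht => ⟨fun i => ht.1 i, fun i => le_one_of_mem_simplex ht i⟩

theorem convex_simplex (q : ℕ) : Convex ℝ (simplex q) := by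
  intro x hx y hy a b ha hb hab
  refine ⟨fun i => ?_, ?_⟩
  · have := hx.1 i; have := hy.1 i
    simp only [Pi.add_apply, Pi.smul_apply, smul_eq_mul]
    positivity
  · simp only [Pi.add_apply, Pi.smul_apply, smul_eq_mul, Finset.sum_add_distrib,
      ← Finset.mul_sum]
    nlinarith [hx.2, hy.2]

theorem interior_simplex_nonempty (q : ℕ) : (interior (simplex q)).Nonempty := by
  have h : IsOpen ((⋂ i, {t : Fin q → ℝ | 0 < t i}) ∩ {t | ∑ i, t i < 1}) :=
    (isOpen_iInter_of_finite fun i => isOpen_lt continuous_const (continuous_apply i)).inter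
    (isOpen_lt (by fun_prop) continuous_const)
  refine ⟨fun _ => 1 / (q + 1), interior_maximal ?_ h ⟨?_, ?_⟩⟩
  · rintro t ⟨h1, h2⟩
    exact ⟨fun i => le_of_lt (Set.mem_iInter.1 h1 i), le_of_lt h2⟩
  · exact Set.mem_iInter.2 fun i => by simp only [Set.mem_ofPred_eq]; positivity
  · simp only [Set.mem_ofPred_eq, Finset.sum_const, Finset.card_univ, Fintype.card_fin,
      nsmul_eq_mul]
    rw [mul_one_div, div_lt_one (by positivity)]
    linarith

theorem uniqueDiffOn_simplex (q : ℕ) : UniqueDiffOn ℝ (simplex q) :=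
  uniqueDiffOn_convex (convex_simplex q) (interior_simplex_nonempty q)

theorem simplex_subset_closure_interior (q : ℕ) : simplex q ⊆ closure (interior (simplex q)) := by
  rw [(convex_simplex q).closure_interior_eq_closure_of_nonempty_interior
    (interior_simplex_nonempty q)]
  exact subset_closure

theorem coface_succ {q : ℕ} (i : Fin (q + 1)) (t : Fin q → ℝ) :
    coface i.succ t = i.insertNth (α := fun _ => ℝ) 0 t := by
  funext k
  rcases Fin.eq_self_or_eq_succAbove i k with rfl | ⟨j, rfl⟩
  · simp [coface, Fin.tail]
  · have : (i.succAbove j).succ = i.succ.succAbove j.succ := by simp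
    rw [coface, Fin.tail, this, Fin.insertNth_apply_succAbove, Fin.insertNth_apply_succAbove]
    simp [bary]

theorem coface_zero {q : ℕ} (t : Fin q → ℝ) : coface 0 t = bary t := by
  simp [coface]

theorem insertNth_mem_simplex {q : ℕ} (i : Fin (q + 1)) (x : ℝ) (u : Fin q → ℝ) :
    i.insertNth (α := fun _ => ℝ) x u ∈ simplex (q + 1) ↔
      u ∈ simplex q ∧ x ∈ Set.Icc 0 (1 - ∑ j, u j) := by
  simp only [simplex, Set.mem_ofPred_eq, Fin.forall_iff_succAbove i, Fin.sum_univ_succAbove _ i,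
    Fin.insertNth_apply_same, Fin.insertNth_apply_succAbove, Set.mem_Icc]
  constructor
  · rintro ⟨⟨h1, h2⟩, h3⟩
    exact ⟨⟨h2, by linarith⟩, h1, by linarith⟩
  · rintro ⟨⟨h1, h2⟩, h3, h4⟩
    exact ⟨⟨h3, h1⟩, by linarith⟩

theorem bary_eq_insertNth {q : ℕ} (t : Fin q → ℝ) :
    bary t = (0 : Fin (q + 1)).insertNth (α := fun _ => ℝ) (1 - ∑ j, t j) t := by
  simp [bary]

theorem coface_mem_simplex {q : ℕ} (j : Fin (q + 2)) {t : Fin q → ℝ} (ht : t ∈ simplex q) :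
    coface j t ∈ simplex (q + 1) := by
  refine Fin.cases ?_ (fun i => ?_) j
  · rw [coface_zero, bary_eq_insertNth, insertNth_mem_simplex]
    exact ⟨ht, by simpa using ht.2, le_rfl⟩
  · rw [coface_succ, insertNth_mem_simplex]
    exact ⟨ht, le_rfl, by simpa using ht.2⟩

/-- Fubini in the i-th coordinate: the simplex is the union of the segments [0, 1 - ∑ u_j] over the
points u of a simplex of one dimension less. -/
theorem integral_simplex_succ {q : ℕ} (i : Fin (q + 1)) {g : (Fin (q + 1) → ℝ) → ℂ}
    (hg : ContinuousOn g (simplex (q + 1))) :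
    ∫ t in simplex (q + 1), g t = ∫ u in simplex q,
      ∫ x in (0 : ℝ)..(1 - ∑ j, u j), g (i.insertNth (α := fun _ => ℝ) x u) := by
  have hm := (isClosed_simplex (q + 1)).measurableSet
  have e := (volume_preserving_piFinSuccAbove (fun _ : Fin (q + 1) => ℝ) i).symm
  have hint : Integrable ((simplex (q + 1)).indicator g) :=
    (hg.integrableOn_compact (isCompact_simplex _)).integrable_indicator hm
  have h1 : ∀ z : ℝ × (Fin q → ℝ), (MeasurableEquiv.piFinSuccAbove (fun _ : Fin (q + 1) => ℝ) i).symm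
      z = i.insertNth (α := fun _ => ℝ) z.1 z.2 := fun z => rfl
  rw [← integral_indicator hm, ← e.integral_comp
    (MeasurableEquiv.piFinSuccAbove (fun _ : Fin (q + 1) => ℝ) i).symm.measurableEmbedding,
    Measure.volume_eq_prod, integral_prod_symm, ← integral_indicator (isClosed_simplex q).measurableSet]
  · refine integral_congr_ae (Eventually.of_forall fun u => ?_)
    by_cases hu : u ∈ simplex q
    · have h0 : (0 : ℝ) ≤ 1 - ∑ j, u j := by simpa using hu.2
      simp only [Set.indicator_of_mem hu]
      rw [intervalIntegral.integral_of_le h0, ← integral_Icc_eq_integral_Ioc,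
        ← integral_indicator measurableSet_Icc]
      refine integral_congr_ae (Eventually.of_forall fun x => ?_)
      dsimp only
      rw [h1]
      by_cases hx : x ∈ Set.Icc 0 (1 - ∑ j, u j)
      · rw [Set.indicator_of_mem hx,
          Set.indicator_of_mem ((insertNth_mem_simplex i x u).2 ⟨hu, hx⟩)]
      · rw [Set.indicator_of_notMem hx,
          Set.indicator_of_notMem fun h => hx ((insertNth_mem_simplex i x u).1 h).2]
    · dsimp only
      rw [Set.indicator_of_notMem hu]
      refine integral_eq_zero_of_ae (Eventually.of_forall fun x => ?_)
      dsimp only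
      rw [h1, Set.indicator_of_notMem fun h => hu ((insertNth_mem_simplex i x u).1 h).1]
      rfl
  · exact e.integrable_comp_of_integrable hint

/-- The reflection of the simplex exchanging the barycentric coordinates `t_0` and `t_j`. -/
noncomputable def reflectBary {q : ℕ} (j : Fin q) (t : Fin q → ℝ) : Fin q → ℝ :=
  Function.update t j (1 - ∑ i, t i)

theorem sum_reflectBary {q : ℕ} (j : Fin q) (t : Fin q → ℝ) :
    ∑ i, reflectBary j t i = 1 - t j := by
  rw [reflectBary, Finset.sum_update_of_mem (Finset.mem_univ j),
    Finset.sum_eq_add_sum_sdiff_singleton_of_mem (Finset.mem_univ j) t]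
  ring

theorem reflectBary_involutive {q : ℕ} (j : Fin q) : Function.Involutive (reflectBary j) := by
  intro t
  rw [reflectBary, sum_reflectBary, reflectBary]
  simp

theorem continuous_reflectBary {q : ℕ} (j : Fin q) : Continuous (reflectBary j) := by
  unfold reflectBary
  fun_prop

theorem reflectBary_mem_simplex {q : ℕ} (j : Fin q) {t : Fin q → ℝ} (ht : t ∈ simplex q) :
    reflectBary j t ∈ simplex q := by
  refine ⟨fun i => ?_, ?_⟩
  · by_cases h : i = j
    · subst h
      simpa [reflectBary] using ht.2
    · simpa [reflectBary, h] using ht.1 i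
  · rw [sum_reflectBary]
    linarith [ht.1 j]

theorem measurePreserving_reflectBary {q : ℕ} (j : Fin q) :
    MeasurePreserving (reflectBary j) := by
  let L : (Fin q → ℝ) →ₗ[ℝ] (Fin q → ℝ) :=
    { toFun := fun t => Function.update t j (-∑ i, t i)
      map_add' := fun s t => by
        rw [← Function.update_add]
        congr 1
        simp [Finset.sum_add_distrib]; ring
      map_smul' := fun c t => by
        rw [RingHom.id_apply, ← Function.update_smul]
        congr 1
        simp [Finset.mul_sum] }
  -- The linear part of the reflection is an involution, so its determinant is ±1.
  have hLL : L * L = 1 := by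
    refine LinearMap.ext fun t => ?_
    change Function.update (Function.update t j (-∑ i, t i)) j
      (-∑ i, Function.update t j (-∑ i, t i) i) = t
    rw [Finset.sum_update_of_mem (Finset.mem_univ j),
      Finset.sum_eq_add_sum_sdiff_singleton_of_mem (Finset.mem_univ j) t]
    simp
  have hdet : LinearMap.det L * LinearMap.det L = 1 := by
    rw [← LinearMap.det.map_mul, hLL, map_one]
  have habs : |(LinearMap.det L)⁻¹| = 1 := by
    rcases mul_self_eq_one_iff.1 hdet with h | h <;> simp [h]
  have h1 : MeasurePreserving L := by
    refine ⟨(LinearMap.continuous_of_finiteDimensional L).measurable, ?_⟩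
    rw [Measure.map_linearMap_addHaar_eq_smul_addHaar _ (by
      intro h; rw [h] at hdet; simp at hdet), habs]
    simp
  have h2 := (measurePreserving_add_right (volume : Measure (Fin q → ℝ)) (Pi.single j 1)).comp h1
  suffices h3 : reflectBary j = (fun x => x + Pi.single j 1) ∘ L from h3 ▸ h2
  funext t i
  by_cases h : i = j
  · subst h
    simp [L, reflectBary]
    ring
  · simp [L, reflectBary, h]

theorem setIntegral_reflectBary {q : ℕ} (j : Fin q) (g : (Fin q → ℝ) → ℂ) :
    ∫ t in simplex q, g (reflectBary j t) = ∫ t in simplex q, g t := by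
  let e : (Fin q → ℝ) ≃ₜ (Fin q → ℝ) :=
    { toFun := reflectBary j
      invFun := reflectBary j
      left_inv := reflectBary_involutive j
      right_inv := reflectBary_involutive j
      continuous_toFun := continuous_reflectBary j
      continuous_invFun := continuous_reflectBary j }
  have h := (measurePreserving_reflectBary j).setIntegral_preimage_emb
    e.measurableEmbedding g (simplex q)
  rw [← h]
  congr 2
  ext t
  exact ⟨fun ht => reflectBary_mem_simplex j ht, fun ht => by
    simpa [reflectBary_involutive j t] using reflectBary_mem_simplex j ht⟩

/-- Both sides integrate over the slanted face ∑ t_k = 1, in charts that omit different coordinates.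
Charts omitting neighbouring coordinates differ by a measure-preserving reflection `reflectBary`. -/
theorem setIntegral_bigFace {q : ℕ} (i : Fin (q + 1)) (g : (Fin (q + 1) → ℝ) → ℂ) :
    ∫ u in simplex q, g (i.insertNth (α := fun _ => ℝ) (1 - ∑ j, u j) u) =
      ∫ u in simplex q, g (coface 0 u) := by
  induction i using Fin.induction with
  | zero => simp only [coface_zero, bary_eq_insertNth]
  | succ i ih =>
    rw [← ih, ← setIntegral_reflectBary i]
    refine integral_congr_ae (Eventually.of_forall fun u => ?_)
    dsimp only
    rw [sum_reflectBary, sub_sub_cancel]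
    congr 1
    funext k
    rcases Fin.eq_self_or_eq_succAbove i.castSucc k with rfl | ⟨j, rfl⟩
    · have : i.castSucc = i.succ.succAbove i := by simp
      rw [Fin.insertNth_apply_same]
      conv_lhs => rw [this, Fin.insertNth_apply_succAbove]
      simp [reflectBary]
    · rw [Fin.insertNth_apply_succAbove]
      by_cases hj : j = i
      · subst hj
        simp [reflectBary]
      · have : i.castSucc.succAbove j = i.succ.succAbove j := by
          have hj' : (j : ℕ) ≠ i := fun h => hj (Fin.ext h)
          ext
          simp only [Fin.succAbove, Fin.lt_def, Fin.val_castSucc, Fin.val_succ]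
          split_ifs <;> first | rfl | omega
        rw [this, Fin.insertNth_apply_succAbove]
        simp [reflectBary, hj]

end Simplex

/-! ### Stokes' theorem on a simplex. -/

section Stokes

open MeasureTheory

theorem continuous_insertNth_right {q : ℕ} (i : Fin (q + 1)) {X : Type} [TopologicalSpace X]
    {a : X → ℝ} {b : X → Fin q → ℝ} {s : Set X} (ha : ContinuousOn a s) (hb : ContinuousOn b s) :
    ContinuousOn (fun x => i.insertNth (α := fun _ => ℝ) (a x) (b x)) s := by
  refine continuousOn_pi.2 fun k => ?_
  rcases Fin.eq_self_or_eq_succAbove i k with rfl | ⟨j, rfl⟩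
  · simpa using ha
  · simpa using (continuousOn_pi.1 hb) j

theorem continuous_coface {q : ℕ} (j : Fin (q + 2)) :
    Continuous (coface j : (Fin q → ℝ) → Fin (q + 1) → ℝ) := by
  rw [← continuousOn_univ]
  refine Fin.cases ?_ (fun i => ?_) j
  · have h : (coface 0 : (Fin q → ℝ) → Fin (q + 1) → ℝ) = fun t =>
        (0 : Fin (q + 1)).insertNth (α := fun _ => ℝ) (1 - ∑ j, t j) t :=
      funext fun t => (coface_zero t).trans (bary_eq_insertNth t)
    rw [h]
    exact continuous_insertNth_right _ (by fun_prop) (by fun_prop)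
  · rw [funext (coface_succ i)]
    exact continuous_insertNth_right _ (by fun_prop) (by fun_prop)

/-- The fundamental theorem of calculus on the segments in the i-th coordinate direction: they begin
on the coordinate face `coface i.succ` and end on the slanted face `coface 0`. -/
theorem integral_fderivWithin_simplex {q : ℕ} {g : (Fin (q + 1) → ℝ) → ℂ}
    (hg : ContDiffOn ℝ 1 g (simplex (q + 1))) (i : Fin (q + 1)) :
    ∫ t in simplex (q + 1), fderivWithin ℝ g (simplex (q + 1)) t (Pi.single i 1) =
      (∫ u in simplex q, g (coface 0 u)) - ∫ u in simplex q, g (coface i.succ u) := by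
  have hD : ContinuousOn (fun t => fderivWithin ℝ g (simplex (q + 1)) t (Pi.single i 1))
      (simplex (q + 1)) :=
    (hg.continuousOn_fderivWithin (uniqueDiffOn_simplex _) le_rfl).clm_apply continuousOn_const
  have hface : ∀ j, IntegrableOn (fun u => g (coface j u)) (simplex q) := fun j =>
    (hg.continuousOn.comp (continuous_coface j).continuousOn
      fun _ hu => coface_mem_simplex j hu).integrableOn_compact (isCompact_simplex q)
  have hbig : IntegrableOn (fun u => g (i.insertNth (α := fun _ => ℝ) (1 - ∑ j, u j) u))
      (simplex q) :=
    (hg.continuousOn.comp (continuous_insertNth_right i (by fun_prop) (by fun_prop))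
      fun u hu => (insertNth_mem_simplex i _ u).2
        ⟨hu, by simpa using hu.2, le_rfl⟩).integrableOn_compact (isCompact_simplex q)
  rw [integral_simplex_succ i hD, ← setIntegral_bigFace i g, ← integral_sub hbig (hface _)]
  refine setIntegral_congr_fun (isClosed_simplex q).measurableSet fun u hu => ?_
  have h0 : (0 : ℝ) ≤ 1 - ∑ j, u j := by simpa using hu.2
  have hmaps : ∀ x ∈ Set.Icc 0 (1 - ∑ j, u j),
      i.insertNth (α := fun _ => ℝ) x u ∈ simplex (q + 1) := fun x hx =>
    (insertNth_mem_simplex i x u).2 ⟨hu, hx⟩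
  have hline : ContinuousOn (fun x => i.insertNth (α := fun _ => ℝ) x u)
      (Set.Icc 0 (1 - ∑ j, u j)) :=
    continuous_insertNth_right i continuousOn_id continuousOn_const
  rw [coface_succ]
  refine intervalIntegral.integral_eq_sub_of_hasDerivAt_of_le h0
    (hg.continuousOn.comp hline hmaps) (fun x hx => ?_) ?_
  · have h1 : HasDerivAt (fun x => i.insertNth (α := fun _ => ℝ) x u) (Pi.single i 1) x := by
      refine hasDerivAt_pi.2 fun k => ?_
      rcases Fin.eq_self_or_eq_succAbove i k with rfl | ⟨j, rfl⟩
      · simpa using hasDerivAt_id' x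
      · simpa using hasDerivAt_const x (u j)
    have h2 := ((hg.differentiableOn one_ne_zero) _
      (hmaps x (Set.Ioo_subset_Icc_self hx))).hasFDerivWithinAt
    exact (h2.comp_hasDerivWithinAt x h1.hasDerivWithinAt hmaps).hasDerivAt (Icc_mem_nhds hx.1 hx.2)
  · exact ContinuousOn.intervalIntegrable_of_Icc h0 (hD.comp hline hmaps)

variable {E : Type} [NormedAddCommGroup E] [NormedSpace ℝ E]

theorem castDegree_apply {F : Type} [NormedAddCommGroup F] [NormedSpace ℝ F] {a b : ℕ} (h : a = b)
    (α : DiffForm E F a) (x : E) (v : Fin b → E) :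
    castDegree h α x v = α x fun i => v (Fin.cast h i) := by
  subst h
  rfl

/-- The frame `∂_{t_1}, …, ∂_{t_q}, v_1, …, v_s` on `ℝ^q × E`. -/
def simplexFrame (q : ℕ) {s k : ℕ} (h : k = q + s) (v : Fin s → E) :
    Fin k → (Fin q → ℝ) × E :=
  fun i => if hi : (i : ℕ) < q then (Pi.single ⟨i, hi⟩ 1, 0) else (0, v ⟨i - q, by omega⟩)

theorem contractSimplex_castDegree (q s : ℕ) {k : ℕ} (h : k = q + s)
    (α : DiffForm ((Fin q → ℝ) × E) ℂ k) (z : (Fin q → ℝ) × E) (v : Fin s → E) :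
    contractSimplex q s (castDegree h α z) v = α z (simplexFrame q h v) := by
  change castDegree h α z _ = _
  rw [castDegree_apply]
  congr 1
  funext i
  obtain ⟨j, rfl⟩ : ∃ j : Fin (q + s), i = Fin.cast h.symm j := ⟨Fin.cast h i, by simp⟩
  refine Fin.addCases (fun a => ?_) (fun b => ?_) j
  · simp [simplexFrame]
  · simp [simplexFrame]

theorem contDiffOn_contractSimplex [FiniteDimensional ℝ E] {q s : ℕ}
    {α : DiffForm ((Fin q → ℝ) × E) ℂ (q + s)} {S : Set ((Fin q → ℝ) × E)} {n : WithTop ℕ∞}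
    (hα : ContDiffOn ℝ n α S) : ContDiffOn ℝ n (fun z => contractSimplex q s (α z)) S :=
  contDiffOn_form fun v => contDiffOn_form_apply (w := fun i _ =>
    Fin.append (fun i => (Pi.single i 1, 0)) (fun j => (0, v j)) i) hα fun _ => contDiffOn_const

theorem contDiffOn_castDegree {F : Type} [NormedAddCommGroup F] [NormedSpace ℝ F] {a b : ℕ}
    (h : a = b) {α : DiffForm E F a} {S : Set E}
    {n : WithTop ℕ∞} (hα : ContDiffOn ℝ n α S) : ContDiffOn ℝ n (castDegree h α) S := by
  subst h
  exact hα

theorem contDiffOn_fiberIntegral [FiniteDimensional ℝ E] {q s : ℕ}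
    {α : DiffForm ((Fin q → ℝ) × E) ℂ (q + s)} {W : Set E} (hW : IsOpen W)
    (hα : ContDiffOn ℝ ∞ α (simplex q ×ˢ W)) : ContDiffOn ℝ ∞ (fiberIntegral q s α) W :=
  contDiffOn_setIntegral (isCompact_simplex q) (uniqueDiffOn_simplex q) hW
    (contDiffOn_contractSimplex hα)

theorem fiberIntegral_apply [FiniteDimensional ℝ E] {q s : ℕ}
    {α : DiffForm ((Fin q → ℝ) × E) ℂ (q + s)} {W : Set E}
    (hα : ContinuousOn α (simplex q ×ˢ W)) {x : E} (hx : x ∈ W) (v : Fin s → E) :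
    fiberIntegral q s α x v = ∫ t in simplex q, contractSimplex q s (α (t, x)) v := by
  have h1 : IntegrableOn (fun t => contractSimplex q s (α (t, x))) (simplex q) :=
    integrableOn_slice (isCompact_simplex q)
      (contDiffOn_contractSimplex (contDiffOn_zero.2 hα)).continuousOn hx
  exact ((ContinuousAlternatingMap.apply ℝ E ℂ v).integral_comp_comm h1).symm

theorem fiberIntegral_congr {q s : ℕ} {α β : DiffForm ((Fin q → ℝ) × E) ℂ (q + s)} {x : E}
    (h : ∀ t ∈ simplex q, α (t, x) = β (t, x)) :
    fiberIntegral q s α x = fiberIntegral q s β x :=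
  setIntegral_congr_fun (isClosed_simplex q).measurableSet fun t ht => by
    simp only [h t ht]

/-- An alternating map does not change when multiples of the first vector are subtracted from the
others. -/
theorem alternating_sub_smul_zero {M N : Type} [AddCommGroup M] [Module ℝ M] [AddCommGroup N]
    [Module ℝ N] {n : ℕ} (f : M [⋀^Fin (n + 1)]→ₗ[ℝ] N) (V : Fin (n + 1) → M) (c : Fin n → ℝ) :
    f (Fin.cons (V 0) fun i => V i.succ - c i • V 0) = f V := by
  have h : ∀ s : Finset (Fin n), f (Fin.cons (V 0) fun i => if i ∈ s then V i.succ - c i • V 0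
      else V i.succ) = f V := by
    intro s
    induction s using Finset.induction_on with
    | empty =>
      congr 1
      funext i
      exact Fin.cases rfl (fun _ => by simp) i
    | insert a s ha ih =>
      rw [← ih]
      have h1 : (Fin.cons (V 0) fun i => if i ∈ insert a s then V i.succ - c i • V 0
          else V i.succ : Fin (n + 1) → M) = Function.update (Fin.cons (V 0) fun i =>
          if i ∈ s then V i.succ - c i • V 0 else V i.succ) a.succ (V a.succ - c a • V 0) := by
        funext i
        refine Fin.cases ?_ (fun i => ?_) i
        · rw [Function.update_of_ne (Fin.succ_ne_zero a).symm]
          rfl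
        · by_cases hi : i = a
          · subst hi
            simp
          · rw [Function.update_of_ne (by simpa using hi)]
            simp [hi]
      have h2 : f (Function.update (Fin.cons (V 0) fun i =>
          if i ∈ s then V i.succ - c i • V 0 else V i.succ) a.succ (V 0)) = 0 := by
        refine AlternatingMap.map_eq_zero_of_eq f _ (i := 0) (j := a.succ) ?_
          (Fin.succ_ne_zero a).symm
        rw [Function.update_of_ne (Fin.succ_ne_zero a).symm, Function.update_self]
        rfl
      rw [h1, AlternatingMap.map_update_sub, AlternatingMap.map_update_smul, h2, smul_zero,
        sub_zero]
      congr 1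
      rw [Function.update_eq_self_iff]
      simp [ha]
  have := h Finset.univ
  simpa using this

/-- The left side is (l ∧ α)(V). It does not change when the later vectors are corrected by
multiples of `V 0` so as to lie in the kernel of `l`, and then only the term i = 0 survives. -/
theorem sum_neg_one_pow_mul_removeNth {n : ℕ} (α : E [⋀^Fin n]→L[ℝ] ℂ) (l : E →L[ℝ] ℝ)
    (V : Fin (n + 1) → E) (h : l (V 0) = 1) :
    ∑ i : Fin (n + 1), (-1 : ℤ) ^ (i : ℕ) • l (V i) • α (i.removeNth V) =
      α fun i => V i.succ - l (V i.succ) • V 0 := by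
  let β := ContinuousAlternatingMap.alternatizeUncurryFin (l.smulRight α)
  have hβ : ∀ V, β V = ∑ i : Fin (n + 1), (-1 : ℤ) ^ (i : ℕ) • l (V i) • α (i.removeNth V) :=
    fun V => by
      simp only [β, ContinuousAlternatingMap.alternatizeUncurryFin_apply]
      rfl
  rw [← hβ]
  have h1 := alternating_sub_smul_zero β.toAlternatingMap V fun i => l (V i.succ)
  refine h1.symm.trans ((hβ _).trans ?_)
  rw [Fin.sum_univ_succ, Finset.sum_eq_zero, add_zero]
  · simp only [Fin.cons_zero, h, Fin.val_zero, pow_zero, one_smul]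
    congr 1
  · intro i _
    simp [h]

end Stokes

/-! ### Stokes' theorem along the fibres of Δ^q × E → E. -/

section Stokes

set_option linter.unusedSectionVars false

open MeasureTheory

/-- The linear part of the affine map `coface j`. -/
noncomputable def cofaceLin {q : ℕ} (j : Fin (q + 2)) : (Fin q → ℝ) →L[ℝ] (Fin (q + 1) → ℝ) :=
  LinearMap.toContinuousLinearMap
    { toFun := fun t => Fin.tail (j.insertNth (α := fun _ => ℝ) 0 (Fin.cons (-∑ i, t i) t))
      map_add' := fun s t => by
        funext k
        rcases Fin.eq_self_or_eq_succAbove j k.succ with h | ⟨i, h⟩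
        · simp [Fin.tail, h]
        · simp only [Fin.tail, h, Fin.insertNth_apply_succAbove, Pi.add_apply]
          refine Fin.cases ?_ (fun i => ?_) i
          · simp [Finset.sum_add_distrib]; ring
          · simp
      map_smul' := fun c t => by
        funext k
        rcases Fin.eq_self_or_eq_succAbove j k.succ with h | ⟨i, h⟩
        · simp [Fin.tail, h]
        · simp only [Fin.tail, h, Fin.insertNth_apply_succAbove, Pi.smul_apply, RingHom.id_apply]
          refine Fin.cases ?_ (fun i => ?_) i
          · simp [Finset.mul_sum]
          · simp }

theorem coface_eq {q : ℕ} (j : Fin (q + 2)) (t : Fin q → ℝ) :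
    coface j t = cofaceLin j t + coface j 0 := by
  funext k
  change _ = Fin.tail (j.insertNth (α := fun _ => ℝ) 0 (Fin.cons (-∑ i, t i) t)) k + coface j 0 k
  rcases Fin.eq_self_or_eq_succAbove j k.succ with h | ⟨i, h⟩
  · simp [coface, Fin.tail, h]
  · simp only [coface, Fin.tail, h, Fin.insertNth_apply_succAbove]
    refine Fin.cases ?_ (fun i => ?_) i
    · simp [bary]; ring
    · simp [bary]

theorem hasFDerivAt_coface {q : ℕ} (j : Fin (q + 2)) (t : Fin q → ℝ) :
    HasFDerivAt (coface j) (cofaceLin j) t := by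
  rw [funext (coface_eq j)]
  exact (cofaceLin j).hasFDerivAt.add_const _

theorem contDiff_coface {q : ℕ} (j : Fin (q + 2)) {n : WithTop ℕ∞} :
    ContDiff ℝ n (coface j : (Fin q → ℝ) → Fin (q + 1) → ℝ) := by
  rw [funext (coface_eq j)]
  exact (cofaceLin j).contDiff.add contDiff_const

theorem cofaceLin_zero_single {q : ℕ} (b : Fin q) :
    cofaceLin 0 (Pi.single b 1) = Pi.single b.succ 1 - Pi.single 0 1 := by
  funext k
  change Fin.tail ((0 : Fin (q + 2)).insertNth (α := fun _ => ℝ) 0 (Fin.cons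
    (-∑ i, Pi.single (M := fun _ => ℝ) b 1 i) (Pi.single b 1))) k = _
  refine Fin.cases ?_ (fun k => ?_) k
  · simp [Fin.tail]
  · by_cases h : k = b
    · subst h
      simp [Fin.tail]
    · simp [Fin.tail, h]

theorem cofaceLin_succ_single {q : ℕ} (a : Fin (q + 1)) (b : Fin q) :
    cofaceLin a.succ (Pi.single b 1) = Pi.single (a.succAbove b) 1 := by
  have h0 : cofaceLin a.succ (Pi.single b 1) = a.insertNth (α := fun _ => ℝ) 0 (Pi.single b 1) := by
    have := coface_eq a.succ (Pi.single b 1)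
    rw [coface_succ, coface_succ] at this
    rw [this]
    simp
  rw [h0]
  funext k
  rcases Fin.eq_self_or_eq_succAbove a k with h | ⟨j, h⟩
  · subst h
    rw [Fin.insertNth_apply_same, Pi.single_eq_of_ne (Fin.ne_succAbove _ _)]
  · subst h
    rw [Fin.insertNth_apply_succAbove]
    by_cases hj : j = b
    · subst hj
      simp
    · rw [Pi.single_eq_of_ne hj, Pi.single_eq_of_ne (by simpa using hj)]

variable {E : Type} [NormedAddCommGroup E] [NormedSpace ℝ E]

theorem fderiv_prodMap_coface {q : ℕ} (j : Fin (q + 2)) (z : (Fin q → ℝ) × E) :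
    HasFDerivAt (Prod.map (coface j) id : (Fin q → ℝ) × E → (Fin (q + 1) → ℝ) × E)
      ((cofaceLin j).prodMap (ContinuousLinearMap.id ℝ E)) z :=
  HasFDerivAt.prodMap z (hasFDerivAt_coface j z.1) (hasFDerivAt_id z.2)

/-- For a coordinate face the tangent frame is the ambient frame with one simplex direction omitted,
without a sign; the boundary terms can thus be read as pull-backs to the face. -/
theorem removeNth_simplexFrame_castAdd {q s k : ℕ} (h1 : k + 1 = q + 1 + s) (h2 : k = q + s)
    (a : Fin (q + 1)) (v : Fin s → E) :
    (Fin.cast h1.symm (Fin.castAdd s a)).removeNth (simplexFrame (q + 1) h1 v) = fun i =>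
      (cofaceLin a.succ).prodMap (ContinuousLinearMap.id ℝ E) (simplexFrame q h2 v i) := by
  funext i
  simp only [Fin.removeNth, simplexFrame]
  by_cases hi : (i : ℕ) < q
  · have h3 : ((Fin.cast h1.symm (Fin.castAdd s a)).succAbove i : ℕ) = a.succAbove ⟨i, hi⟩ := by
      simp only [Fin.succAbove, Fin.lt_def]
      split_ifs <;> simp_all <;> omega
    have h4 : ((Fin.cast h1.symm (Fin.castAdd s a)).succAbove i : ℕ) < q + 1 := by
      rw [h3]; omega
    rw [dif_pos h4, dif_pos hi]
    have h5 : (⟨_, h4⟩ : Fin (q + 1)) = a.succAbove ⟨i, hi⟩ := Fin.ext h3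
    rw [h5]
    simp [cofaceLin_succ_single]
  · have h3 : ((Fin.cast h1.symm (Fin.castAdd s a)).succAbove i : ℕ) = i + 1 := by
      have := a.2
      simp only [Fin.succAbove, Fin.lt_def]
      rw [if_neg (by simp; omega)]
      simp
    rw [dif_neg (by omega), dif_neg hi]
    simp [h3]

theorem removeNth_simplexFrame_natAdd {q s k : ℕ} (h1 : k + 1 = q + (s + 1)) (h2 : k = q + s)
    (b : Fin (s + 1)) (v : Fin (s + 1) → E) :
    (Fin.cast h1.symm (Fin.natAdd q b)).removeNth (simplexFrame q h1 v) =
      simplexFrame q h2 (b.removeNth v) := by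
  funext i
  simp only [Fin.removeNth, simplexFrame]
  by_cases hi : (i : ℕ) < q
  · have h3 : ((Fin.cast h1.symm (Fin.natAdd q b)).succAbove i : ℕ) = i := by
      simp only [Fin.succAbove, Fin.lt_def]
      rw [if_pos (by simp; omega)]
      simp
    rw [dif_pos (by omega), dif_pos hi]
    simp [h3]
  · have h3 : ((Fin.cast h1.symm (Fin.natAdd q b)).succAbove i : ℕ) - q =
        b.succAbove ⟨i - q, by omega⟩ := by
      simp only [Fin.succAbove, Fin.lt_def]
      split_ifs <;> simp_all <;> omega
    have h4 : ¬ ((Fin.cast h1.symm (Fin.natAdd q b)).succAbove i : ℕ) < q := by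
      simp only [Fin.succAbove, Fin.lt_def]
      split_ifs <;> simp_all <;> omega
    rw [dif_neg h4, dif_neg hi]
    congr 2
    exact Fin.ext h3

theorem simplexFrame_castAdd {q s k : ℕ} (h : k = q + s) (a : Fin q) (v : Fin s → E) :
    simplexFrame q h v (Fin.cast h.symm (Fin.castAdd s a)) = (Pi.single a 1, 0) := by
  simp [simplexFrame]

theorem simplexFrame_natAdd {q s k : ℕ} (h : k = q + s) (b : Fin s) (v : Fin s → E) :
    simplexFrame q h v (Fin.cast h.symm (Fin.natAdd q b)) = (0, v b) := by
  simp [simplexFrame]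

/-- The slanted face is not a coordinate face: its tangent frame consists of differences of simplex
directions. `sum_neg_one_pow_mul_removeNth`, with `l` the sum of the simplex coordinates, collects
the contributions of all directions into one evaluation on that frame. -/
theorem sum_removeNth_simplexFrame {q s k : ℕ} (h1 : k + 1 = q + 1 + s) (h2 : k = q + s)
    (α : ((Fin (q + 1) → ℝ) × E) [⋀^Fin k]→L[ℝ] ℂ) (v : Fin s → E) :
    ∑ a : Fin (q + 1), (-1 : ℂ) ^ (a : ℕ) *
      α ((Fin.cast h1.symm (Fin.castAdd s a)).removeNth (simplexFrame (q + 1) h1 v)) =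
    α fun i => (cofaceLin 0).prodMap (ContinuousLinearMap.id ℝ E) (simplexFrame q h2 v i) := by
  let l : (Fin (q + 1) → ℝ) × E →L[ℝ] ℝ :=
    (∑ i : Fin (q + 1), ContinuousLinearMap.proj i) ∘L ContinuousLinearMap.fst ℝ _ E
  have hl : ∀ z, l z = ∑ i, z.1 i := fun z => by simp [l]
  have h0 : simplexFrame (q + 1) h1 v 0 = (Pi.single 0 1, 0) := by
    simp [simplexFrame]
  have h := sum_neg_one_pow_mul_removeNth α l (simplexFrame (q + 1) h1 v) (by
    rw [h0, hl]; simp)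
  rw [← (finCongr h1.symm).sum_comp, Fin.sum_univ_add] at h
  simp only [finCongr_apply, simplexFrame_castAdd, simplexFrame_natAdd, hl] at h
  simp only [Pi.zero_apply, Finset.sum_const_zero, zero_smul, smul_zero, add_zero,
    Finset.sum_pi_single', Finset.mem_univ, if_true, one_smul, Fin.val_cast, Fin.val_castAdd] at h
  have h' : ∑ a : Fin (q + 1), (-1 : ℂ) ^ (a : ℕ) *
      α ((Fin.cast h1.symm (Fin.castAdd s a)).removeNth (simplexFrame (q + 1) h1 v)) =
      ∑ a : Fin (q + 1), (-1 : ℤ) ^ (a : ℕ) •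
      α ((Fin.cast h1.symm (Fin.castAdd s a)).removeNth (simplexFrame (q + 1) h1 v)) :=
    Finset.sum_congr rfl fun a _ => by rw [zsmul_eq_mul]; push_cast; rfl
  rw [h', h]
  congr 1
  funext i
  rw [h0]
  by_cases hi : (i : ℕ) < q
  · simp [simplexFrame, hi, cofaceLin_zero_single]
  · simp [simplexFrame, hi]

theorem integral_extDerivWithin_frame [FiniteDimensional ℝ E] {q s k : ℕ}
    (h1 : k + 1 = q + s)
    {α : DiffForm ((Fin q → ℝ) × E) ℂ k} {W : Set E} (hW : IsOpen W)
    (hα : ContDiffOn ℝ ∞ α (simplex q ×ˢ W)) {x : E} (hx : x ∈ W) (v : Fin s → E) :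
    ∫ t in simplex q, extDerivWithin α (simplex q ×ˢ W) (t, x) (simplexFrame q h1 v) =
      (∑ a : Fin q, (-1 : ℂ) ^ (a : ℕ) * ∫ t in simplex q, fderivWithin ℝ
        (fun z => α z ((Fin.cast h1.symm (Fin.castAdd s a)).removeNth
          (simplexFrame q h1 v))) (simplex q ×ˢ W) (t, x) (Pi.single a 1, 0)) +
      ∑ b : Fin s, (-1 : ℂ) ^ (q + b : ℕ) * ∫ t in simplex q, fderivWithin ℝ
        (fun z => α z ((Fin.cast h1.symm (Fin.natAdd q b)).removeNth
          (simplexFrame q h1 v))) (simplex q ×ˢ W) (t, x) (0, v b) := by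
  set S := simplex q ×ˢ W with hS
  set V := simplexFrame q h1 v with hV
  have hu : UniqueDiffOn ℝ S := (uniqueDiffOn_simplex _).prod hW.uniqueDiffOn
  have hαw : ∀ w, ContDiffOn ℝ ∞ (fun z => α z w) S := fun w =>
    contDiffOn_form_apply (w := fun i _ => w i) hα fun _ => contDiffOn_const
  have hint : ∀ w u, IntegrableOn (fun t => fderivWithin ℝ (fun z => α z w) S (t, x) u)
      (simplex q) := fun w u => integrableOn_slice (isCompact_simplex _)
        (F := fun z => fderivWithin ℝ (fun z => α z w) S z u)
        (((hαw w).continuousOn_fderivWithin hu (by simp)).clm_apply continuousOn_const) hx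
  have e1 : ∫ t in simplex q, extDerivWithin α S (t, x) V =
      ∑ i : Fin (k + 1), (-1 : ℂ) ^ (i : ℕ) * ∫ t in simplex q,
        fderivWithin ℝ (fun z => α z (i.removeNth V)) S (t, x) (V i) := by
    simp_rw [← integral_const_mul]
    rw [← integral_finsetSum _ fun i _ => (hint _ _).const_mul _]
    refine setIntegral_congr_fun (isClosed_simplex _).measurableSet fun t ht => ?_
    refine (extDerivWithin_apply ((hα.differentiableOn (by simp)) _ ⟨ht, hx⟩) (hu _ ⟨ht, hx⟩)
      V).trans (Finset.sum_congr rfl fun i _ => ?_)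
    rw [zsmul_eq_mul]
    push_cast
    rfl
  rw [e1, ← (finCongr h1.symm).sum_comp, Fin.sum_univ_add]
  simp only [finCongr_apply, hV, simplexFrame_castAdd, simplexFrame_natAdd, Fin.val_cast,
    Fin.val_castAdd, Fin.val_natAdd]

/-- Differentiating in the a-th simplex direction gives the slanted face minus the face a + 1. The
slanted terms combine to the summand j = 0, and the minus sign turns (-1)^a into the sign (-1)^{a+1}
of the other face. The derivatives along E are left untouched. -/
theorem integral_extDerivWithin_simplexFrame [FiniteDimensional ℝ E] {q s k : ℕ}
    (h1 : k + 1 = q + 1 + s) (h2 : k = q + s)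
    {α : DiffForm ((Fin (q + 1) → ℝ) × E) ℂ k} {W : Set E} (hW : IsOpen W)
    (hα : ContDiffOn ℝ ∞ α (simplex (q + 1) ×ˢ W)) {x : E} (hx : x ∈ W) (v : Fin s → E) :
    ∫ t in simplex (q + 1), extDerivWithin α (simplex (q + 1) ×ˢ W) (t, x)
        (simplexFrame (q + 1) h1 v) =
      (∑ j : Fin (q + 2), (-1 : ℂ) ^ (j : ℕ) * ∫ t in simplex q, α (coface j t, x) fun i =>
        (cofaceLin j).prodMap (ContinuousLinearMap.id ℝ E) (simplexFrame q h2 v i)) +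
      ∑ b : Fin s, (-1 : ℂ) ^ (q + 1 + b : ℕ) * ∫ t in simplex (q + 1), fderivWithin ℝ
        (fun z => α z ((Fin.cast h1.symm (Fin.natAdd (q + 1) b)).removeNth
          (simplexFrame (q + 1) h1 v))) (simplex (q + 1) ×ˢ W) (t, x) (0, v b) := by
  set S := simplex (q + 1) ×ˢ W with hS
  set V := simplexFrame (q + 1) h1 v with hV
  have hu : UniqueDiffOn ℝ S := (uniqueDiffOn_simplex _).prod hW.uniqueDiffOn
  have hαw : ∀ w, ContDiffOn ℝ ∞ (fun z => α z w) S := fun w =>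
    contDiffOn_form_apply (w := fun i _ => w i) hα fun _ => contDiffOn_const
  have e2 : ∀ a : Fin (q + 1), ∀ w, ∫ t in simplex (q + 1),
      fderivWithin ℝ (fun z => α z w) S (t, x) (Pi.single a 1, 0) =
      (∫ t in simplex q, α (coface 0 t, x) w) - ∫ t in simplex q, α (coface a.succ t, x) w := by
    intro a w
    have hs : ContDiffOn ℝ ∞ (fun t => α (t, x) w) (simplex (q + 1)) :=
      (hαw w).comp (f := fun t => (t, x)) (contDiff_prodMk_left x).contDiffOn fun t ht => ⟨ht, hx⟩
    rw [← integral_fderivWithin_simplex (hs.of_le (by simp)) a]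
    refine setIntegral_congr_fun (isClosed_simplex _).measurableSet fun t ht => ?_
    have d1 := (((hαw w).differentiableOn (by simp)) (t, x) ⟨ht, hx⟩).hasFDerivWithinAt
    have d2 : HasFDerivWithinAt (fun t : Fin (q + 1) → ℝ => (t, x))
      (ContinuousLinearMap.inl ℝ (Fin (q + 1) → ℝ) E) (simplex (q + 1)) t :=
      (hasFDerivAt_prodMk_left t x).hasFDerivWithinAt
    have d3 := (d1.comp (f := fun t => (t, x)) t d2 fun t ht => ⟨ht, hx⟩).fderivWithin
      (uniqueDiffOn_simplex _ t ht)
    exact (congrArg (fun L : (Fin (q + 1) → ℝ) →L[ℝ] ℂ => L (Pi.single a 1)) d3).symm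
  have hface : ∀ j w, IntegrableOn (fun t => α (coface j t, x) w) (simplex q) := fun j w =>
    ((hαw w).continuousOn.comp (((continuous_coface j).prodMk continuous_const).continuousOn)
      fun t ht => ⟨coface_mem_simplex j ht, hx⟩).integrableOn_compact (isCompact_simplex q)
  have e3 : ∑ a : Fin (q + 1), (-1 : ℂ) ^ (a : ℕ) * ∫ t in simplex q, α (coface 0 t, x)
      ((Fin.cast h1.symm (Fin.castAdd s a)).removeNth V) = ∫ t in simplex q, α (coface 0 t, x)
        fun i => (cofaceLin 0).prodMap (ContinuousLinearMap.id ℝ E) (simplexFrame q h2 v i) := by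
    simp_rw [← integral_const_mul]
    rw [← integral_finsetSum _ fun i _ => (hface _ _).const_mul _]
    refine setIntegral_congr_fun (isClosed_simplex _).measurableSet fun t ht => ?_
    exact sum_removeNth_simplexFrame h1 h2 _ v
  rw [integral_extDerivWithin_frame h1 hW hα hx v]
  congr 1
  simp only [← hV, e2, ← hS, mul_sub, Finset.sum_sub_distrib]
  rw [e3, sub_eq_add_neg, Fin.sum_univ_succ (n := q + 1)]
  congr 1
  · simp
  · rw [← Finset.sum_neg_distrib]
    refine Finset.sum_congr rfl fun a _ => ?_
    rw [removeNth_simplexFrame_castAdd h1 h2, Fin.val_succ, pow_succ]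
    ring

/-- The derivatives along E pass through the integral; the sign (-1)^q arises because these
directions come after the q simplex directions. -/
theorem sum_integral_fderivWithin_frame [FiniteDimensional ℝ E] {q s k : ℕ}
    (h1 : k + 1 = q + (s + 1)) (h2 : k = q + s)
    {α : DiffForm ((Fin q → ℝ) × E) ℂ k} {W : Set E} (hW : IsOpen W)
    (hα : ContDiffOn ℝ ∞ α (simplex q ×ˢ W)) {x : E} (hx : x ∈ W) (v : Fin (s + 1) → E) :
    ∑ b : Fin (s + 1), (-1 : ℂ) ^ (q + b : ℕ) * ∫ t in simplex q, fderivWithin ℝ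
        (fun z => α z ((Fin.cast h1.symm (Fin.natAdd q b)).removeNth
          (simplexFrame q h1 v))) (simplex q ×ˢ W) (t, x) (0, v b) =
      (-1 : ℂ) ^ q * extDeriv (fiberIntegral q s (castDegree h2 α)) x v := by
  have hα' := contDiffOn_castDegree h2 hα
  rw [extDeriv_apply (((contDiffOn_fiberIntegral hW hα').differentiableOn
    (by simp)).differentiableAt (hW.mem_nhds hx)), Finset.mul_sum]
  refine Finset.sum_congr rfl fun b _ => ?_
  rw [removeNth_simplexFrame_natAdd h1 h2, pow_add, mul_assoc, zsmul_eq_mul]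
  push_cast
  congr 2
  have hF : ContDiffOn ℝ ∞ (fun z => α z (simplexFrame q h2 (b.removeNth v)))
      (simplex q ×ˢ W) :=
    contDiffOn_form_apply (w := fun i _ => simplexFrame q h2 (b.removeNth v) i) hα
      fun _ => contDiffOn_const
  have h3 : HasFDerivAt (fun y => fiberIntegral q s (castDegree h2 α) y (b.removeNth v)) _ x :=
    (hasFDerivAt_setIntegral (μ := volume) (isCompact_simplex q) (uniqueDiffOn_simplex q) hW
      (hF.of_le (by simp)) hx).congr_of_eventuallyEq <| by
      filter_upwards [hW.mem_nhds hx] with y hy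
      rw [fiberIntegral_apply hα'.continuousOn hy]
      simp only [contractSimplex_castDegree]
  rw [h3.fderiv]
  have hu : UniqueDiffOn ℝ (simplex q ×ˢ W) := (uniqueDiffOn_simplex _).prod hW.uniqueDiffOn
  have h4 : IntegrableOn (fun t => (fderivWithin ℝ (fun z => α z (simplexFrame q h2
      (b.removeNth v))) (simplex q ×ˢ W) (t, x)) ∘L ContinuousLinearMap.inr ℝ (Fin q → ℝ) E)
      (simplex q) := integrableOn_slice (isCompact_simplex _)
        (F := fun z => (fderivWithin ℝ (fun z => α z (simplexFrame q h2
          (b.removeNth v))) (simplex q ×ˢ W) z) ∘L ContinuousLinearMap.inr ℝ (Fin q → ℝ) E)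
        ((hF.continuousOn_fderivWithin hu (by simp)).clm_comp continuousOn_const) hx
  exact ((ContinuousLinearMap.apply ℝ ℂ (v b)).integral_comp_comm h4)

end Stokes

/-! ### Pull-backs along maps defined on a simplex times an open set. -/

section PullbackIntegral

set_option linter.unusedSectionVars false

open MeasureTheory

variable {E F H : Type} [NormedAddCommGroup E] [NormedSpace ℝ E] [FiniteDimensional ℝ E]
  [NormedAddCommGroup F] [NormedSpace ℝ F] [FiniteDimensional ℝ F]
  [NormedAddCommGroup H] [NormedSpace ℝ H] [FiniteDimensional ℝ H]

theorem uniqueDiffOn_simplex_prod_univ (q : ℕ) :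
    UniqueDiffOn ℝ (simplex q ×ˢ (Set.univ : Set E)) :=
  (uniqueDiffOn_simplex q).prod uniqueDiffOn_univ

/-- Derivatives within a set are local. The definition of β uses all of E as second factor, while
the maps are smooth only over the open set `W`; over `W` there is no difference. -/
theorem fderivWithin_simplex_prod {q : ℕ} {W : Set E} (hW : IsOpen W) {t : Fin q → ℝ} {x : E}
    (hx : x ∈ W) (g : (Fin q → ℝ) × E → F) :
    fderivWithin ℝ g (simplex q ×ˢ W) (t, x) =
      fderivWithin ℝ g (simplex q ×ˢ (Set.univ : Set E)) (t, x) := by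
  have h : simplex q ×ˢ W = (simplex q ×ˢ (Set.univ : Set E)) ∩ (Set.univ ×ˢ W) := by
    ext z; simp [Set.mem_prod]
  rw [h]
  exact fderivWithin_inter ((isOpen_univ.prod hW).mem_nhds ⟨trivial, hx⟩)

theorem contDiffOn_pullbackWithin {q s : ℕ} {W : Set E} (hW : IsOpen W)
    {g : (Fin q → ℝ) × E → F} (hg : ContDiffOn ℝ ∞ g (simplex q ×ˢ W)) {O : Set F}
    {α : DiffForm F ℂ s} (hα : ContDiffOn ℝ ∞ α O) (hgO : ∀ z ∈ simplex q ×ˢ W, g z ∈ O) :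
    ContDiffOn ℝ ∞ (pullbackWithin g (simplex q ×ˢ Set.univ) α) (simplex q ×ˢ W) := by
  have h1 : ContDiffOn ℝ ∞ (pullbackWithin g (simplex q ×ˢ W) α) (simplex q ×ˢ W) := by
    refine contDiffOn_form fun v => ?_
    exact contDiffOn_form_apply (F := fun z => α (g z))
      (w := fun i z => fderivWithin ℝ g (simplex q ×ˢ W) z (v i)) (hα.comp hg hgO)
      fun i => (hg.fderivWithin (m := ∞) ((uniqueDiffOn_simplex q).prod hW.uniqueDiffOn)
        (by simp)).clm_apply contDiffOn_const
  refine h1.congr fun z hz => ?_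
  rw [pullbackWithin, pullbackWithin, fderivWithin_simplex_prod hW hz.2]

theorem extDerivWithin_pullbackWithin {q s : ℕ} {W : Set E} (hW : IsOpen W)
    {g : (Fin q → ℝ) × E → F} (hg : ContDiffOn ℝ ∞ g (simplex q ×ˢ W)) {O : Set F}
    (hO : IsOpen O) {α : DiffForm F ℂ s} (hα : ContDiffOn ℝ ∞ α O)
    (hgO : ∀ z ∈ simplex q ×ˢ W, g z ∈ O) {z : (Fin q → ℝ) × E} (hz : z ∈ simplex q ×ˢ W) :
    extDerivWithin (pullbackWithin g (simplex q ×ˢ Set.univ) α) (simplex q ×ˢ W) z =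
      pullbackWithin g (simplex q ×ˢ Set.univ) (extDeriv α) z := by
  have h1 : Set.EqOn (pullbackWithin g (simplex q ×ˢ Set.univ) α)
      (fun z => (α (g z)).compContinuousLinearMap (fderivWithin ℝ g (simplex q ×ˢ W) z))
      (simplex q ×ˢ W) := fun z hz => by
    dsimp only
    rw [pullbackWithin, fderivWithin_simplex_prod hW hz.2]
  have h2 : DifferentiableWithinAt ℝ α O (g z) := (hα.differentiableOn (by simp)) _ (hgO z hz)
  -- Second derivatives within the set are also symmetric at boundary points of the simplex, as
  -- these are limits of interior points.
  have hc : z ∈ closure (interior (simplex q ×ˢ W)) := by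
    rw [interior_prod_eq, closure_prod_eq, hW.interior_eq]
    exact ⟨simplex_subset_closure_interior q hz.1, subset_closure hz.2⟩
  rw [extDerivWithin_congr' h1 hz, extDerivWithin_pullback h2 (hg z hz) two_le
    ((uniqueDiffOn_simplex q).prod hW.uniqueDiffOn) hc hz hgO, pullbackWithin,
    fderivWithin_simplex_prod hW hz.2]
  congr 1
  rw [extDerivWithin, fderivWithin_of_isOpen hO (hgO z hz)]
  rfl

theorem pullbackWithin_congr {q s : ℕ} {W : Set E} (hW : IsOpen W) {g g' : (Fin q → ℝ) × E → F}
    (α : DiffForm F ℂ s) (h : Set.EqOn g g' (simplex q ×ˢ W)) {z : (Fin q → ℝ) × E}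
    (hz : z ∈ simplex q ×ˢ W) :
    pullbackWithin g (simplex q ×ˢ Set.univ) α z =
      pullbackWithin g' (simplex q ×ˢ Set.univ) α z := by
  rw [pullbackWithin, pullbackWithin, ← fderivWithin_simplex_prod hW hz.2,
    ← fderivWithin_simplex_prod hW hz.2, fderivWithin_congr h (h hz), h hz]

theorem pullbackWithin_pullback {q s : ℕ} {W : Set E} (hW : IsOpen W)
    {g : (Fin q → ℝ) × E → F} (hg : ContDiffOn ℝ ∞ g (simplex q ×ˢ W)) {f : F → H}
    (hf : ContDiff ℝ ∞ f) (α : DiffForm H ℂ s) {z : (Fin q → ℝ) × E} (hz : z ∈ simplex q ×ˢ W) :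
    pullbackWithin g (simplex q ×ˢ Set.univ) (pullback f α) z =
      pullbackWithin (f ∘ g) (simplex q ×ˢ Set.univ) α z := by
  simp only [pullbackWithin, pullback]
  rw [← fderivWithin_simplex_prod hW hz.2, ← fderivWithin_simplex_prod hW hz.2,
    fderiv_comp_fderivWithin z (hf.differentiable (by simp) _)
    ((hg.differentiableOn (by simp)) z hz) (((uniqueDiffOn_simplex q).prod hW.uniqueDiffOn) z hz)]
  rfl

theorem pullback_prodMap_pullbackWithin {q q' s : ℕ} {W : Set E} (hW : IsOpen W) {W' : Set F}
    (hW' : IsOpen W') {g : (Fin q → ℝ) × E → H} (hg : ContDiffOn ℝ ∞ g (simplex q ×ˢ W))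
    {c : (Fin q' → ℝ) → (Fin q → ℝ)} (hc : ContDiff ℝ ∞ c) {φ : F → E} (hφ : ContDiff ℝ ∞ φ)
    (hcm : Set.MapsTo c (simplex q') (simplex q)) (hφm : Set.MapsTo φ W' W)
    (α : DiffForm H ℂ s) {z : (Fin q' → ℝ) × F} (hz : z ∈ simplex q' ×ˢ W') :
    pullback (Prod.map c φ) (pullbackWithin g (simplex q ×ˢ Set.univ) α) z =
      pullbackWithin (g ∘ Prod.map c φ) (simplex q' ×ˢ Set.univ) α z := by
  have hd : ContDiff ℝ ∞ (Prod.map c φ) := hc.prodMap hφ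
  have hm : Set.MapsTo (Prod.map c φ) (simplex q' ×ˢ W') (simplex q ×ˢ W) :=
    fun z hz => ⟨hcm hz.1, hφm hz.2⟩
  have hu : UniqueDiffWithinAt ℝ (simplex q' ×ˢ W') z :=
    ((uniqueDiffOn_simplex q').prod hW'.uniqueDiffOn) z hz
  simp only [pullbackWithin, pullback]
  rw [← fderivWithin_simplex_prod hW' hz.2, fderivWithin_comp z
    ((hg.differentiableOn (by simp)) _ (hm hz)) (hd.differentiable (by simp) z).differentiableWithinAt
    hm hu, (hd.differentiable (by simp) z).fderivWithin hu]
  rw [← fderivWithin_simplex_prod hW (show (Prod.map c φ z).2 ∈ W from hφm hz.2)]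
  rfl

/-- Pull-backs commute with integration along the fibre. -/
theorem pullback_fiberIntegral {q s : ℕ} {W : Set E}
    {α : DiffForm ((Fin q → ℝ) × E) ℂ (q + s)} (hα : ContinuousOn α (simplex q ×ˢ W))
    {φ : F → E} (hφ : Differentiable ℝ φ) {x : F} (hx : φ x ∈ W) :
    pullback φ (fiberIntegral q s α) x =
      fiberIntegral q s (pullback (Prod.map id φ) α) x := by
  have h1 : IntegrableOn (fun t => contractSimplex q s (α (t, φ x))) (simplex q) :=
    integrableOn_slice (isCompact_simplex q)
      (contDiffOn_contractSimplex (contDiffOn_zero.2 hα)).continuousOn hx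
  let L : (E [⋀^Fin s]→L[ℝ] ℂ) →L[ℝ] (F [⋀^Fin s]→L[ℝ] ℂ) :=
    ContinuousAlternatingMap.compContinuousLinearMapCLM (fderiv ℝ φ x)
  have h2 := L.integral_comp_comm h1
  refine h2.symm.trans (setIntegral_congr_fun (isClosed_simplex q).measurableSet fun t ht => ?_)
  ext v
  have h3 : HasFDerivAt (Prod.map id φ : (Fin q → ℝ) × F → _)
      ((ContinuousLinearMap.id ℝ (Fin q → ℝ)).prodMap (fderiv ℝ φ x)) (t, x) :=
    HasFDerivAt.prodMap (t, x) (hasFDerivAt_id t) (hφ x).hasFDerivAt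
  change α (t, φ x) _ = α (t, φ x) _
  congr 1
  funext i
  change Fin.append _ (fun j => ((0 : Fin q → ℝ), fderiv ℝ φ x (v j))) i =
    fderiv ℝ (Prod.map id φ) (t, x) (Fin.append _ (fun j => ((0 : Fin q → ℝ), v j)) i)
  rw [h3.fderiv]
  refine Fin.addCases (fun a => ?_) (fun b => ?_) i <;> simp

/-- The derivative of `g` kills the simplex directions, so the contracted form vanishes. This needs
at least one such direction, whence the dimension q + 1. -/
theorem fiberIntegral_eq_zero_of_snd {q s : ℕ} {g : (Fin (q + 1) → ℝ) × E → F} {W : Set E}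
    (hW : IsOpen W) {f : E → F} (hf : DifferentiableOn ℝ f W)
    (h : ∀ z ∈ simplex (q + 1) ×ˢ W, g z = f z.2)
    (α : DiffForm F ℂ (q + 1 + s)) {x : E} (hx : x ∈ W) :
    fiberIntegral (q + 1) s (pullbackWithin g (simplex (q + 1) ×ˢ Set.univ) α) x = 0 := by
  refine setIntegral_eq_zero_of_forall_eq_zero fun t ht => ?_
  ext v
  have h1 : HasFDerivWithinAt (fun z : (Fin (q + 1) → ℝ) × E => f z.2)
      (fderiv ℝ f x ∘L ContinuousLinearMap.snd ℝ _ E) (simplex (q + 1) ×ˢ W) (t, x) :=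
    ((hf.differentiableAt (hW.mem_nhds hx)).hasFDerivAt.comp (t, x)
      hasFDerivAt_snd).hasFDerivWithinAt
  have h2 : fderivWithin ℝ g (simplex (q + 1) ×ˢ Set.univ) (t, x) =
      fderiv ℝ f x ∘L ContinuousLinearMap.snd ℝ _ E := by
    rw [← fderivWithin_simplex_prod hW hx, fderivWithin_congr h (h _ ⟨ht, hx⟩)]
    exact h1.fderivWithin (((uniqueDiffOn_simplex _).prod hW.uniqueDiffOn) _ ⟨ht, hx⟩)
  change α (g (t, x)) (fun i => fderivWithin ℝ g (simplex (q + 1) ×ˢ Set.univ) (t, x) _) = 0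
  rw [h2]
  refine (α (g (t, x))).map_coord_zero (Fin.castAdd s 0) ?_
  simp

theorem fiberIntegral_zero {s : ℕ} (α : DiffForm ((Fin 0 → ℝ) × E) ℂ (0 + s)) (x : E)
    (v : Fin s → E) :
    fiberIntegral 0 s α x v = contractSimplex 0 s (α (0, x)) v := by
  have h : simplex 0 = Set.univ := by
    ext t; simp [simplex]
  have h1 : fiberIntegral 0 s α x = contractSimplex 0 s (α (0, x)) := by
    rw [fiberIntegral, h, Measure.restrict_univ, integral_unique]
    have : (volume : Measure (Fin 0 → ℝ)).real Set.univ = 1 := by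
      simp [Measure.real, volume_pi]
    rw [this, one_smul]
    exact congrArg (fun t => contractSimplex 0 s (α (t, x))) (Subsingleton.elim _ _)
  rw [h1]

end PullbackIntegral

theorem traceCLM_mul_comm (a b : Mat n) : traceCLM n (a * b) = traceCLM n (b * a) :=
  Matrix.trace_mul_comm (R := ℂ) a b

/-! ### The Chern–Weil forms on Δ^m × G^m and their restrictions to faces. -/

section Nerve

attribute [local irreducible] instNormedRingMat instNormedAlgebraRealMat

section ChernForms

open MeasureTheory

variable {n : ℕ}

/-- The tuples of invertible matrices. -/
def invTuples (n m : ℕ) : Set (MatTuple n m) := {h | ∀ i, IsUnit (h i)}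

theorem isOpen_invTuples (n m : ℕ) : IsOpen (invTuples n m) := by
  have h : invTuples n m = ⋂ i, (fun h : MatTuple n m => h i) ⁻¹' {a | IsUnit a} := by
    ext h; simp [invTuples]
  rw [h]
  exact isOpen_iInter_of_finite fun i => Units.isOpen.preimage (continuous_apply i)

theorem face_mem_invTuples {m : ℕ} {h : MatTuple n (m + 1)} (hh : h ∈ invTuples n (m + 1)) (i : ℕ) :
    face i h ∈ invTuples n m := fun k => by
  unfold face
  split_ifs
  · exact hh _
  · exact (hh _).mul (hh _)
  · exact hh _

theorem nerveSection_castSucc {m : ℕ} (h : MatTuple n m) (i : Fin m) :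
    nerveSection h i.castSucc = h i * nerveSection h i.succ := by
  unfold nerveSection
  rw [← List.prod_cons]
  congr 1
  rw [Fin.val_castSucc, Fin.val_succ, List.drop_eq_getElem_cons (by simp)]
  simp

theorem nerveSection_last {m : ℕ} (h : MatTuple n m) : nerveSection h (Fin.last m) = 1 := by
  rw [nerveSection, List.drop_eq_nil_of_le (by simp), List.prod_nil]

theorem nerveSection_mem {m : ℕ} {h : MatTuple n m} (hh : h ∈ invTuples n m) :
    nerveSection h ∈ invTuples n (m + 1) := fun i => by
  unfold nerveSection
  refine List.prod_isUnit fun a ha => ?_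
  obtain ⟨j, rfl⟩ := (List.mem_ofFn' h a).1 (List.mem_of_mem_drop ha)
  exact hh j

theorem contDiff_nerveSection (n m : ℕ) :
    ContDiff ℝ ∞ (nerveSection : MatTuple n m → MatTuple n (m + 1)) := by
  refine contDiff_pi.2 fun i => ?_
  have h : (fun h : MatTuple n m => nerveSection h i) =
      fun h => (((List.finRange m).drop i).map fun j => h j).prod := by
    funext h
    rw [nerveSection, List.ofFn_eq_map, List.map_drop]
  rw [h, ← contDiffOn_univ]
  exact contDiffOn_list_prod (fun j => (contDiff_apply ℝ (Mat n) j).contDiffOn) _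

/-- The factor by which the sections of the nerve before and after the face operator `ε_j`
differ. -/
noncomputable def faceGauge {m : ℕ} (j : Fin (m + 2)) (h : MatTuple n (m + 1)) : Mat n :=
  if j = Fin.last (m + 1) then h (Fin.last m) else 1

/-- Both sides satisfy the same recursion, going down from the last index. The section is normalized
by its last entry being 1, so a correction appears only when that entry is the one deleted. -/
theorem nerveSection_succAbove {m : ℕ} (j : Fin (m + 2)) (h : MatTuple n (m + 1))
    (i : Fin (m + 1)) :
    nerveSection h (j.succAbove i) = nerveSection (face j h) i * faceGauge j h := by
  induction i using Fin.reverseInduction with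
  | last =>
    rw [nerveSection_last, one_mul, faceGauge]
    split_ifs with hj
    · rw [hj, Fin.succAbove_last, nerveSection_castSucc, Fin.succ_last, nerveSection_last, mul_one]
    · rw [Fin.succAbove_ne_last_last hj, nerveSection_last]
  | cast a ih =>
    rw [nerveSection_castSucc, mul_assoc, ← ih, face]
    split_ifs with h1 h2
    · rw [Fin.succAbove_of_castSucc_lt _ _ (by simp [Fin.lt_def]; omega),
        Fin.succAbove_of_castSucc_lt _ _ (by simp [Fin.lt_def]; omega), nerveSection_castSucc,
        Fin.succ_castSucc]
    · rw [Fin.succAbove_of_castSucc_lt _ _ (by simp [Fin.lt_def]; omega),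
        Fin.succAbove_of_le_castSucc _ _ (by simp [Fin.le_def]; omega), nerveSection_castSucc,
        Fin.succ_castSucc, nerveSection_castSucc, mul_assoc]
    · rw [Fin.succAbove_of_le_castSucc _ _ (by simp [Fin.le_def]; omega),
        Fin.succAbove_of_le_castSucc _ _ (by simp [Fin.le_def]; omega), Fin.succ_castSucc,
        nerveSection_castSucc]

theorem isUnit_faceGauge {m : ℕ} (j : Fin (m + 2)) {h : MatTuple n (m + 1)}
    (hh : h ∈ invTuples n (m + 1)) : IsUnit (faceGauge j h) := by
  unfold faceGauge
  split_ifs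
  · exact hh _
  · exact isUnit_one

theorem contDiff_faceGauge {m : ℕ} (j : Fin (m + 2)) :
    ContDiff ℝ ∞ (faceGauge j : MatTuple n (m + 1) → Mat n) := by
  unfold faceGauge
  split_ifs
  · fun_prop
  · exact contDiff_const

theorem contDiffOn_inverse : ContDiffOn ℝ ∞ (Ring.inverse : Mat n → Mat n) {a | IsUnit a} := by
  rintro a ⟨u, rfl⟩
  exact (contDiffAt_ringInverse ℝ u).contDiffWithinAt

theorem bary_coface {q : ℕ} (j : Fin (q + 2)) (t : Fin q → ℝ) :
    bary (coface j t) = j.insertNth (α := fun _ => ℝ) 0 (bary t) := by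
  have h : ∑ k, j.insertNth (α := fun _ => ℝ) 0 (bary t) k = 1 := by
    rw [Fin.sum_univ_succAbove _ j]
    simp [bary, Fin.sum_univ_succ]
  -- Both sides have sum 1, so their entries with index 0 agree because the others do.
  rw [Fin.sum_univ_succ] at h
  funext k
  refine Fin.cases ?_ (fun k => ?_) k
  · rw [bary, Fin.cons_zero, ← h]
    simp [coface, Fin.tail]
  · simp [bary, coface, Fin.tail]

theorem sum_bary {q : ℕ} (t : Fin q → ℝ) : ∑ i, bary t i = 1 := by
  simp [bary, Fin.sum_univ_succ]

theorem contDiff_bary {q : ℕ} (i : Fin (q + 1)) :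
    ContDiff ℝ ∞ fun t : Fin q → ℝ => bary t i := by
  refine Fin.cases ?_ (fun i => ?_) i
  · simp only [bary, Fin.cons_zero]
    fun_prop
  · simp only [bary, Fin.cons_succ]
    fun_prop

/-- The family of linear maps underlying the canonical connection. -/
noncomputable def connectionMap (n m : ℕ) (x : (Fin m → ℝ) × MatTuple n (m + 1)) :
    (Fin m → ℝ) × MatTuple n (m + 1) →L[ℝ] Mat n :=
  ∑ i : Fin (m + 1), bary x.1 i • (ContinuousLinearMap.mul ℝ (Mat n) (Ring.inverse (x.2 i)) ∘L
      ContinuousLinearMap.proj i ∘L ContinuousLinearMap.snd ℝ (Fin m → ℝ) (MatTuple n (m + 1)))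

theorem contDiffOn_connectionMap (n m : ℕ) :
    ContDiffOn ℝ ∞ (connectionMap n m) (Set.univ ×ˢ invTuples n (m + 1)) := by
  refine ContDiffOn.sum fun i _ => ?_
  have h1 : ContDiffOn ℝ ∞ (fun x : (Fin m → ℝ) × MatTuple n (m + 1) => bary x.1 i)
      (Set.univ ×ˢ invTuples n (m + 1)) := ((contDiff_bary i).comp contDiff_fst).contDiffOn
  have h2 : ContDiffOn ℝ ∞ (fun x : (Fin m → ℝ) × MatTuple n (m + 1) => Ring.inverse (x.2 i))
      (Set.univ ×ˢ invTuples n (m + 1)) :=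
    contDiffOn_inverse.comp (by fun_prop) fun x hx => hx.2 i
  refine (((ContinuousLinearMap.mul ℝ (Mat n)).contDiff.comp_contDiffOn (h1.smul h2)).clm_comp
    (contDiffOn_const (c := ContinuousLinearMap.proj i ∘L
      ContinuousLinearMap.snd ℝ (Fin m → ℝ) (MatTuple n (m + 1))))).congr fun x _ =>
    ContinuousLinearMap.ext fun v => ?_
  exact (smul_mul_assoc (bary x.1 i) (Ring.inverse (x.2 i)) (v.2 i)).symm

/-- The section of the nerve on the products with the simplices. -/
noncomputable def simplexSection (n m : ℕ) (y : (Fin m → ℝ) × MatTuple n m) :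
    (Fin m → ℝ) × MatTuple n (m + 1) := (y.1, nerveSection y.2)

theorem contDiff_simplexSection (n m : ℕ) : ContDiff ℝ ∞ (simplexSection n m) :=
  contDiff_fst.prodMk ((contDiff_nerveSection n m).comp contDiff_snd)

/-- The pull-back of the canonical connection by the section. -/
noncomputable def nerveConnection (n m : ℕ) (y : (Fin m → ℝ) × MatTuple n m) :
    (Fin m → ℝ) × MatTuple n m →L[ℝ] Mat n :=
  (connectionMap n m (simplexSection n m y)).comp (fderiv ℝ (simplexSection n m) y)

theorem isOpen_univ_prod_invTuples (m k : ℕ) :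
    IsOpen ((Set.univ : Set (Fin m → ℝ)) ×ˢ invTuples n k) :=
  isOpen_univ.prod (isOpen_invTuples n k)

theorem contDiffOn_nerveConnection (n m : ℕ) :
    ContDiffOn ℝ ∞ (nerveConnection n m) (Set.univ ×ˢ invTuples n m) :=
  ((contDiffOn_connectionMap n m).comp (contDiff_simplexSection n m).contDiffOn fun _ hx =>
    ⟨trivial, nerveSection_mem hx.2⟩).clm_comp
    ((contDiff_simplexSection n m).fderiv_right (m := ∞) (by simp)).contDiffOn

theorem nerveConnection_apply {m : ℕ} (y v : (Fin m → ℝ) × MatTuple n m) :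
    nerveConnection n m y v = ∑ i : Fin (m + 1), bary y.1 i •
      (Ring.inverse (nerveSection y.2 i) *
        fderiv ℝ (fun h : MatTuple n m => nerveSection h i) y.2 v.2) := by
  have h1 : ∀ i, HasFDerivAt (fun h : MatTuple n m => nerveSection h i)
      (fderiv ℝ (fun h : MatTuple n m => nerveSection h i) y.2) y.2 := fun i =>
    ((contDiff_pi.1 (contDiff_nerveSection n m) i).differentiable (by simp) _).hasFDerivAt
  have h2 : HasFDerivAt (simplexSection n m) ((ContinuousLinearMap.fst ℝ _ _).prod
      ((ContinuousLinearMap.pi fun i => fderiv ℝ (fun h : MatTuple n m => nerveSection h i) y.2) ∘L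
        ContinuousLinearMap.snd ℝ _ _)) y :=
    hasFDerivAt_fst.prodMk ((hasFDerivAt_pi.2 h1).comp y hasFDerivAt_snd)
  rw [nerveConnection, h2.fderiv, connectionMap]
  simp [simplexSection, sum_apply]

/-- The Chern–Weil form of the connection on `Δ^m × G^m`. -/
noncomputable def nerveChernWeil (n p m : ℕ) : DiffForm ((Fin m → ℝ) × MatTuple n m) ℂ (2 * p) :=
  chernWeilForm (traceCLM n) p (oneForm (nerveConnection n m))

theorem contDiffOn_nerveChernWeil (n p m : ℕ) :
    ContDiffOn ℝ ∞ (nerveChernWeil n p m) (Set.univ ×ˢ invTuples n m) :=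
  contDiffOn_chernWeilForm (isOpen_univ_prod_invTuples m m) (contDiffOn_nerveConnection n m) _ p

theorem pullback_chernFormTotal {p m : ℕ} {y : (Fin m → ℝ) × MatTuple n m}
    (hy : y.2 ∈ invTuples n m) :
    pullback (fun y : (Fin m → ℝ) × MatTuple n m => (y.1, nerveSection y.2))
      (chernFormTotal n p m) y = nerveChernWeil n p m y :=
  (chernWeilForm_pullback (isOpen_univ_prod_invTuples m (m + 1)) (contDiffOn_connectionMap n m)
    (f := simplexSection n m) ⟨trivial, nerveSection_mem hy⟩
    (contDiff_simplexSection n m).contDiffAt (traceCLM n) p).symm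

/-- On the j-th face of the simplex, the connection is the gauge transform by `faceGauge j` of the
connection pulled back along `face j`; the Chern–Weil form is gauge invariant. -/
theorem pullback_coface_nerveChernWeil {p m : ℕ} (j : Fin (m + 2))
    {z : (Fin m → ℝ) × MatTuple n (m + 1)} (hz : z.2 ∈ invTuples n (m + 1)) :
    pullback (Prod.map (coface j) id) (nerveChernWeil n p (m + 1)) z =
      pullback (Prod.map id (face j)) (nerveChernWeil n p m) z := by
  have hc : ContDiff ℝ ∞ (Prod.map (coface j) id : (Fin m → ℝ) × MatTuple n (m + 1) → _) :=
    (contDiff_coface j).prodMap contDiff_id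
  have hf : ContDiff ℝ ∞ (Prod.map id (face j) : (Fin m → ℝ) × MatTuple n (m + 1) →
      (Fin m → ℝ) × MatTuple n m) := contDiff_id.prodMap (contDiff_face j)
  have hO := isOpen_univ_prod_invTuples (n := n) m (m + 1)
  have hk : ContDiffOn ℝ ∞ (fun y : (Fin m → ℝ) × MatTuple n (m + 1) =>
      Ring.inverse (faceGauge j y.2)) (Set.univ ×ˢ invTuples n (m + 1)) :=
    contDiffOn_inverse.comp (((contDiff_faceGauge j).comp contDiff_snd).contDiffOn)
      fun y hy => isUnit_faceGauge j hy.2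
  have hΘ := (contDiffOn_nerveConnection n m).comp hf.contDiffOn
    (s := Set.univ ×ˢ invTuples n (m + 1)) fun y hy => ⟨trivial, face_mem_invTuples hy.2 j⟩
  have hΘ' := (contDiffOn_nerveConnection n (m + 1)).comp hc.contDiffOn
    (s := Set.univ ×ˢ invTuples n (m + 1)) fun y hy => ⟨trivial, hy.2⟩
  rw [nerveChernWeil, nerveChernWeil, ← chernWeilForm_pullback
    (isOpen_univ_prod_invTuples (m + 1) (m + 1)) (contDiffOn_nerveConnection n (m + 1))
    (f := Prod.map (coface j) id) ⟨trivial, hz⟩ hc.contDiffAt, ← chernWeilForm_pullback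
    (isOpen_univ_prod_invTuples m m) (contDiffOn_nerveConnection n m)
    (f := Prod.map id (face j)) ⟨trivial, face_mem_invTuples hz j⟩ hf.contDiffAt]
  refine chernWeilForm_gauge hO
    (hΘ.clm_comp (hf.fderiv_right (m := ∞) (by simp)).contDiffOn)
    ((contDiff_faceGauge j).comp contDiff_snd).contDiffOn hk
    (fun y hy => Ring.mul_inverse_cancel _ (isUnit_faceGauge j hy.2))
    (fun y hy => Ring.inverse_mul_cancel _ (isUnit_faceGauge j hy.2))
    (hΘ'.clm_comp (hc.fderiv_right (m := ∞) (by simp)).contDiffOn) ?_ ⟨trivial, hz⟩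
    traceCLM_mul_comm p
  rintro ⟨t, h⟩ ⟨-, hh⟩ ⟨a, u⟩
  have d1 : fderiv ℝ (Prod.map id (face j) : (Fin m → ℝ) × MatTuple n (m + 1) →
      (Fin m → ℝ) × MatTuple n m) (t, h) (a, u) = (a, fderiv ℝ (face j) h u) := by
    have : HasFDerivAt (Prod.map id (face j) : (Fin m → ℝ) × MatTuple n (m + 1) →
      (Fin m → ℝ) × MatTuple n m) ((ContinuousLinearMap.id ℝ _).prodMap (fderiv ℝ (face j) h))
        (t, h) := HasFDerivAt.prodMap (t, h) (hasFDerivAt_id t)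
          ((contDiff_face (n := n) (r := m) j).differentiable (by simp) h).hasFDerivAt
    rw [this.fderiv]
    rfl
  have d2 : fderiv ℝ (fun y : (Fin m → ℝ) × MatTuple n (m + 1) => faceGauge j y.2) (t, h) (a, u) =
      fderiv ℝ (faceGauge j) h u := by
    have : HasFDerivAt (fun y : (Fin m → ℝ) × MatTuple n (m + 1) => faceGauge j y.2)
      ((fderiv ℝ (faceGauge j) h) ∘L (ContinuousLinearMap.snd ℝ _ _)) (t, h) :=
      HasFDerivAt.comp (g := faceGauge j) (f := Prod.snd) (t, h)
        ((contDiff_faceGauge (n := n) j).differentiable (by simp) h).hasFDerivAt hasFDerivAt_snd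
    rw [this.fderiv]
    rfl
  have d3 : ∀ i : Fin (m + 1),
      fderiv ℝ (fun h : MatTuple n (m + 1) => nerveSection h (j.succAbove i)) h u =
      fderiv ℝ (fun h : MatTuple n m => nerveSection h i) (face j h) (fderiv ℝ (face j) h u) *
        faceGauge j h + nerveSection (face j h) i * fderiv ℝ (faceGauge j) h u := by
    intro i
    simp only [nerveSection_succAbove]
    have e1 : HasFDerivAt (fun h : MatTuple n (m + 1) => nerveSection (face j h) i) _ h :=
      ((contDiff_pi.1 (contDiff_nerveSection n m) i).differentiable (by simp)
        (face j h)).hasFDerivAt.comp h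
        ((contDiff_face (n := n) (r := m) j).differentiable (by simp) h).hasFDerivAt
    have e2 := ((contDiff_faceGauge (n := n) j).differentiable (by simp) h).hasFDerivAt
    refine (congrArg (fun L : MatTuple n (m + 1) →L[ℝ] Mat n => L u) (e1.mul' e2).fderiv).trans ?_
    simp [add_comm]
  rw [ContinuousLinearMap.comp_apply, (fderiv_prodMap_coface j (t, h)).fderiv,
    ContinuousLinearMap.comp_apply, d1, Function.comp_apply, Function.comp_apply,
    nerveConnection_apply, nerveConnection_apply]
  simp only [Prod.map_apply, id_eq, ContinuousLinearMap.coe_prodMap']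
  rw [bary_coface, Fin.sum_univ_succAbove _ j]
  have hu := isUnit_faceGauge j hh
  -- With s the section and g the gauge factor, (sg)⁻¹ d(sg) = g⁻¹(s⁻¹ds)g + g⁻¹dg. The weights add
  -- up to 1, so g⁻¹dg appears exactly once in the sum.
  have e : ∀ i : Fin (m + 1), j.insertNth (α := fun _ => ℝ) 0 (bary t) (j.succAbove i) •
      (Ring.inverse (nerveSection h (j.succAbove i)) *
        fderiv ℝ (fun h : MatTuple n (m + 1) => nerveSection h (j.succAbove i)) h u) =
      Ring.inverse (faceGauge j h) * (bary t i • (Ring.inverse (nerveSection (face j h) i) *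
        fderiv ℝ (fun h : MatTuple n m => nerveSection h i) (face j h)
          (fderiv ℝ (face j) h u))) * faceGauge j h +
      bary t i • (Ring.inverse (faceGauge j h) * fderiv ℝ (faceGauge j) h u) := by
    intro i
    have hs : IsUnit (nerveSection (face j h) i) := nerveSection_mem (face_mem_invTuples hh j) i
    rw [Fin.insertNth_apply_succAbove, d3, nerveSection_succAbove]
    obtain ⟨a, ha⟩ := hs
    obtain ⟨b, hb⟩ := hu
    rw [← ha, ← hb, ← Units.val_mul, Ring.inverse_unit, Ring.inverse_unit, Ring.inverse_unit,
      mul_inv_rev, Units.val_mul, mul_smul_comm, smul_mul_assoc, ← smul_add]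
    congr 1
    simp only [mul_add, mul_assoc, Units.inv_mul_cancel_left]
  rw [Fin.insertNth_apply_same, zero_smul, zero_add]
  refine (Finset.sum_congr rfl fun i _ => e i).trans ?_
  rw [Finset.sum_add_distrib, ← Finset.sum_smul, sum_bary, one_smul, ← Finset.sum_mul,
    ← Finset.mul_sum]
  congr 2
  exact d2.symm

end ChernForms

/-! ### The forms ω_m and their differentials. -/

section ChernFormDifferential

open MeasureTheory

variable {n : ℕ}

theorem nerveConnection_fst {m : ℕ} (y : (Fin m → ℝ) × MatTuple n m) (a : Fin m → ℝ) :
    nerveConnection n m y (a, 0) = 0 := by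
  rw [nerveConnection_apply]
  simp

/-- The connection vanishes identically on the directions of the simplex, and so do its derivatives
there; hence every curvature factor contains at most one dt. -/
theorem curvature_nerveConnection_fst {m : ℕ} {y : (Fin m → ℝ) × MatTuple n m}
    (hy : y.2 ∈ invTuples n m) (a b : Fin m → ℝ) :
    curvature (nerveConnection n m) y (a, 0) (b, 0) = 0 := by
  have h1 : DifferentiableAt ℝ (nerveConnection n m) y :=
    ((contDiffOn_nerveConnection n m).differentiableOn (by simp)).differentiableAt
      ((isOpen_univ_prod_invTuples m m).mem_nhds ⟨trivial, hy⟩)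
  have h2 : ∀ (a : Fin m → ℝ) u, fderiv ℝ (nerveConnection n m) y u (a, 0) = 0 := fun a u => by
    have h3 := (h1.hasFDerivAt.clm_apply (hasFDerivAt_const (a, (0 : MatTuple n m)) y)).fderiv
    have h4 : fderiv ℝ (fun y => nerveConnection n m y (a, 0)) y = 0 := by
      simp only [nerveConnection_fst]
      simp
    have h5 := congrArg (fun L : (Fin m → ℝ) × MatTuple n m →L[ℝ] Mat n => L u) (h3.symm.trans h4)
    simpa using h5
  simp only [curvature, h2, nerveConnection_fst]
  simp

/-- Among the `2p` vectors of a term of the Chern–Weil form, more than `p` vectors tangent to the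
simplex cannot be in different factors. -/
theorem nerveChernWeil_simplexFrame {p m k : ℕ} (hm : p < m) (h : 2 * p = m + k)
    {y : (Fin m → ℝ) × MatTuple n m} (hy : y.2 ∈ invTuples n m) (v : Fin k → MatTuple n m) :
    nerveChernWeil n p m y (simplexFrame m h v) = 0 := by
  rw [nerveChernWeil, chernWeilForm_oneForm_apply (isOpen_univ_prod_invTuples m m)
    (contDiffOn_nerveConnection n m) ⟨trivial, hy⟩, Finset.sum_eq_zero, smul_zero, smul_zero]
  intro σ _
  -- `g a` is the curvature factor whose arguments include the a-th simplex direction. For m > p two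
  -- directions share a factor, which is then zero.
  let g : Fin m → Fin p := fun a =>
    ⟨(σ.symm (Fin.cast h.symm (Fin.castAdd k a)) : ℕ) / 2, by omega⟩
  obtain ⟨a, b, hab, hg⟩ : ∃ a b, a ≠ b ∧ g a = g b :=
    Fintype.exists_ne_map_eq_of_card_lt g (by simpa using hm)
  have hv : ∀ c : Fin m, ∀ i : Fin (2 * p), i = σ.symm (Fin.cast h.symm (Fin.castAdd k c)) →
      (simplexFrame m h v ∘ σ) i = (Pi.single c 1, 0) := by
    rintro c i rfl
    rw [Function.comp_apply, Equiv.apply_symm_apply, simplexFrame_castAdd]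
  have hne : (σ.symm (Fin.cast h.symm (Fin.castAdd k a)) : ℕ) ≠
      σ.symm (Fin.cast h.symm (Fin.castAdd k b)) := fun h' => hab <| by
    have := σ.symm.injective (Fin.ext h')
    simpa using this
  have hg' : (σ.symm (Fin.cast h.symm (Fin.castAdd k a)) : ℕ) / 2 =
      (σ.symm (Fin.cast h.symm (Fin.castAdd k b)) : ℕ) / 2 := congrArg Fin.val hg
  rw [pairProd_eq_zero _ p _ (g a), map_zero, smul_zero]
  rcases lt_or_gt_of_ne hne with hlt | hlt
  · rw [hv a _ (Fin.ext (by simp only [g]; omega)), hv b _ (Fin.ext (by simp only [g]; omega))]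
    exact curvature_nerveConnection_fst hy _ _
  · rw [hv b _ (Fin.ext (by simp only [g]; omega)), hv a _ (Fin.ext (by simp only [g]; omega))]
    exact curvature_nerveConnection_fst hy _ _

theorem contDiffOn_nerveChernWeil_simplex (p m : ℕ) :
    ContDiffOn ℝ ∞ (nerveChernWeil n p m) (simplex m ×ˢ invTuples n m) :=
  (contDiffOn_nerveChernWeil n p m).mono (Set.prod_mono (Set.subset_univ _) le_rfl)

theorem fiberIntegral_nerveChernWeil {p m k : ℕ} (h : 2 * p = m + k) {x : MatTuple n m}
    (hx : x ∈ invTuples n m) (v : Fin k → MatTuple n m) :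
    fiberIntegral m k (castDegree h (nerveChernWeil n p m)) x v =
      ∫ t in simplex m, nerveChernWeil n p m (t, x) (simplexFrame m h v) := by
  rw [fiberIntegral_apply (contDiffOn_castDegree h
    (contDiffOn_nerveChernWeil_simplex p m)).continuousOn hx]
  simp only [contractSimplex_castDegree]

/-- The convention that ω_m is zero outside 1 ≤ m ≤ p agrees with the integral: for m = 0 the form
has positive degree on a point, and for m > p it vanishes by `nerveChernWeil_simplexFrame`. Stokes'
theorem thus applies uniformly, including at the ends of the range. -/
theorem chernForm_eq_fiberIntegral {p m k : ℕ} (hp : 1 ≤ p) (h : 2 * p = m + k) {x : MatTuple n m}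
    (hx : x ∈ invTuples n m) :
    chernForm n p m k x = fiberIntegral m k (castDegree h (nerveChernWeil n p m)) x := by
  by_cases hm : 1 ≤ m ∧ m ≤ p
  · rw [chernForm, dif_pos ⟨hm.1, hm.2, h⟩]
    refine fiberIntegral_congr fun t _ => ?_
    ext v
    rw [castDegree_apply, castDegree_apply, pullback_chernFormTotal (y := (t, x)) hx]
  · rw [chernForm, dif_neg fun h' => hm ⟨h'.1, h'.2.1⟩]
    ext v
    rw [fiberIntegral_nerveChernWeil h hx]
    refine (setIntegral_eq_zero_of_forall_eq_zero fun t _ => ?_).symm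
    rcases Nat.eq_zero_or_pos m with rfl | hm'
    · exact (nerveChernWeil n p 0 (t, x)).map_coord_zero ⟨0, by omega⟩ (Subsingleton.elim _ _)
    · exact nerveChernWeil_simplexFrame (by omega) h hx v

theorem chernForm_eq_zero {p m k : ℕ} (h : ¬ (1 ≤ m ∧ m ≤ p ∧ 2 * p = m + k)) :
    chernForm n p m k = 0 := dif_neg h

theorem contDiffOn_chernForm (n p m k : ℕ) : ContDiffOn ℝ ∞ (chernForm n p m k) (invTuples n m) := by
  by_cases h : 1 ≤ m ∧ m ≤ p ∧ 2 * p = m + k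
  · exact (contDiffOn_fiberIntegral (isOpen_invTuples n m) (contDiffOn_castDegree h.2.2
      (contDiffOn_nerveChernWeil_simplex p m))).congr fun x hx =>
        chernForm_eq_fiberIntegral (h.1.trans h.2.1) h.2.2 hx
  · rw [chernForm_eq_zero h]
    exact contDiffOn_const

theorem contDiffOn_pullback {E F : Type} [NormedAddCommGroup E] [NormedSpace ℝ E]
    [FiniteDimensional ℝ E] [NormedAddCommGroup F] [NormedSpace ℝ F] {s : ℕ} {f : E → F}
    (hf : ContDiff ℝ ∞ f) {α : DiffForm F ℂ s} {O : Set F} (hα : ContDiffOn ℝ ∞ α O) {S : Set E}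
    (hS : Set.MapsTo f S O) : ContDiffOn ℝ ∞ (pullback f α) S :=
  contDiffOn_form fun v => contDiffOn_form_apply (F := fun z => α (f z))
    (w := fun i z => fderiv ℝ f z (v i)) (hα.comp hf.contDiffOn hS) fun i =>
      ((hf.fderiv_right (m := ∞) (by simp)).clm_apply contDiff_const).contDiffOn

/-- Identifies the boundary terms of Stokes' theorem: restriction to a face becomes pull-back by
`face j`, which commutes with integration along the fibre. -/
theorem integral_coface_nerveChernWeil {p m k : ℕ} (hp : 1 ≤ p) (h : 2 * p = m + (k + 1))
    {x : MatTuple n (m + 1)} (hx : x ∈ invTuples n (m + 1)) (j : Fin (m + 2))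
    (v : Fin (k + 1) → MatTuple n (m + 1)) :
    (∫ t in simplex m, nerveChernWeil n p (m + 1) (coface j t, x) fun i =>
      (cofaceLin j).prodMap (ContinuousLinearMap.id ℝ (MatTuple n (m + 1)))
        (simplexFrame m h v i)) = pullback (face j) (chernForm n p m (k + 1)) x v := by
  have hf := face_mem_invTuples hx j
  have h1 := pullback_fiberIntegral (contDiffOn_castDegree h
    (contDiffOn_nerveChernWeil_simplex (n := n) p m)).continuousOn
    ((contDiff_face (n := n) (r := m) j).differentiable (by simp)) hf
  have h2 : pullback (face j) (chernForm n p m (k + 1)) x =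
      pullback (face j) (fiberIntegral m (k + 1) (castDegree h (nerveChernWeil n p m))) x := by
    rw [pullback, pullback, chernForm_eq_fiberIntegral hp h hf]
  have h3 : ContinuousOn (castDegree h (pullback (Prod.map (coface j) id)
      (nerveChernWeil n p (m + 1)))) (simplex m ×ˢ invTuples n (m + 1)) := by
    refine (contDiffOn_castDegree h (n := ∞) (contDiffOn_pullback
      ((contDiff_coface j).prodMap contDiff_id) (contDiffOn_nerveChernWeil n p (m + 1))
      fun z hz => ?_)).continuousOn
    exact ⟨trivial, hz.2⟩
  have h4 : fiberIntegral m (k + 1) (pullback (Prod.map id (face j))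
      (castDegree h (nerveChernWeil n p m))) x = fiberIntegral m (k + 1) (castDegree h
        (pullback (Prod.map (coface j) id) (nerveChernWeil n p (m + 1)))) x := by
    refine fiberIntegral_congr fun t _ => ?_
    ext v
    rw [castDegree_apply, pullback_coface_nerveChernWeil j (z := (t, x)) hx, pullback, pullback,
      ContinuousAlternatingMap.compContinuousLinearMap_apply, castDegree_apply]
    rfl
  rw [h2, h1, h4, fiberIntegral_apply h3 hx]
  refine setIntegral_congr_fun (isClosed_simplex m).measurableSet fun t _ => ?_
  rw [contractSimplex_castDegree, pullback, (fderiv_prodMap_coface j (t, x)).fderiv]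
  rfl

/-- The forms `ω_m` are the components of a cocycle. -/
theorem extDeriv_chernForm {p m k : ℕ} (hp : 1 ≤ p) {x : MatTuple n (m + 1)}
    (hx : x ∈ invTuples n (m + 1)) :
    extDeriv (chernForm n p (m + 1) k) x = (-1 : ℂ) ^ m • ∑ i ∈ Finset.range (m + 2),
      (-1 : ℂ) ^ i • pullback (face i) (chernForm n p m (k + 1)) x := by
  by_cases h : 2 * p = m + 1 + k
  · have h2 : 2 * p = m + (k + 1) := by omega
    have hα := contDiffOn_nerveChernWeil_simplex (n := n) p (m + 1)
    have hO := isOpen_invTuples n (m + 1)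
    have e1 : extDeriv (chernForm n p (m + 1) k) x =
        extDeriv (fiberIntegral (m + 1) k (castDegree h (nerveChernWeil n p (m + 1)))) x := by
      have : fderiv ℝ (chernForm n p (m + 1) k) x =
        fderiv ℝ (fiberIntegral (m + 1) k (castDegree h (nerveChernWeil n p (m + 1)))) x := by
        refine Filter.EventuallyEq.fderiv_eq ?_
        filter_upwards [hO.mem_nhds hx] with y hy
        exact chernForm_eq_fiberIntegral hp h hy
      rw [extDeriv, extDeriv, this]
    ext v
    -- Stokes for the Chern–Weil form: the left side vanishes by closedness, and the right side
    -- consists of the face terms and (-1)^{m+1} dω_{m+1}.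
    have h3 := integral_extDerivWithin_simplexFrame (q := m) (s := k + 1) (by omega) h2 hO hα hx v
    rw [sum_integral_fderivWithin_frame (q := m + 1) (s := k) (by omega) h hO hα hx v] at h3
    have h4 : ∫ t in simplex (m + 1), extDerivWithin (nerveChernWeil n p (m + 1))
        (simplex (m + 1) ×ˢ invTuples n (m + 1)) (t, x)
        (simplexFrame (m + 1) (by omega : 2 * p + 1 = m + 1 + (k + 1)) v) = 0 := by
      refine setIntegral_eq_zero_of_forall_eq_zero fun t ht => ?_
      have h5 : DifferentiableAt ℝ (nerveChernWeil n p (m + 1)) (t, x) :=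
        ((contDiffOn_nerveChernWeil n p (m + 1)).differentiableOn (by simp)).differentiableAt
          ((isOpen_univ_prod_invTuples _ _).mem_nhds ⟨trivial, hx⟩)
      have h6 : extDeriv (nerveChernWeil n p (m + 1)) (t, x) = 0 :=
        extDeriv_chernWeilForm (isOpen_univ_prod_invTuples _ _) (contDiffOn_nerveConnection n _)
          ⟨trivial, hx⟩ traceCLM_mul_comm p
      have h7 : extDerivWithin (nerveChernWeil n p (m + 1))
          (simplex (m + 1) ×ˢ invTuples n (m + 1)) (t, x) =
          extDeriv (nerveChernWeil n p (m + 1)) (t, x) := by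
        rw [extDerivWithin, extDeriv, h5.fderivWithin
          (((uniqueDiffOn_simplex _).prod hO.uniqueDiffOn) _ ⟨ht, hx⟩)]
      rw [h7, h6]
      rfl
    rw [h4] at h3
    simp only [integral_coface_nerveChernWeil hp h2 hx] at h3
    rw [e1, ContinuousAlternatingMap.smul_apply, ContinuousAlternatingMap.sum_apply,
      Finset.sum_range, smul_eq_mul]
    simp only [ContinuousAlternatingMap.smul_apply, smul_eq_mul]
    have h8 : ((-1 : ℂ) ^ m) * (-1 : ℂ) ^ m = 1 := by rw [← mul_pow]; simp
    rw [pow_succ] at h3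
    linear_combination (-1 : ℂ) ^ m * h3 - (extDeriv (fiberIntegral (m + 1) k
      (castDegree h (nerveChernWeil n p (m + 1)))) x v) * h8
  -- If the degrees do not add up to 2p, both sides are zero.
  · rw [chernForm_eq_zero fun h' => h (by omega), chernForm_eq_zero fun h' => h (by omega)]
    have h1 : ∀ i, pullback (face i) (0 : DiffForm (MatTuple n m) ℂ (k + 1)) x = 0 := fun i => rfl
    simp only [h1, smul_zero, Finset.sum_const_zero]
    ext v
    simp only [extDeriv, fderiv_zero]
    simp [ContinuousAlternatingMap.alternatizeUncurryFin_apply]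

end ChernFormDifferential

/-! ### Stokes' theorem for the integrals of g^* ω_m. -/

section ChernIntegral

open MeasureTheory

theorem castDegree_pullbackWithin_chernForm {n p q k s m : ℕ} {E : Type} [NormedAddCommGroup E]
    [NormedSpace ℝ E] {g : (Fin q → ℝ) × E → MatTuple n m} (h : k = s)
    (S : Set ((Fin q → ℝ) × E)) :
    castDegree h (pullbackWithin g S (chernForm n p m k)) =
      pullbackWithin g S (chernForm n p m s) := by
  subst h
  rfl

variable {n p : ℕ} {E F : Type} [NormedAddCommGroup E] [NormedSpace ℝ E] [FiniteDimensional ℝ E]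
  [NormedAddCommGroup F] [NormedSpace ℝ F] [FiniteDimensional ℝ F]

/-- The integral along `Δ^q` of the pull-back of `ω_m` by a map `g : Δ^q × E → G^m`. -/
noncomputable def chernIntegral (n p q s : ℕ) {m : ℕ} (g : (Fin q → ℝ) × E → MatTuple n m) :
    DiffForm E ℂ s :=
  fiberIntegral q s (pullbackWithin g (simplex q ×ˢ Set.univ) (chernForm n p m (q + s)))

/-- The differential of `chernIntegral`, with the degree of the result prescribed. -/
noncomputable def chernIntegralD (n p q : ℕ) {m : ℕ} (g : (Fin q → ℝ) × E → MatTuple n m) :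
    (s : ℕ) → DiffForm E ℂ s
  | 0 => 0
  | s + 1 => extDeriv (chernIntegral n p q s g)

section

variable {q s k m : ℕ} {W : Set E} {x : E}
  {g : (Fin q → ℝ) × E → MatTuple n m}

theorem contDiffOn_chernIntegral (hW : IsOpen W) (hg : ContDiffOn ℝ ∞ g (simplex q ×ˢ W))
    (hgO : ∀ z ∈ simplex q ×ˢ W, g z ∈ invTuples n m) :
    ContDiffOn ℝ ∞ (chernIntegral n p q s g) W :=
  contDiffOn_fiberIntegral hW (contDiffOn_pullbackWithin hW hg (contDiffOn_chernForm n p m _) hgO)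

theorem chernIntegral_congr (hW : IsOpen W) (hx : x ∈ W) {g' : (Fin q → ℝ) × E → MatTuple n m}
    (h : Set.EqOn g g' (simplex q ×ˢ W)) :
    chernIntegral n p q s g x = chernIntegral n p q s g' x :=
  fiberIntegral_congr fun _ ht => pullbackWithin_congr hW _ h ⟨ht, hx⟩

theorem chernIntegral_apply (hW : IsOpen W) (hx : x ∈ W) (hg : ContDiffOn ℝ ∞ g (simplex q ×ˢ W))
    (hgO : ∀ z ∈ simplex q ×ˢ W, g z ∈ invTuples n m) (h : k = q + s) (v : Fin s → E) :
    chernIntegral n p q s g x v = ∫ t in simplex q,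
      pullbackWithin g (simplex q ×ˢ Set.univ) (chernForm n p m k) (t, x)
        (simplexFrame q h v) := by
  rw [chernIntegral, fiberIntegral_apply
    (contDiffOn_pullbackWithin hW hg (contDiffOn_chernForm n p m _) hgO).continuousOn hx]
  simp only [← castDegree_pullbackWithin_chernForm h, contractSimplex_castDegree]

theorem pullback_chernIntegral (hW : IsOpen W) (hg : ContDiffOn ℝ ∞ g (simplex q ×ˢ W))
    (hgO : ∀ z ∈ simplex q ×ˢ W, g z ∈ invTuples n m) {φ : F → E} (hφ : ContDiff ℝ ∞ φ)
    {W' : Set F} (hW' : IsOpen W') (hφm : Set.MapsTo φ W' W) {y : F} (hy : y ∈ W') :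
    pullback φ (chernIntegral n p q s g) y = chernIntegral n p q s (g ∘ Prod.map id φ) y := by
  refine (pullback_fiberIntegral (contDiffOn_pullbackWithin hW hg (contDiffOn_chernForm n p m _)
    hgO).continuousOn (hφ.differentiable (by simp)) (hφm hy)).trans ?_
  exact fiberIntegral_congr fun t ht => pullback_prodMap_pullbackWithin hW hW' hg contDiff_id hφ
    (Set.mapsTo_id _) hφm _ ⟨ht, hy⟩

end

section

variable {q s k m : ℕ} {W : Set E} {x : E}
  {g : (Fin q → ℝ) × E → MatTuple n (m + 1)}

/-- First evaluation of the integral of d(g^* ω_{m+1}): d commutes with pull-back, and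
`extDeriv_chernForm` expresses dω_{m+1} by the faces of ω_m. -/
theorem integral_extDerivWithin_pullback_chernForm (hW : IsOpen W) (hx : x ∈ W) (hp : 1 ≤ p)
    (hg : ContDiffOn ℝ ∞ g (simplex q ×ˢ W))
    (hgO : ∀ z ∈ simplex q ×ˢ W, g z ∈ invTuples n (m + 1)) (h : k + 1 = q + s) (v : Fin s → E) :
    ∫ t in simplex q, extDerivWithin (pullbackWithin g (simplex q ×ˢ Set.univ)
      (chernForm n p (m + 1) k)) (simplex q ×ˢ W) (t, x) (simplexFrame q h v) =
    (-1 : ℂ) ^ m * ∑ i ∈ Finset.range (m + 2),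
      (-1 : ℂ) ^ i * chernIntegral n p q s (face i ∘ g) x v := by
  have hf : ∀ i, ContDiffOn ℝ ∞ (face i ∘ g) (simplex q ×ˢ W) := fun i =>
    (contDiff_face i).comp_contDiffOn hg
  have hfO : ∀ i, ∀ z ∈ simplex q ×ˢ W, (face i ∘ g) z ∈ invTuples n m := fun i z hz =>
    face_mem_invTuples (hgO z hz) i
  have hint : ∀ i, IntegrableOn (fun t => pullbackWithin (face i ∘ g) (simplex q ×ˢ Set.univ)
      (chernForm n p m (k + 1)) (t, x) (simplexFrame q h v)) (simplex q) := fun i =>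
    integrableOn_slice (isCompact_simplex q) (F := fun z => pullbackWithin (face i ∘ g)
      (simplex q ×ˢ Set.univ) (chernForm n p m (k + 1)) z (simplexFrame q h v))
      (contDiffOn_form_apply (w := fun i _ => simplexFrame q h v i) (contDiffOn_pullbackWithin hW
        (hf i) (contDiffOn_chernForm n p m _) (hfO i)) fun _ => contDiffOn_const).continuousOn hx
  simp only [chernIntegral_apply hW hx (hf _) (hfO _) h, ← integral_const_mul]
  rw [← integral_finsetSum _ fun i _ => (hint i).const_mul _, ← integral_const_mul]
  refine setIntegral_congr_fun (isClosed_simplex q).measurableSet fun t ht => ?_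
  rw [extDerivWithin_pullbackWithin hW hg (isOpen_invTuples n (m + 1))
    (contDiffOn_chernForm n p (m + 1) k) hgO ⟨ht, hx⟩, pullbackWithin,
    extDeriv_chernForm hp (hgO _ ⟨ht, hx⟩)]
  simp only [ContinuousAlternatingMap.compContinuousLinearMap_apply,
    ContinuousAlternatingMap.smul_apply, ContinuousAlternatingMap.sum_apply, smul_eq_mul]
  congr 1
  refine Finset.sum_congr rfl fun i _ => ?_
  rw [← pullbackWithin_pullback hW hg (contDiff_face i) _ ⟨ht, hx⟩]
  rfl

theorem sum_integral_fderivWithin_pullback_chernForm (hW : IsOpen W) (hx : x ∈ W)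
    (hg : ContDiffOn ℝ ∞ g (simplex q ×ˢ W))
    (hgO : ∀ z ∈ simplex q ×ˢ W, g z ∈ invTuples n (m + 1)) (h : k + 1 = q + s) (v : Fin s → E) :
    ∑ b : Fin s, (-1 : ℂ) ^ (q + b : ℕ) * ∫ t in simplex q, fderivWithin ℝ
        (fun z => pullbackWithin g (simplex q ×ˢ Set.univ) (chernForm n p (m + 1) k) z
          ((Fin.cast h.symm (Fin.natAdd q b)).removeNth (simplexFrame q h v)))
          (simplex q ×ˢ W) (t, x) (0, v b) =
      (-1 : ℂ) ^ q * chernIntegralD n p q g s x v := by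
  cases s with
  | zero => simp [chernIntegralD]
  | succ s =>
    rw [sum_integral_fderivWithin_frame h (by omega) hW
      (contDiffOn_pullbackWithin hW hg (contDiffOn_chernForm n p _ _) hgO) hx v,
      castDegree_pullbackWithin_chernForm]
    rfl

end

/-- Stokes' theorem for `chernIntegral` over a simplex of positive dimension. -/
theorem sum_chernIntegral_face_succ {q s m : ℕ} {W : Set E} (hW : IsOpen W) {x : E} (hx : x ∈ W)
    {g : (Fin (q + 1) → ℝ) × E → MatTuple n (m + 1)} (hp : 1 ≤ p)
    (hg : ContDiffOn ℝ ∞ g (simplex (q + 1) ×ˢ W))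
    (hgO : ∀ z ∈ simplex (q + 1) ×ˢ W, g z ∈ invTuples n (m + 1)) :
    (-1 : ℂ) ^ m • ∑ i ∈ Finset.range (m + 2),
      (-1 : ℂ) ^ i • chernIntegral n p (q + 1) s (face i ∘ g) x =
    ∑ j : Fin (q + 2), (-1 : ℂ) ^ (j : ℕ) •
      chernIntegral n p q s (g ∘ Prod.map (coface j) id) x +
    (-1 : ℂ) ^ (q + 1) • chernIntegralD n p (q + 1) g s x := by
  ext v
  have h1 := integral_extDerivWithin_pullback_chernForm (k := q + s) hW hx hp hg hgO
    (by omega) v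
  -- Second evaluation of the same integral, by the boundary of the simplex and the differential on
  -- the base.
  rw [integral_extDerivWithin_simplexFrame (by omega) rfl hW
    (contDiffOn_pullbackWithin hW hg (contDiffOn_chernForm n p _ _) hgO) hx v,
    sum_integral_fderivWithin_pullback_chernForm hW hx hg hgO] at h1
  simp only [ContinuousAlternatingMap.add_apply, ContinuousAlternatingMap.smul_apply,
    ContinuousAlternatingMap.sum_apply, smul_eq_mul]
  rw [← h1]
  congr 1
  refine Finset.sum_congr rfl fun j _ => ?_
  congr 1
  have hm : Set.MapsTo (Prod.map (coface j) id) (simplex q ×ˢ W) (simplex (q + 1) ×ˢ W) :=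
    fun z hz => ⟨coface_mem_simplex j hz.1, hz.2⟩
  have hc : ContDiff ℝ ∞ (Prod.map (coface j) id : (Fin q → ℝ) × E → (Fin (q + 1) → ℝ) × E) :=
    (contDiff_coface j).prodMap contDiff_id
  rw [chernIntegral_apply hW hx (hg.comp hc.contDiffOn hm) (fun z hz => hgO _ (hm hz)) rfl]
  refine setIntegral_congr_fun (isClosed_simplex q).measurableSet fun t ht => ?_
  rw [← pullback_prodMap_pullbackWithin hW hW hg (contDiff_coface j) contDiff_id
    (fun t ht => coface_mem_simplex j ht) (Set.mapsTo_id _) _ ⟨ht, hx⟩, pullback,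
    (fderiv_prodMap_coface j (t, x)).fderiv]
  rfl

/-- Over Δ^0 there is no boundary term. Degree s = 0 is separate, since then no form of degree q + s
- 1 exists to be differentiated. -/
theorem sum_chernIntegral_face_zero {s m : ℕ} {W : Set E} (hW : IsOpen W) {x : E} (hx : x ∈ W)
    {g : (Fin 0 → ℝ) × E → MatTuple n (m + 1)} (hp : 1 ≤ p)
    (hg : ContDiffOn ℝ ∞ g (simplex 0 ×ˢ W))
    (hgO : ∀ z ∈ simplex 0 ×ˢ W, g z ∈ invTuples n (m + 1)) :
    (-1 : ℂ) ^ m • ∑ i ∈ Finset.range (m + 2),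
      (-1 : ℂ) ^ i • chernIntegral n p 0 s (face i ∘ g) x =
    chernIntegralD n p 0 g s x := by
  cases s with
  | zero =>
    -- A nonzero component of degree 0 would need 2p = m with 1 ≤ m ≤ p.
    have h1 : ∀ g : (Fin 0 → ℝ) × E → MatTuple n m, chernIntegral n p 0 0 g x = 0 := fun g => by
      rw [chernIntegral, chernForm_eq_zero (by omega)]
      refine setIntegral_eq_zero_of_forall_eq_zero fun t _ => ?_
      ext v
      rfl
    simp [h1, chernIntegralD]
  | succ s =>
    ext v
    have h1 := integral_extDerivWithin_pullback_chernForm (k := s) hW hx hp hg hgO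
      (by omega) v
    rw [integral_extDerivWithin_frame (by omega) hW
      (contDiffOn_pullbackWithin hW hg (contDiffOn_chernForm n p _ _) hgO) hx v,
      sum_integral_fderivWithin_pullback_chernForm hW hx hg hgO] at h1
    simp only [ContinuousAlternatingMap.smul_apply,
      ContinuousAlternatingMap.sum_apply, smul_eq_mul]
    rw [← h1]
    simp

end ChernIntegral

/-! ### Existence of systems of simplices. -/

section Existence

/-- Deleting a vertex other than the first from 1, h_1, h_1h_2, … gives the vertices belonging to
`face j h`. Deleting the first gives instead h_1 times the vertices belonging to `face 0 h`, which
is the exceptional case of the face condition. -/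
theorem partialProd_succAbove {M : Type} [Monoid M] {l : ℕ} {j : Fin (l + 2)} (hj : j ≠ 0)
    (h : Fin (l + 1) → M) (i : Fin (l + 1)) :
    Fin.partialProd h (j.succAbove i) = Fin.partialProd (face j h) i := by
  induction i using Fin.induction with
  | zero => rw [Fin.succAbove_ne_zero_zero hj, Fin.partialProd_zero, Fin.partialProd_zero]
  | succ a ih =>
    rw [Fin.partialProd_succ, ← ih, face]
    split_ifs with h1 h2
    · rw [Fin.succAbove_of_castSucc_lt _ _ (by simp [Fin.lt_def]; omega),
        Fin.succAbove_of_castSucc_lt _ _ (by simp [Fin.lt_def]; omega), ← Fin.succ_castSucc,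
        Fin.partialProd_succ]
    · rw [Fin.succAbove_of_le_castSucc _ _ (by simp [Fin.le_def]; omega),
        Fin.succAbove_of_castSucc_lt _ _ (by simp [Fin.lt_def]; omega), Fin.partialProd_succ,
        ← Fin.succ_castSucc, Fin.partialProd_succ, mul_assoc]
    · rw [Fin.succAbove_of_le_castSucc _ _ (by simp [Fin.le_def]; omega),
        Fin.succAbove_of_le_castSucc _ _ (by simp [Fin.le_def]; omega), Fin.partialProd_succ,
        ← Fin.succ_castSucc]

theorem contDiff_partialProd {n l : ℕ} (k : Fin (l + 1)) :
    ContDiff ℝ ∞ fun h : MatTuple n l => Fin.partialProd h k := by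
  induction k using Fin.induction with
  | zero => simpa only [Fin.partialProd_zero] using contDiff_const
  | succ a ih => simpa only [Fin.partialProd_succ] using ih.mul (contDiff_apply ℝ (Mat n) a)

theorem partialProd_one {M : Type} [Monoid M] {l : ℕ} (k : Fin (l + 1)) :
    Fin.partialProd (1 : Fin l → M) k = 1 := by
  induction k using Fin.induction with
  | zero => rfl
  | succ a ih => rw [Fin.partialProd_succ, ih, Pi.one_apply, mul_one]

/-- The domains of the affine simplices spanned by the partial products. -/
def affineDomain {n : ℕ} (U B : Set (Mat n)) : (l : ℕ) → Set (MatTuple n l)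
  | 0 => Set.univ
  | l + 1 => {h | (∀ i, h i ∈ U) ∧ (∀ k, Fin.partialProd h k ∈ B) ∧
      ∀ i : Fin (l + 2), face i h ∈ affineDomain U B l}

/-- The affine simplices with vertices `1, h_1, h_1 h_2, …, h_1 ⋯ h_l`. -/
noncomputable def affineSimplex {n : ℕ} (l : ℕ) (x : (Fin l → ℝ) × MatTuple n l) : Mat n :=
  ∑ k, bary x.1 k • Fin.partialProd x.2 k

theorem isOpen_affineDomain {n : ℕ} {U B : Set (Mat n)} (hU : IsOpen U) (hB : IsOpen B) (l : ℕ) :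
    IsOpen (affineDomain U B l) := by
  induction l with
  | zero => exact isOpen_univ
  | succ l ih =>
    have h : affineDomain U B (l + 1) = (⋂ i, (fun h : MatTuple n (l + 1) => h i) ⁻¹' U) ∩
        ((⋂ k, (fun h : MatTuple n (l + 1) => Fin.partialProd h k) ⁻¹' B) ∩
          ⋂ i : Fin (l + 2), face i ⁻¹' affineDomain U B l) := by
      ext h
      simp [affineDomain]
    rw [h]
    exact (isOpen_iInter_of_finite fun i => hU.preimage (continuous_apply i)).inter
      ((isOpen_iInter_of_finite fun k => hB.preimage (contDiff_partialProd k).continuous).inter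
        (isOpen_iInter_of_finite fun i => ih.preimage (contDiff_face (n := n) i).continuous))

theorem one_mem_affineDomain {n : ℕ} {U B : Set (Mat n)} (hU : 1 ∈ U) (hB : 1 ∈ B) (l : ℕ) :
    1 ∈ affineDomain U B l := by
  induction l with
  | zero => trivial
  | succ l ih =>
    refine ⟨fun _ => hU, fun k => ?_, fun i => ?_⟩
    · rwa [partialProd_one]
    · rwa [face_one]

theorem bary_mem {q : ℕ} {t : Fin q → ℝ} (ht : t ∈ simplex q) (i : Fin (q + 1)) : 0 ≤ bary t i := by
  refine Fin.cases ?_ (fun i => ?_) i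
  · simpa [bary] using ht.2
  · simpa [bary] using ht.1 i

theorem affineSimplex_coface {n l : ℕ} (t : Fin l → ℝ) (h : MatTuple n (l + 1)) (j : Fin (l + 2)) :
    affineSimplex (l + 1) (coface j t, h) =
      if j = 0 then h 0 * affineSimplex l (t, face 0 h) else affineSimplex l (t, face j h) := by
  rw [affineSimplex, bary_coface, Fin.sum_univ_succAbove _ j, Fin.insertNth_apply_same, zero_smul,
    zero_add]
  simp only [Fin.insertNth_apply_succAbove]
  split_ifs with hj
  · subst hj
    rw [affineSimplex, Finset.mul_sum]
    refine Finset.sum_congr rfl fun i _ => ?_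
    rw [Fin.succAbove_zero, Fin.partialProd_succ', mul_smul_comm]
    rfl
  · simp only [partialProd_succAbove hj, affineSimplex]

/-- Convexity of a ball around 1 inside U keeps the affine simplices in U as soon as their vertices
lie in the ball. The recursive definition of `affineDomain` makes the domains stable under faces. -/
theorem nonempty_simplexFamily {n : ℕ} {U : Set (Mat n)} (hU : IsOpen U) (h1 : 1 ∈ U) :
    Nonempty (SimplexFamily n U) := by
  obtain ⟨ε, hε, hεU⟩ := Metric.isOpen_iff.1 hU 1 h1
  have hB : (1 : Mat n) ∈ Metric.ball (1 : Mat n) ε := Metric.mem_ball_self hε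
  have hp : ∀ l, ∀ h ∈ affineDomain U (Metric.ball (1 : Mat n) ε) l, ∀ k,
      Fin.partialProd h k ∈ Metric.ball (1 : Mat n) ε := by
    intro l h hh k
    cases l with
    | zero =>
      rw [Fin.fin_one_eq_zero k, Fin.partialProd_zero]
      exact hB
    | succ l => exact hh.2.1 k
  refine ⟨{ W := affineDomain U (Metric.ball 1 ε)
            isOpen_W := isOpen_affineDomain hU Metric.isOpen_ball
            one_mem_W := one_mem_affineDomain h1 hB
            W_subset := ?_
            face_mem_W := fun l h hh i hi => hh.2.2 ⟨i, by omega⟩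
            σ := affineSimplex
            contDiffOn_σ := fun l => ?_
            σ_mem := fun l t ht h hh => hεU ?_
            σ_zero := fun t _ h _ => ?_
            σ_face := fun l t _ h _ j => affineSimplex_coface t h j }⟩
  · intro l h hh i
    cases l with
    | zero => exact i.elim0
    | succ l => exact hh.1 i
  · refine (ContDiff.sum fun k _ => ?_).contDiffOn
    exact ((contDiff_bary k).comp contDiff_fst).smul ((contDiff_partialProd k).comp contDiff_snd)
  · exact (convex_ball (1 : Mat n) ε).sum_mem (fun i _ => bary_mem ht i) (sum_bary t)
      fun i _ => hp l h hh i
  · have : bary t 0 = 1 := by simp [bary]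
    change ∑ k : Fin 1, bary t k • Fin.partialProd h k = 1
    rw [Fin.sum_univ_one, this, one_smul, Fin.partialProd_zero]

end Existence

/-! ### The cancellation scheme, and the faces of the maps f_{m,q}. -/

section Transgression

/-- The bookkeeping of the double complex, with m one less than in f_{m,q}. `P m q i` stands for the
integral of f ∘ ε_i, `K m q i` for that of ε_i ∘ f, `C` for the 0-th face of the simplex, `A` for
the whole boundary and `X` for the differential; `hX` is Stokes' theorem. The low faces in `K` and
the faces j ≥ 1 in `A` together cancel all of `P`, the terms `C` cancel between `K` and `A`, and
only the last faces remain. -/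
theorem sum_transgression {M : Type} [AddCommGroup M] [Module ℂ M] (R : ℕ) (P K : ℕ → ℕ → ℕ → M)
    (A C X : ℕ → ℕ → M) (w : M)
    (hX : ∀ m q, m + q = R + 1 → X m q =
      (-1 : ℂ) ^ q • ((-1 : ℂ) ^ m • ∑ i ∈ Finset.range (m + 2), (-1 : ℂ) ^ i • K m q i - A m q))
    (hK0 : ∀ i, K 0 (R + 1) i = 0)
    (hKP : ∀ m q i, m + q = R → i ≤ m → K (m + 1) q i = P m q i)
    (hKC : ∀ m q, m + q = R → K (m + 1) q (m + 1) = C m q)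
    (hKl : ∀ m q, m + (q + 1) = R → K (m + 1) (q + 1) (m + 2) = 0)
    (hKw : K (R + 1) 0 (R + 2) = w) (hA0 : A (R + 1) 0 = 0)
    (hA : ∀ m q, m + q = R → A m (q + 1) = C m q -
      ∑ j ∈ Finset.range (q + 1), (-1 : ℂ) ^ j • P m q (m + 1 + j)) :
    ∑ i ∈ Finset.range (R + 2), (-1 : ℂ) ^ i • ∑ x ∈ Finset.HasAntidiagonal.antidiagonal R,
      (-1 : ℂ) ^ (x.1 + 1) • P x.1 x.2 i +
    (-1 : ℂ) ^ (R + 1) • ∑ x ∈ Finset.HasAntidiagonal.antidiagonal (R + 1), (-1 : ℂ) ^ (x.1 + 1) • X x.1 x.2 =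
      w := by
  have hs : ∀ a : ℕ, (-1 : ℂ) ^ a * (-1 : ℂ) ^ a = 1 := fun a => by rw [← mul_pow]; simp
  have h1 : (-1 : ℂ) ^ (R + 1) • ∑ x ∈ Finset.HasAntidiagonal.antidiagonal (R + 1),
      (-1 : ℂ) ^ (x.1 + 1) • X x.1 x.2 = ∑ x ∈ Finset.HasAntidiagonal.antidiagonal (R + 1), A x.1 x.2 -
      ∑ x ∈ Finset.HasAntidiagonal.antidiagonal (R + 1), (-1 : ℂ) ^ x.1 •
        ∑ i ∈ Finset.range (x.1 + 2), (-1 : ℂ) ^ i • K x.1 x.2 i := by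
    rw [Finset.smul_sum, ← Finset.sum_sub_distrib]
    refine Finset.sum_congr rfl fun x hx => ?_
    have hx' := Finset.HasAntidiagonal.mem_antidiagonal.1 hx
    rw [hX _ _ hx', smul_smul, smul_smul, ← hx']
    have : (-1 : ℂ) ^ (x.1 + x.2) * (-1) ^ (x.1 + 1) * (-1) ^ x.2 = -1 := by
      rw [pow_add, pow_succ]
      linear_combination (-(-1 : ℂ) ^ x.2 * (-1 : ℂ) ^ x.2) * hs x.1 - hs x.2
    rw [this, neg_one_smul, neg_sub]
  have h2 : ∑ i ∈ Finset.range (R + 2), (-1 : ℂ) ^ i • ∑ x ∈ Finset.HasAntidiagonal.antidiagonal R,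
      (-1 : ℂ) ^ (x.1 + 1) • P x.1 x.2 i = ∑ x ∈ Finset.HasAntidiagonal.antidiagonal R, (-1 : ℂ) ^ (x.1 + 1) •
        ∑ i ∈ Finset.range (R + 2), (-1 : ℂ) ^ i • P x.1 x.2 i := by
    simp only [Finset.smul_sum]
    rw [Finset.sum_comm]
    exact Finset.sum_congr rfl fun x _ => Finset.sum_congr rfl fun i _ => smul_comm _ _ _
  -- The terms `A m (q + 1)` and `K (m + 1) q` are both indexed by m + q = R; the end terms `A (R +
  -- 1) 0` and `K 0 (R + 1)` split off and vanish.
  rw [h1, h2, Finset.Nat.sum_antidiagonal_succ' (f := fun x => A x.1 x.2),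
    Finset.Nat.sum_antidiagonal_succ, hA0]
  simp only [hK0, smul_zero, Finset.sum_const_zero, zero_add]
  rw [← add_sub_assoc, ← Finset.sum_add_distrib, ← Finset.sum_sub_distrib]
  refine (Finset.sum_congr (g := fun x : ℕ × ℕ => K (x.1 + 1) x.2 (x.1 + 2)) rfl
    fun x hx => ?_).trans ?_
  · obtain ⟨m, q⟩ := x
    have hx' : m + q = R := Finset.HasAntidiagonal.mem_antidiagonal.1 hx
    have e1 : ∑ i ∈ Finset.range (m + 1), (-1 : ℂ) ^ i • K (m + 1) q i =
        ∑ i ∈ Finset.range (m + 1), (-1 : ℂ) ^ i • P m q i :=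
      Finset.sum_congr rfl fun i hi => by
        rw [hKP m q i hx' (by have := Finset.mem_range.1 hi; omega)]
    have e2 : ∑ j ∈ Finset.range (q + 1), (-1 : ℂ) ^ (m + 1 + j) • P m q (m + 1 + j) =
        (-1 : ℂ) ^ (m + 1) • ∑ j ∈ Finset.range (q + 1), (-1 : ℂ) ^ j • P m q (m + 1 + j) := by
      simp only [Finset.smul_sum, smul_smul, pow_add]
    have e5 : ∑ i ∈ Finset.range (m + 1 + 2), (-1 : ℂ) ^ i • K (m + 1) q i =
        ∑ i ∈ Finset.range (m + 1), (-1 : ℂ) ^ i • P m q i + (-1 : ℂ) ^ (m + 1) • C m q +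
          (-1 : ℂ) ^ (m + 1 + 1) • K (m + 1) q (m + 2) := by
      rw [show m + 1 + 2 = m + 1 + 1 + 1 from rfl, Finset.sum_range_succ, Finset.sum_range_succ, e1,
        hKC m q hx']
    have e3 : R + 2 = (m + 1) + (q + 1) := by omega
    dsimp only
    rw [e3, Finset.sum_range_add, e2, hA m q hx', e5]
    simp only [smul_add, smul_smul, hs, one_smul]
    have e4 : (-1 : ℂ) ^ (m + 1) * (-1) ^ (m + 1 + 1) = -1 := by
      rw [pow_succ _ (m + 1), ← mul_assoc, hs, one_mul]
    rw [e4, neg_one_smul]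
    abel
  -- Last faces do not depend on the simplex, so only the one over Δ^0 contributes.
  · rw [Finset.sum_eq_single (R, 0)]
    · exact hKw
    · rintro ⟨m, q⟩ hx hne
      have hx' : m + q = R := Finset.HasAntidiagonal.mem_antidiagonal.1 hx
      cases q with
      | zero => exact absurd (by simpa using hx') (fun h : m = R => hne (by rw [h]))
      | succ q => exact hKl m q hx'
    · intro h
      exact absurd (Finset.HasAntidiagonal.mem_antidiagonal.2 (by simp)) h

variable {n r : ℕ}

/-- The entries of a tuple, continued by `1`. -/
noncomputable def entry (h : MatTuple n r) (i : ℕ) : Mat n := if hi : i < r then h ⟨i, hi⟩ else 1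

/-- The entries of a tuple from the index `m` on. -/
noncomputable def tailFrom (m q : ℕ) (h : MatTuple n r) : MatTuple n q := fun j => entry h (m + j)

theorem contDiff_entry (i : ℕ) : ContDiff ℝ ∞ fun h : MatTuple n r => entry h i := by
  unfold entry
  split_ifs
  · exact contDiff_apply ℝ (Mat n) _
  · exact contDiff_const

theorem contDiff_tailFrom (m q : ℕ) :
    ContDiff ℝ ∞ (tailFrom m q : MatTuple n r → MatTuple n q) :=
  contDiff_pi.2 fun _ => contDiff_entry _

theorem entry_one (i : ℕ) : entry (1 : MatTuple n r) i = 1 := by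
  unfold entry
  split_ifs <;> rfl

theorem isUnit_entry {h : MatTuple n r} (hh : h ∈ invTuples n r) (i : ℕ) : IsUnit (entry h i) := by
  unfold entry
  split_ifs
  · exact hh _
  · exact isUnit_one

theorem entry_face (i : ℕ) (h : MatTuple n (r + 1)) {k : ℕ} (hk : k < r) :
    entry (face i h) k = if k + 1 < i then entry h k else
      if k + 1 = i then entry h k * entry h (k + 1) else entry h (k + 1) := by
  unfold entry face
  simp [hk, Nat.lt_succ_of_lt hk]

theorem tailFrom_face_of_le {i m q : ℕ} (hi : i ≤ m) (hr : m + q = r) (h : MatTuple n (r + 1)) :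
    tailFrom m q (face i h) = tailFrom (m + 1) q h := by
  funext j
  rw [tailFrom, tailFrom, entry_face _ _ (by omega), if_neg (by omega), if_neg (by omega)]
  congr 1
  omega

theorem tailFrom_face_add {j m q : ℕ} (hr : m + q = r) (h : MatTuple n (r + 1)) :
    tailFrom m q (face (m + 1 + j) h) = face (j + 1) (tailFrom m (q + 1) h) := by
  funext k
  rw [tailFrom, entry_face _ _ (by omega), face]
  simp only [tailFrom, Fin.val_castSucc, Fin.val_succ]
  have e1 : m + (k : ℕ) + 1 < m + 1 + j ↔ (k : ℕ) + 1 < j + 1 := by omega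
  have e2 : m + (k : ℕ) + 1 = m + 1 + j ↔ (k : ℕ) + 1 = j + 1 := by omega
  simp only [e1, e2, ← add_assoc]

theorem face_zero_tailFrom {m q : ℕ} (h : MatTuple n r) :
    face 0 (tailFrom m (q + 1) h) = tailFrom (m + 1) q h := by
  funext k
  simp only [face, tailFrom, Fin.val_succ]
  rw [if_neg (by omega), if_neg (by omega)]
  congr 1
  omega

namespace SimplexFamily

variable {U : Set (Mat n)} (S : SimplexFamily n U)

/-- An open neighbourhood of `1 ∈ G^r` on which all `f_{m,q}` are defined. -/
def domain (r : ℕ) : Set (MatTuple n r) :=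
  {h | h ∈ invTuples n r ∧ ∀ m q, m + q = r → tailFrom m q h ∈ S.W q}

theorem isOpen_domain (r : ℕ) : IsOpen (S.domain r) := by
  have h : S.domain r = invTuples n r ∩
      ⋂ q : Fin (r + 1), tailFrom (r - q) q ⁻¹' S.W q := by
    ext h
    simp only [domain, Set.mem_ofPred_eq, Set.mem_inter_iff, Set.mem_iInter, Set.mem_preimage]
    refine and_congr_right fun _ => ⟨fun h q => h _ _ (by omega), fun h m q hq => ?_⟩
    have := h ⟨q, by omega⟩
    rwa [show r - q = m by omega] at this
  rw [h]
  exact (isOpen_invTuples n r).inter (isOpen_iInter_of_finite fun q =>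
    (S.isOpen_W q).preimage (contDiff_tailFrom _ _).continuous)

theorem one_mem_domain (r : ℕ) : 1 ∈ S.domain r := by
  refine ⟨fun _ => isUnit_one, fun m q _ => ?_⟩
  have : tailFrom m q (1 : MatTuple n r) = 1 := funext fun j => entry_one _
  rw [this]
  exact S.one_mem_W q

/-- A face operator of index at most m only shifts the tail starting at m, while one of larger index
acts on the tail by a face operator, under which the domains `S.W` are stable. -/
theorem face_mem_domain {h : MatTuple n (r + 1)} (hh : h ∈ S.domain (r + 1)) {i : ℕ}
    (hi : i ≤ r + 1) : face i h ∈ S.domain r := by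
  refine ⟨face_mem_invTuples hh.1 i, fun m q hq => ?_⟩
  rcases le_or_gt i m with him | him
  · rw [tailFrom_face_of_le him hq]
    exact hh.2 _ _ (by omega)
  · obtain ⟨j, rfl⟩ : ∃ j, i = m + 1 + j := ⟨i - (m + 1), by omega⟩
    rw [tailFrom_face_add hq]
    exact S.face_mem_W _ _ (hh.2 _ _ (by omega)) _ (by omega)

/-- The map `f_{m+1,q}`, defined for all `r`. -/
noncomputable def fExt (m q : ℕ) (x : (Fin q → ℝ) × MatTuple n r) : MatTuple n (m + 1) :=
  Fin.snoc (α := fun _ => Mat n) (fun i : Fin m => entry x.2 i) (S.σ q (x.1, tailFrom m q x.2))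

theorem f_eq_fExt {m q : ℕ} (hr : m + q = r) : S.f hr = S.fExt m q := by
  subst hr
  funext x
  have h1 : (fun j : Fin q => x.2 (Fin.cast rfl (Fin.natAdd m j))) = tailFrom m q x.2 :=
    funext fun j => by simp [tailFrom, entry]; rfl
  have h2 : (fun i : Fin m => x.2 (Fin.cast rfl (Fin.castAdd q i))) = fun i : Fin m => entry x.2 i :=
    funext fun i => by
      have : (i : ℕ) < m + q := by omega
      simp only [entry, this, dif_pos]
      rfl
  rw [f, fExt, h1, h2]

theorem contDiffOn_fExt {m q : ℕ} (hr : m + q = r) :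
    ContDiffOn ℝ ∞ (S.fExt m q) (simplex q ×ˢ S.domain r) := by
  refine contDiffOn_pi.2 fun i => ?_
  refine Fin.lastCases ?_ (fun i => ?_) i
  · simp only [fExt, Fin.snoc_last]
    exact (S.contDiffOn_σ q).comp ((contDiff_fst.prodMk
      ((contDiff_tailFrom m q).comp contDiff_snd)).contDiffOn) fun x hx => ⟨hx.1, hx.2.2 m q hr⟩
  · simp only [fExt, Fin.snoc_castSucc]
    exact ((contDiff_entry _).comp contDiff_snd).contDiffOn

theorem fExt_mem (hUG : ∀ h ∈ U, IsUnit h) {m q : ℕ} (hr : m + q = r) :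
    ∀ z ∈ simplex q ×ˢ S.domain r, S.fExt m q z ∈ invTuples n (m + 1) := by
  intro z hz i
  refine Fin.lastCases ?_ (fun i => ?_) i
  · simp only [fExt, Fin.snoc_last]
    exact hUG _ (S.σ_mem q _ hz.1 _ (hz.2.2 m q hr))
  · simp only [fExt, Fin.snoc_castSucc]
    exact isUnit_entry hz.2.1 _

/-- These faces involve only the entries in front of σ, so the argument of σ stays the same. -/
theorem face_fExt_of_le {m q i : ℕ} (hr : m + q = r) (hi : i ≤ m)
    (z : (Fin q → ℝ) × MatTuple n (r + 1)) :
    face i (S.fExt (m + 1) q z) = S.fExt m q (Prod.map id (face i) z) := by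
  funext k
  refine Fin.lastCases ?_ (fun k => ?_) k
  · rw [face, if_neg (by simp; omega), if_neg (by simp; omega), Fin.succ_last]
    simp only [fExt, Fin.snoc_last, id_eq, Prod.map_fst, Prod.map_snd,
      tailFrom_face_of_le hi hr]
  · rw [face, Fin.succ_castSucc]
    simp only [fExt, Fin.snoc_castSucc, Prod.map_snd, Fin.val_castSucc, Fin.val_succ]
    rw [entry_face _ _ (by omega)]

/-- Here the last entry in front of σ is multiplied into it, which by the condition on the 0-th face
of σ gives a face of the simplex one dimension up. These terms cancel against the boundary terms j =
0. -/
theorem face_fExt_self {m q : ℕ} (hr : m + q = r) {z : (Fin q → ℝ) × MatTuple n (r + 1)}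
    (hz : z ∈ simplex q ×ˢ S.domain (r + 1)) :
    face (m + 1) (S.fExt (m + 1) q z) = S.fExt m (q + 1) (Prod.map (coface 0) id z) := by
  funext k
  refine Fin.lastCases ?_ (fun k => ?_) k
  · rw [face, if_neg (by simp), if_pos (by simp), Fin.succ_last]
    simp only [fExt, Fin.snoc_last, Fin.snoc_castSucc, Prod.map_fst, Prod.map_snd, id_eq]
    rw [S.σ_face q _ hz.1 _ (hz.2.2 m (q + 1) (by omega)), if_pos rfl, face_zero_tailFrom]
    simp [tailFrom]
  · rw [face, if_pos (by simp)]
    simp only [fExt, Fin.snoc_castSucc, Prod.map_snd, id_eq, Fin.val_castSucc]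

theorem face_fExt_last {m q : ℕ} (z : (Fin q → ℝ) × MatTuple n r) :
    face (m + 2) (S.fExt (m + 1) q z) = fun k : Fin (m + 1) => entry z.2 k := by
  funext k
  rw [face, if_pos (by omega)]
  simp [fExt]

/-- The condition on σ for j ≥ 1: a face of the simplex is a face operator on the group entries
after position m. -/
theorem fExt_coface_succ {m q : ℕ} (hr : m + q = r) (j : Fin (q + 1))
    {z : (Fin q → ℝ) × MatTuple n (r + 1)} (hz : z ∈ simplex q ×ˢ S.domain (r + 1)) :
    S.fExt m (q + 1) (Prod.map (coface j.succ) id z) =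
      S.fExt m q (Prod.map id (face (m + 1 + j)) z) := by
  simp only [fExt, Prod.map_fst, Prod.map_snd, id_eq]
  rw [S.σ_face q _ hz.1 _ (hz.2.2 m (q + 1) (by omega)), if_neg (Fin.succ_ne_zero j),
    tailFrom_face_add hr, Fin.val_succ]
  congr 1
  funext k
  rw [entry_face _ _ (by omega), if_pos (by omega)]

end SimplexFamily

end Transgression

/-! ### The total differential of η near 1. -/

section TransgressionForms

variable {n p r : ℕ} {E : Type} [NormedAddCommGroup E] [NormedSpace ℝ E]

theorem extDeriv_sum_smul {F : Type} [NormedAddCommGroup F] [NormedSpace ℝ F] {ι : Type}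
    {s : ℕ} (I : Finset ι) (c : ι → ℂ) (α : ι → DiffForm F ℂ s) {x : F}
    (hα : ∀ i ∈ I, DifferentiableAt ℝ (α i) x) :
    extDeriv (∑ i ∈ I, c i • α i) x = ∑ i ∈ I, c i • extDeriv (α i) x := by
  have h1 : HasFDerivAt (∑ i ∈ I, c i • α i) (∑ i ∈ I, c i • fderiv ℝ (α i) x) x :=
    HasFDerivAt.sum fun i hi => (hα i hi).hasFDerivAt.const_smul (c i)
  have h2 : extDeriv (∑ i ∈ I, c i • α i) x = ContinuousAlternatingMap.alternatizeUncurryFinCLM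
      ℝ F ℂ (∑ i ∈ I, c i • fderiv ℝ (α i) x) := by
    rw [extDeriv, h1.fderiv]
    rfl
  rw [h2, map_sum]
  refine Finset.sum_congr rfl fun i _ => ?_
  ext v
  simp [extDeriv, ContinuousAlternatingMap.alternatizeUncurryFin_apply, Finset.mul_sum]

theorem pullback_sum_smul {F : Type} [NormedAddCommGroup F] [NormedSpace ℝ F] {ι : Type}
    {s : ℕ} (I : Finset ι) (c : ι → ℂ) (α : ι → DiffForm F ℂ s) (f : E → F) (x : E) :
    pullback f (∑ i ∈ I, c i • α i) x = ∑ i ∈ I, c i • pullback f (α i) x := by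
  ext v
  simp only [pullback, ContinuousAlternatingMap.compContinuousLinearMap_apply, Finset.sum_apply,
    ContinuousAlternatingMap.sum_apply, ContinuousAlternatingMap.smul_apply, Pi.smul_apply]

theorem chernIntegral_of_base_zero {q s : ℕ} (g : (Fin q → ℝ) × E → MatTuple n 0) (x : E) :
    chernIntegral n p q s g x = 0 := by
  rw [chernIntegral, chernForm_eq_zero (by omega)]
  exact MeasureTheory.setIntegral_eq_zero_of_forall_eq_zero fun t _ => by ext v; rfl

theorem chernIntegral_snd {s : ℕ} (x : MatTuple n r) :
    chernIntegral n p 0 s (fun z : (Fin 0 → ℝ) × MatTuple n r => z.2) x = chernForm n p r s x := by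
  ext v
  have h : s = 0 + s := (zero_add s).symm
  have h0 : (0 : Fin 0 → ℝ) ∈ simplex 0 := ⟨fun i => i.elim0, by simp⟩
  have h1 : fderivWithin ℝ (fun z : (Fin 0 → ℝ) × MatTuple n r => z.2)
      (simplex 0 ×ˢ Set.univ) (0, x) = ContinuousLinearMap.snd ℝ _ _ :=
    hasFDerivAt_snd.hasFDerivWithinAt.fderivWithin
      (uniqueDiffOn_simplex_prod_univ 0 _ ⟨h0, trivial⟩)
  rw [chernIntegral, fiberIntegral_zero, ← castDegree_pullbackWithin_chernForm h,
    contractSimplex_castDegree, pullbackWithin, h1,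
    ContinuousAlternatingMap.compContinuousLinearMap_apply]
  congr 1

namespace SimplexFamily

variable {U : Set (Mat n)} (S : SimplexFamily n U)

theorem eta_eq_sum (s : ℕ) : S.eta p r s = ∑ x ∈ Finset.HasAntidiagonal.antidiagonal r,
    (-1 : ℂ) ^ (x.1 + 1) • chernIntegral n p x.2 s (S.fExt x.1 x.2 (r := r)) := by
  rw [eta, ← Finset.sum_coe_sort (Finset.HasAntidiagonal.antidiagonal r) fun x =>
    (-1 : ℂ) ^ (x.1 + 1) • chernIntegral n p x.2 s (S.fExt x.1 x.2 (r := r))]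
  refine Finset.sum_congr rfl fun x _ => ?_
  rw [beta, f_eq_fExt]
  rfl

theorem contDiffOn_eta (hUG : ∀ h ∈ U, IsUnit h) (s : ℕ) : ContDiffOn ℝ ∞ (S.eta p r s) (S.domain r) := by
  rw [eta_eq_sum]
  refine ContDiffOn.congr (f := fun y => ∑ x ∈ Finset.HasAntidiagonal.antidiagonal r,
    (-1 : ℂ) ^ (x.1 + 1) • chernIntegral n p x.2 s (S.fExt x.1 x.2 (r := r)) y)
    (ContDiffOn.sum fun x hx => ?_) fun y _ => by simp only [Finset.sum_apply, Pi.smul_apply]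
  have hr := Finset.HasAntidiagonal.mem_antidiagonal.1 hx
  exact (contDiffOn_chernIntegral (S.isOpen_domain r) (S.contDiffOn_fExt hr)
    (S.fExt_mem hUG hr)).const_smul _

theorem pullback_face_eta (hUG : ∀ h ∈ U, IsUnit h) {x : MatTuple n (r + 1)}
    (hx : x ∈ S.domain (r + 1)) {i : ℕ} (hi : i ≤ r + 1) (s : ℕ) : pullback (face i) (S.eta p r s) x =
      ∑ a ∈ Finset.HasAntidiagonal.antidiagonal r, (-1 : ℂ) ^ (a.1 + 1) •
        chernIntegral n p a.2 s (S.fExt a.1 a.2 ∘ Prod.map id (face i)) x := by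
  rw [eta_eq_sum, pullback_sum_smul]
  refine Finset.sum_congr rfl fun a ha => ?_
  have hr := Finset.HasAntidiagonal.mem_antidiagonal.1 ha
  rw [pullback_chernIntegral (S.isOpen_domain r) (S.contDiffOn_fExt hr) (S.fExt_mem hUG hr)
    (contDiff_face i) (S.isOpen_domain (r + 1)) (fun h hh => S.face_mem_domain hh hi) hx]

theorem extDeriv_eta (hUG : ∀ h ∈ U, IsUnit h) {x : MatTuple n r} (hx : x ∈ S.domain r) (s : ℕ) :
    extDeriv (S.eta p r s) x = ∑ a ∈ Finset.HasAntidiagonal.antidiagonal r, (-1 : ℂ) ^ (a.1 + 1) •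
      chernIntegralD n p a.2 (S.fExt a.1 a.2 (r := r)) (s + 1) x := by
  rw [eta_eq_sum, extDeriv_sum_smul _ _ _ fun a ha => ?_]
  · rfl
  · have hr := Finset.HasAntidiagonal.mem_antidiagonal.1 ha
    exact ((contDiffOn_chernIntegral (S.isOpen_domain r) (S.contDiffOn_fExt hr)
      (S.fExt_mem hUG hr)).differentiableOn (by simp)).differentiableAt
      ((S.isOpen_domain r).mem_nhds hx)

/-- Near `1`, the total differential of `η` is `ω_1 + ⋯ + ω_p`. -/
theorem sum_pullback_eta_add (hUG : ∀ h ∈ U, IsUnit h) (hp : 1 ≤ p) {x : MatTuple n (r + 1)}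
    (hx : x ∈ S.domain (r + 1)) (s : ℕ) :
    ∑ i ∈ Finset.range (r + 2), (-1 : ℂ) ^ i • pullback (face i) (S.eta p r s) x +
      (-1 : ℂ) ^ (r + 1) • ∑ a ∈ Finset.HasAntidiagonal.antidiagonal (r + 1), (-1 : ℂ) ^ (a.1 + 1) •
        chernIntegralD n p a.2 (S.fExt a.1 a.2 (r := r + 1)) s x = chernForm n p (r + 1) s x := by
  have hO := S.isOpen_domain (r + 1)
  have h1 : ∑ i ∈ Finset.range (r + 2), (-1 : ℂ) ^ i • pullback (face i) (S.eta p r s) x =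
      ∑ i ∈ Finset.range (r + 2), (-1 : ℂ) ^ i •
        ∑ a ∈ Finset.HasAntidiagonal.antidiagonal r, (-1 : ℂ) ^ (a.1 + 1) •
          chernIntegral n p a.2 s (S.fExt a.1 a.2 ∘ Prod.map id (face i)) x :=
    Finset.sum_congr rfl fun i hi => by
      rw [S.pullback_face_eta hUG hx (by have := Finset.mem_range.1 hi; omega)]
  rw [h1]
  -- `A m 0` is set to zero since Δ^0 has no boundary; for q > 0 it is the alternating sum over the
  -- faces of Δ^q.
  refine sum_transgression r
    (fun m q i => chernIntegral n p q s (S.fExt m q (r := r) ∘ Prod.map id (face i)) x)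
    (fun m q i => chernIntegral n p q s (face i ∘ S.fExt m q (r := r + 1)) x)
    (fun m q => match q with
      | 0 => 0
      | q + 1 => ∑ j : Fin (q + 2), (-1 : ℂ) ^ (j : ℕ) •
          chernIntegral n p q s (S.fExt m (q + 1) (r := r + 1) ∘ Prod.map (coface j) id) x)
    (fun m q => chernIntegral n p q s (S.fExt m (q + 1) (r := r + 1) ∘ Prod.map (coface 0) id) x)
    (fun m q => chernIntegralD n p q (S.fExt m q (r := r + 1)) s x) _
    ?_ ?_ ?_ ?_ ?_ ?_ ?_ ?_
  · intro m q hr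
    cases q with
    | zero =>
      dsimp only
      rw [sum_chernIntegral_face_zero hO hx hp (S.contDiffOn_fExt hr) (S.fExt_mem hUG hr)]
      simp
    | succ q =>
      dsimp only
      rw [sum_chernIntegral_face_succ hO hx hp (S.contDiffOn_fExt hr) (S.fExt_mem hUG hr),
        add_sub_cancel_left, smul_smul, ← mul_pow]
      simp
  · exact fun i => chernIntegral_of_base_zero _ _
  · exact fun m q i hr hi => chernIntegral_congr hO hx fun z hz => S.face_fExt_of_le hr hi z
  · exact fun m q hr => chernIntegral_congr hO hx fun z hz => S.face_fExt_self hr hz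
  · intro m q hr
    -- The last face forgets σ and with it the simplex variable, so its fibre integral over a
    -- simplex of positive dimension vanishes.
    have h2 : ContDiff ℝ ∞ fun (h : MatTuple n (r + 1)) (k : Fin (m + 1)) => entry h k :=
      contDiff_pi.2 fun k => contDiff_entry _
    exact fiberIntegral_eq_zero_of_snd isOpen_univ
      (f := fun (h : MatTuple n (r + 1)) (k : Fin (m + 1)) => entry h k)
      (h2.differentiable (by simp)).differentiableOn (fun z _ => S.face_fExt_last z) _
      (Set.mem_univ x)
  · refine (chernIntegral_congr hO hx fun z _ => ?_).trans (chernIntegral_snd x)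
    rw [Function.comp_apply, S.face_fExt_last]
    funext k
    exact dif_pos k.2
  · rfl
  · intro m q hr
    dsimp only
    rw [Fin.sum_univ_succ, Finset.sum_range, sub_eq_add_neg, ← Finset.sum_neg_distrib]
    congr 1
    · simp
    · refine Finset.sum_congr rfl fun j _ => ?_
      rw [Fin.val_succ, pow_succ, mul_neg_one, neg_smul]
      congr 2
      exact chernIntegral_congr hO hx fun z hz => S.fExt_coface_succ hr j hz

end SimplexFamily

end TransgressionForms

end Nerve

/-! ### Passage to germs, and the theorem. -/

section Germs

variable {n p : ℕ}

/-- The germs at `1` of a family of forms. -/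
noncomputable def BiForm.ofForms (α : (r s : ℕ) → DiffForm (MatTuple n r) ℂ s)
    (hα : ∀ r s, SmoothNear 1 (α r s)) : BiForm n :=
  ⟨fun r s => ⟨Germ.ofFun (α r s), α r s, hα r s, rfl⟩⟩

theorem smoothNear_of_contDiffOn {E : Type} [NormedAddCommGroup E] [NormedSpace ℝ E] {s : ℕ}
    {α : DiffForm E ℂ s} {O : Set E} (hO : IsOpen O) (hα : ContDiffOn ℝ ∞ α O) {x : E}
    (hx : x ∈ O) : SmoothNear x α := by
  filter_upwards [hO.mem_nhds hx] with y hy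
  exact hα.contDiffAt (hO.mem_nhds hy)

theorem smoothNear_chernForm (m k : ℕ) : SmoothNear 1 (chernForm n p m k) :=
  smoothNear_of_contDiffOn (isOpen_invTuples n m) (contDiffOn_chernForm n p m k)
    fun _ => isUnit_one

theorem coe_dHor_ofForms {α : (r s : ℕ) → DiffForm (MatTuple n r) ℂ s}
    (hα : ∀ r s, SmoothNear 1 (α r s)) (r s : ℕ) :
    (dHor n (BiForm.ofForms α hα) (r + 1) s).1 = Germ.ofFun fun x =>
      ∑ i ∈ Finset.range (r + 2), (-1 : ℂ) ^ i • pullback (face i) (α r s) x := by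
  change Submodule.subtype _ (∑ i ∈ Finset.range (r + 2),
    (-1 : ℂ) ^ i • facePullback n r s i (BiForm.ofForms α hα r s)) = _
  rw [map_sum]
  have h : (fun x => ∑ i ∈ Finset.range (r + 2), (-1 : ℂ) ^ i • pullback (face i) (α r s) x) =
      ∑ i ∈ Finset.range (r + 2), (-1 : ℂ) ^ i •
        (pullback (face i) (α r s) : DiffForm (MatTuple n (r + 1)) ℂ s) := by
    funext x
    simp only [Finset.sum_apply, Pi.smul_apply]
  rw [h]
  exact (map_sum (Germ.coeAddHom (M := MatTuple n (r + 1) [⋀^Fin s]→L[ℝ] ℂ)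
    (𝓝 (1 : MatTuple n (r + 1)))) _ _).symm

theorem coe_dVert_ofForms {α : (r s : ℕ) → DiffForm (MatTuple n r) ℂ s}
    (hα : ∀ r s, SmoothNear 1 (α r s)) (r s : ℕ) :
    (dVert n (BiForm.ofForms α hα) r (s + 1)).1 = Germ.ofFun fun x =>
      (-1 : ℂ) ^ r • extDeriv (α r s) x := rfl

variable {U : Set (Mat n)} (S : SimplexFamily n U)

theorem SimplexFamily.smoothNear_eta (hUG : ∀ h ∈ U, IsUnit h) (r s : ℕ) :
    SmoothNear 1 (S.eta p r s) :=
  smoothNear_of_contDiffOn (S.isOpen_domain r) (S.contDiffOn_eta hUG s) (S.one_mem_domain r)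

theorem SimplexFamily.eta_eq_zero {r s : ℕ} (h : r + s + 1 ≠ 2 * p) : S.eta p r s = 0 := by
  rw [S.eta_eq_sum]
  refine Finset.sum_eq_zero fun x hx => ?_
  have hr := Finset.HasAntidiagonal.mem_antidiagonal.1 hx
  have h1 : chernIntegral n p x.2 s (S.fExt x.1 x.2 (r := r)) = 0 := by
    funext y
    rw [chernIntegral, chernForm_eq_zero (by omega)]
    exact MeasureTheory.setIntegral_eq_zero_of_forall_eq_zero fun t _ => by ext v; rfl
  rw [h1, smul_zero]

/-- An equality of all components, including the form degrees ≥ p of η: the components below p make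
the truncation of η closed, the others compute its image under the boundary map. -/
theorem SimplexFamily.totalD_eta (hUG : ∀ h ∈ U, IsUnit h) (hp : 1 ≤ p) :
    totalD n (BiForm.ofForms (S.eta p) (S.smoothNear_eta hUG)) =
      BiForm.ofForms (chernForm n p) smoothNear_chernForm := by
  refine BiForm.ext' fun r s => Subtype.ext ?_
  change (dHor n (BiForm.ofForms (S.eta p) (S.smoothNear_eta hUG)) r s).1 +
    (dVert n (BiForm.ofForms (S.eta p) (S.smoothNear_eta hUG)) r s).1 =
      Germ.ofFun (chernForm n p r s)
  cases r with
  | zero =>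
    -- Over the point G^0 there is no d', forms of positive degree are zero, and ω_0 = 0.
    rw [chernForm_eq_zero (by omega)]
    change (0 : Germ _ _) + _ = _
    rw [zero_add]
    cases s with
    | zero => rfl
    | succ s =>
      rw [coe_dVert_ofForms]
      congr 1
      funext x
      ext v
      have : extDeriv (S.eta p 0 s) x v = 0 :=
        (extDeriv (S.eta p 0 s) x).map_coord_zero 0 (Subsingleton.elim _ _)
      simp [this]
  | succ r =>
    rw [coe_dHor_ofForms]
    cases s with
    | zero =>
      change _ + (0 : Germ _ _) = _
      rw [add_zero]
      refine Germ.coe_eq.2 ?_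
      filter_upwards [(S.isOpen_domain (r + 1)).mem_nhds (S.one_mem_domain (r + 1))] with x hx
      rw [← S.sum_pullback_eta_add hUG hp hx 0]
      simp [chernIntegralD]
    | succ s =>
      rw [coe_dVert_ofForms]
      refine Germ.coe_eq.2 ?_
      filter_upwards [(S.isOpen_domain (r + 1)).mem_nhds (S.one_mem_domain (r + 1))] with x hx
      rw [← S.sum_pullback_eta_add hUG hp hx (s + 1), ← S.extDeriv_eta hUG hx]

end Germs

/-- Needed with `l'` free because 2p is not syntactically a successor of 2p - 1. -/
theorem exists_cocycles_of_succ_eq (n p l l' : ℕ) (hl : l + 1 = l') (y w : BiForm n)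
    (hy : ∀ r s, r + s ≠ l → y r s = 0) (hw : ∀ r s, s < p → w r s = 0) (h : totalD n y = w) :
    ∃ (η : cochains n (Set.Iio p) l) (w' : cochains n (Set.Ici p) l')
      (hη : (truncatedLoc n p).d l (l + 1) η = 0)
      (hw' : (filteredLoc n p).d l' (l' + 1) w' = 0),
      (∀ r s, s < p → η.1 r s = y r s) ∧ w'.1 = w ∧
      boundaryMap n p l l' hl (cohomologyClass (truncatedLoc n p) l η hη) =
        cohomologyClass (filteredLoc n p) l' w' hw' := by
  subst hl
  exact exists_cocycles n p l y w hy hw h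

end SimplicialDeRham

theorem mainTheorem2 (n p : ℕ) (hp : 1 ≤ p) (U : Set (SimplicialDeRham.Mat n)) (hU : IsOpen U)
    (h1 : 1 ∈ U) (hUG : ∀ h ∈ U, IsUnit h) :
    Nonempty (SimplicialDeRham.SimplexFamily n U) ∧
    ∀ S : SimplicialDeRham.SimplexFamily n U,
      ∃ (η : SimplicialDeRham.cochains n (Set.Iio p) (2 * p - 1))
        (w : SimplicialDeRham.cochains n (Set.Ici p) (2 * p))
        (hη : (SimplicialDeRham.truncatedLoc n p).d (2 * p - 1) (2 * p - 1 + 1) η = 0)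
        (hw : (SimplicialDeRham.filteredLoc n p).d (2 * p) (2 * p + 1) w = 0),
        (∀ r s, s < p → (η.1 r s).1 = Filter.Germ.ofFun (S.eta p r s)) ∧
        (∀ m k, (w.1 m k).1 = Filter.Germ.ofFun (SimplicialDeRham.chernForm n p m k)) ∧
        SimplicialDeRham.boundaryMap n p (2 * p - 1) (2 * p) (by omega)
            (SimplicialDeRham.cohomologyClass (SimplicialDeRham.truncatedLoc n p) (2 * p - 1) η hη) =
          SimplicialDeRham.cohomologyClass (SimplicialDeRham.filteredLoc n p) (2 * p) w hw := by
  refine ⟨SimplicialDeRham.nonempty_simplexFamily hU h1, fun S => ?_⟩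
  -- The lift is the family of all `S.eta p r s`, without the restriction s < p.
  obtain ⟨η, w, hη, hw, h2, h3, h4⟩ := SimplicialDeRham.exists_cocycles_of_succ_eq n p (2 * p - 1)
    (2 * p) (by omega) (SimplicialDeRham.BiForm.ofForms (S.eta p) (S.smoothNear_eta hUG))
    (SimplicialDeRham.BiForm.ofForms (SimplicialDeRham.chernForm n p)
      SimplicialDeRham.smoothNear_chernForm)
    (fun r s hrs => Subtype.ext (congrArg Filter.Germ.ofFun (S.eta_eq_zero (by omega))))
    -- From m ≤ p and m + k = 2p it follows that k ≥ p, so ω lies in F^p.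
    (fun r s hs => Subtype.ext (congrArg Filter.Germ.ofFun
      (SimplicialDeRham.chernForm_eq_zero (by omega))))
    (S.totalD_eta hUG hp)
  refine ⟨η, w, hη, hw, fun r s hs => ?_, fun m k => ?_, h4⟩
  · rw [h2 r s hs]
    rfl
  · rw [h3]
    rfl
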